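/- Let $C=\dfrac{2+\log 4}{\log(3/2)}\approx 8.4$. Let $\mathcal A\subset\mathbb R$ be a finite set. For $n\ge 1$ and random variables $\epsilon_1,\dots,\epsilon_n$ put $$S_k=\sum_{i=1}^k\epsilon_i,\qquad W_k=S_k-\frac kn S_n\quad(0\le k\le n),\qquad \gamma=\Big(\frac1n\sum_{i=1}^n\epsilon_i^2\Big)^{1/2}\ge 0 .$$ A standard Brownian bridge $(B_t)_{0\le t\le 1}$ is a centred Gaussian process with covariance $\min(s,t)-st$ and almost surely continuous paths. A *coupling* is a probability space carrying random variables with the same joint law as $(\epsilon_1,\dots,\epsilon_n)$ together with a standard Brownian bridge $B$; in the expectations and probabilities below, $W_k$ and $\gamma$ are computed from that version of $(\epsilon_1,\dots,\epsilon_n)$. **(a)** For every $\nu>0$ there are constants $K_1,K_2,\lambda_0>0$, depending only on $\mathcal A$ and $\nu$, such that for all $n\ge1$, all $\eta\ge\nu$ and all exchangeable $\epsilon_1,\dots,\epsilon_n$ with values in $\mathcal A$ there is a coupling with $$\mathbb E\exp\Big(\lambda\max_{0\le k\le n}\big|W_k-\sqrt n\,\eta B_{k/n}\big|\Big)\le \exp(C\log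 n)\;\mathbb E\exp\Big(\frac{K_1\lambda^2S_n^2}{n}+K_2\lambda^2 n(\gamma^2-\eta^2)^2\Big)\quad\text{for all }\lambda\le\lambda_0 .$$ **(b)** If $0\notin\mathcal A$, there are constants $K_1,\lambda_0,\lambda_1>0$, depending only on $\mathcal A$, such that for all $n\ge1$ and all exchangeable $\epsilon_1,\dots,\epsilon_n$ with values in $\mathcal A$ there is a coupling with $$\mathbb E\exp\Big(\lambda\max_{0\le k\le n}\big|W_k-\sqrt n\,\gamma B_{k/n}\big|\Big)\le \exp(C\log n)\;\mathbb E\exp\Big(\frac{K_1\lambda^2S_n^2}{n}\Big)\quad\text{for all }\lambda\le\lambda_0 ,$$ and such that, if in addition $\epsilon_1,\dots,\epsilon_n$ are i.i.d. with mean zero, $$P\Big(\max_{0\le k\le n}\big|W_k-\sqrt n\,\gamma B_{k/n}\big|\ge\lambda_1^{-1}C\log n+x\Big)\le 2e^{-\lambda_1x}\quad\text{for all }x\ge0 .$$ -/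

import Mathlib

open MeasureTheory ProbabilityTheory

namespace ExchangeableEmbedding

/-- The random variables `X 0, …, X (n-1)` are exchangeable under `P`: permuting the indices does
not change the joint law. (Almost everywhere measurability of the random vector is part of
`IdentDistrib`.) -/
def Exchangeable {Ω : Type*} [MeasurableSpace Ω] {n : ℕ} (X : Fin n → Ω → ℝ)
    (P : Measure Ω) : Prop :=
  ∀ σ : Equiv.Perm (Fin n), IdentDistrib (fun ω i => X (σ i) ω) (fun ω i => X i ω) P P

/-- The random variables `X 0, …, X (n-1)` are independent and identically distributed. -/
structure IsIID {Ω : Type*} [MeasurableSpace Ω] {n : ℕ} (X : Fin n → Ω → ℝ)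
    (P : Measure Ω) : Prop where
  indep : iIndepFun X P
  identDistrib : ∀ i j, IdentDistrib (X i) (X j) P P

/-- A standard Brownian bridge on `[0,1]`: a centred Gaussian process with covariance
`min s t - s t` and almost surely continuous paths. -/
structure IsBrownianBridge {Ω : Type*} [MeasurableSpace Ω] (B : unitInterval → Ω → ℝ)
    (P : Measure Ω) : Prop where
  isGaussianProcess : IsGaussianProcess B P
  mean_eq_zero : ∀ t, P[B t] = 0
  covariance_eq : ∀ s t, cov[B s, B t; P] = min (s : ℝ) (t : ℝ) - (s : ℝ) * (t : ℝ)
  continuous_paths : ∀ᵐ ω ∂P, Continuous fun t => B t ω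

/-- `S_k`, the sum of the first `k` of the numbers `x_1, …, x_n`
(`x_i` is the entry with index `i - 1`). -/
noncomputable def partialSum {n : ℕ} (x : Fin n → ℝ) (k : ℕ) : ℝ :=
  ∑ i ∈ Finset.univ.filter (fun i : Fin n => (i : ℕ) < k), x i

/-- `W_k = S_k - (k/n) S_n`. -/
noncomputable def bridgeSum {n : ℕ} (x : Fin n → ℝ) (k : ℕ) : ℝ :=
  partialSum x k - (k : ℝ) / (n : ℝ) * partialSum x n

/-- `γ² = (1/n) ∑ x_i²`. -/
noncomputable def gammaSq {n : ℕ} (x : Fin n → ℝ) : ℝ :=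
  1 / (n : ℝ) * ∑ i, x i ^ 2

/-- `γ`, the nonnegative square root of `γ²`. -/
noncomputable def gamma {n : ℕ} (x : Fin n → ℝ) : ℝ :=
  √(gammaSq x)

/-- The time point `k/n` of `[0,1]`, for `0 ≤ k ≤ n`. -/
noncomputable def gridPoint {n : ℕ} (k : Fin (n + 1)) : unitInterval :=
  ⟨(k : ℝ) / (n : ℝ), unitInterval.div_mem (Nat.cast_nonneg _) (Nat.cast_nonneg _)
    (Nat.cast_le.mpr (Nat.lt_succ_iff.mp k.isLt))⟩

/-- `max_{0 ≤ k ≤ n} |W_k - √n η b(k/n)|`. -/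
noncomputable def maxDeviation {n : ℕ} (x : Fin n → ℝ) (η : ℝ) (b : unitInterval → ℝ) : ℝ :=
  Finset.univ.sup' Finset.univ_nonempty fun k : Fin (n + 1) =>
    |bridgeSum x (k : ℕ) - √(n : ℝ) * η * b (gridPoint k)|

/-- `(ε', B)`, defined on the probability space `(Ω', P')`, is a coupling of a version `ε'` of `ε`
with a standard Brownian bridge `B`. -/
structure IsCoupling {Ω : Type*} [MeasurableSpace Ω] {n : ℕ} (ε : Fin n → Ω → ℝ) (P : Measure Ω)
    {Ω' : Type*} [MeasurableSpace Ω'] (ε' : Fin n → Ω' → ℝ) (B : unitInterval → Ω' → ℝ)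
    (P' : Measure Ω') : Prop where
  isProbabilityMeasure : IsProbabilityMeasure P'
  identDistrib : IdentDistrib (fun ω i => ε' i ω) (fun ω i => ε i ω) P' P
  isBrownianBridge : IsBrownianBridge B P'

end ExchangeableEmbedding

open ExchangeableEmbedding

/-!
An exchangeable sequence with values in a finite set is a mixture, over its composition `m` (how
often each value occurs), of uniform arrangements of a fixed multiset. Uniform arrangements are
coupled with Brownian bridges by a dyadic construction of Komlós–Major–Tusnády type.

*The dyadic step.* Split the `N` positions in two halves. The composition of the first half is
multivariate hypergeometric, and given it both halves are independent uniform arrangements.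
Likewise, a lattice bridge is its value at the splitting time, a Gaussian variable, together with
two independent shorter bridges. It therefore suffices to couple the deviation of the first half
with one Gaussian variable and to proceed with the halves. For two types this is
`exists_hypergeom_coupling`: under the quantile coupling, an entropy inequality bounds the
exponential moments of the difference by those of the squared distance between the square root of
the Stein kernel and the standard deviation (`exists_quantile_coupling`); the Stein kernel of the
hypergeometric distribution is explicit, and its fluctuation is controlled by a Bernstein bound.
More types are handled by drawing the count of one type at a time and rotating the Gaussian
variables so that they add up to a given one (`exists_multiHypergeom_coupling`).

*The scale.* The natural scale of the coupling is the standard deviation of the population, which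
differs from `η`, and from that of either half. The price of working with `η` throughout is the
energy, which is quadratic in the sum of the values and in the difference between their second
moment and `η ^ 2` (`mul_sq_sqrt_popVar_sub_le`). The energy of a half is at most `4 / 5` of the
energy of the whole, up to fluctuations with bounded exponential moments (`energy_le_of_eq`,
`tsum_multiHypergeom_exp_sq_le`). This contraction makes room for the error at the splitting time,
so that each step costs a constant factor only (`tsum_split_le`), and the logarithmically many
steps cost a power of `N` (`exists_lattice_coupling`).

*The Brownian bridge.* The lattice bridge has the same law for all compositions, so the couplings
can be mixed over the composition (`Exchangeable.exists_isCoupling`). Replacing the lattice values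
of an independent Brownian bridge, which exists by Lévy's construction (`exists_brownianBridge`),
extends the lattice bridge to a Brownian bridge (`IsLatticeBridge.hasGaussianKernel_bridgeInterp`).
By Jensen's inequality, the power of `n` can be lowered to any positive one by restricting the range
of the exponent (`exists_isCoupling_integral_exp_le`), so that of the constant `C` only its
positivity matters.

If `0` is not a value, the scale `γ` is a function of the composition that is bounded below, and the
second part of the energy vanishes at `η = γ`. For independent centred variables, `S_n ^ 2 / n` has
a bounded exponential moment by Hoeffding's inequality, and Markov's inequality yields the tail
bound (`measureReal_le_two_mul_exp`).
-/

namespace ExchangeableEmbedding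

open Filter Set Topology
open scoped ENNReal

/-! ### The standard normal distribution -/

/-- The standard normal law. -/
noncomputable abbrev stdNormal : Measure ℝ := gaussianReal 0 1

/-- The standard normal density. -/
noncomputable abbrev normalPDF : ℝ → ℝ := gaussianPDFReal 0 1

/-- The standard normal distribution function. -/
noncomputable def normalCDF (z : ℝ) : ℝ := ∫ x in Iic z, normalPDF x

lemma normalPDF_pos (z : ℝ) : 0 < normalPDF z := gaussianPDFReal_pos _ _ _ one_ne_zero

lemma hasDerivAt_normalPDF (z : ℝ) : HasDerivAt normalPDF (-z * normalPDF z) z := by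
  have h : HasDerivAt (fun x : ℝ => (√(2 * Real.pi * ((1 : NNReal) : ℝ)))⁻¹ *
      Real.exp (-(x - 0) ^ 2 / (2 * ((1 : NNReal) : ℝ))))
      ((√(2 * Real.pi * ((1 : NNReal) : ℝ)))⁻¹ *
      (Real.exp (-(z - 0) ^ 2 / (2 * ((1 : NNReal) : ℝ))) *
        (-(2 * (z - 0) ^ 1 * 1) / (2 * ((1 : NNReal) : ℝ))))) z := by
    refine HasDerivAt.const_mul _ (HasDerivAt.exp (HasDerivAt.div_const (HasDerivAt.fun_neg ?_) _))
    simpa using ((hasDerivAt_id z).sub_const 0).fun_pow 2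
  refine h.congr_deriv ?_
  simp only [normalPDF, gaussianPDFReal]
  push_cast
  ring

lemma continuous_normalPDF : Continuous normalPDF :=
  continuous_iff_continuousAt.2 fun z => (hasDerivAt_normalPDF z).continuousAt

lemma integrable_normalPDF : Integrable normalPDF := integrable_gaussianPDFReal 0 1

lemma hasDerivAt_normalCDF (z : ℝ) : HasDerivAt normalCDF (normalPDF z) z := by
  have h : normalCDF = fun u => (∫ x in (0 : ℝ)..u, normalPDF x) + normalCDF 0 := by
    funext u
    rw [← intervalIntegral.integral_Iic_sub_Iic integrable_normalPDF.integrableOn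
      integrable_normalPDF.integrableOn]
    simp [normalCDF]
  rw [h]
  exact (intervalIntegral.integral_hasDerivAt_right
    (continuous_normalPDF.intervalIntegrable _ _)
    (continuous_normalPDF.stronglyMeasurableAtFilter _ _)
    continuous_normalPDF.continuousAt).add_const _

lemma continuous_normalCDF : Continuous normalCDF :=
  continuous_iff_continuousAt.2 fun z => (hasDerivAt_normalCDF z).continuousAt

lemma strictMono_normalCDF : StrictMono normalCDF :=
  strictMono_of_hasDerivAt_pos hasDerivAt_normalCDF normalPDF_pos

lemma stdNormal_Iic (z : ℝ) : stdNormal (Iic z) = ENNReal.ofReal (normalCDF z) :=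
  gaussianReal_apply_eq_integral 0 one_ne_zero _

lemma normalCDF_nonneg (z : ℝ) : 0 ≤ normalCDF z :=
  integral_nonneg fun x => (normalPDF_pos x).le

lemma stdNormal_real_Iic (z : ℝ) : stdNormal.real (Iic z) = normalCDF z := by
  rw [measureReal_def, stdNormal_Iic, ENNReal.toReal_ofReal (normalCDF_nonneg z)]

lemma normalCDF_le_one (z : ℝ) : normalCDF z ≤ 1 := by
  rw [← stdNormal_real_Iic]
  exact measureReal_le_one

lemma normalCDF_pos (z : ℝ) : 0 < normalCDF z :=
  (normalCDF_nonneg (z - 1)).trans_lt (strictMono_normalCDF (by linarith))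

/-- Chernoff bound for the lower Gaussian tail. -/
lemma normalCDF_le_exp (t z : ℝ) (ht : 0 ≤ t) : normalCDF z ≤ Real.exp (t * z + t ^ 2 / 2) := by
  rw [← stdNormal_real_Iic]
  have h := measure_le_le_exp_mul_mgf (μ := stdNormal) (X := fun x => x) (t := -t) z (by linarith)
    (integrable_exp_mul_gaussianReal _)
  rw [mgf_fun_id_gaussianReal, ← Real.exp_add] at h
  refine h.trans (Real.exp_le_exp.2 (le_of_eq ?_))
  push_cast
  ring

/-- Chernoff bound for the upper Gaussian tail. -/
lemma one_sub_normalCDF_le_exp (t z : ℝ) (ht : 0 ≤ t) :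
    1 - normalCDF z ≤ Real.exp (-(t * z) + t ^ 2 / 2) := by
  have h0 : 1 - normalCDF z = stdNormal.real (Iic z)ᶜ := by
    rw [probReal_compl_eq_one_sub measurableSet_Iic, stdNormal_real_Iic]
  have h := measure_ge_le_exp_mul_mgf (μ := stdNormal) (X := fun x => x) (t := t) z ht
    (integrable_exp_mul_gaussianReal _)
  rw [mgf_fun_id_gaussianReal, ← Real.exp_add] at h
  rw [h0]
  refine (measureReal_mono (fun x hx => ?_)).trans (h.trans (Real.exp_le_exp.2 (le_of_eq ?_)))
  · rw [mem_compl_iff, mem_Iic, not_le] at hx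
    exact hx.le
  · push_cast
    ring

lemma exists_normalCDF_eq {u : ℝ} (h0 : 0 < u) (h1 : u < 1) : ∃ z, normalCDF z = u := by
  have hb : ∃ a, normalCDF a ≤ u := by
    refine ⟨Real.log u - 1, (normalCDF_le_exp 1 _ zero_le_one).trans ?_⟩
    calc Real.exp (1 * (Real.log u - 1) + 1 ^ 2 / 2) ≤ Real.exp (Real.log u) :=
          Real.exp_le_exp.2 (by linarith)
      _ = u := Real.exp_log h0
  have ht : ∃ b, u ≤ normalCDF b := by
    refine ⟨-Real.log (1 - u) + 1, ?_⟩
    have h := one_sub_normalCDF_le_exp 1 (-Real.log (1 - u) + 1) zero_le_one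
    have : Real.exp (-(1 * (-Real.log (1 - u) + 1)) + 1 ^ 2 / 2) ≤ 1 - u := by
      calc _ ≤ Real.exp (Real.log (1 - u)) := Real.exp_le_exp.2 (by linarith)
        _ = 1 - u := Real.exp_log (by linarith)
    linarith
  obtain ⟨a, ha⟩ := hb
  obtain ⟨b, hb⟩ := ht
  exact mem_range_of_exists_le_of_exists_ge continuous_normalCDF ⟨a, ha⟩ ⟨b, hb⟩

/-! ### An entropy inequality -/

/-- If `𝔼[U e^U] ≤ 𝔼[X e^U]` with `X ≥ 0`, then `𝔼 e^U ≤ 𝔼 e^{2 X}`. This is Gibbs' variational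
principle: the entropy of the density `e^U`, normalized, bounds its pairing with `2 X` from below by
`2 log 𝔼 e^U`, and the duality of entropy and exponential moments bounds it from above. -/
lemma integral_exp_le_of_entropy {Ω : Type*} [MeasurableSpace Ω] {P : Measure Ω}
    [IsProbabilityMeasure P] {U X : Ω → ℝ} (hU : Integrable (fun ω => Real.exp (U ω)) P)
    (hUU : Integrable (fun ω => U ω * Real.exp (U ω)) P)
    (hXU : Integrable (fun ω => X ω * Real.exp (U ω)) P)
    (hX : Integrable (fun ω => Real.exp (2 * X ω)) P) (hX0 : ∀ ω, 0 ≤ X ω)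
    (h : ∫ ω, U ω * Real.exp (U ω) ∂P ≤ ∫ ω, X ω * Real.exp (U ω) ∂P) :
    ∫ ω, Real.exp (U ω) ∂P ≤ ∫ ω, Real.exp (2 * X ω) ∂P := by
  set m := ∫ ω, Real.exp (U ω) ∂P with hm
  set l := ∫ ω, Real.exp (2 * X ω) ∂P with hl
  set a := ∫ ω, U ω * Real.exp (U ω) ∂P with ha
  have hm0 : 0 < m := integral_exp_pos hU
  have hl1 : 1 ≤ l := by
    have := integral_mono (integrable_const (1 : ℝ)) hX
      (fun ω => Real.one_le_exp (by linarith [hX0 ω] : 0 ≤ 2 * X ω))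
    simpa using this
  have hl0 : 0 < l := by linarith
  -- tangent line of `y log y` at `m`
  have h1 : m * Real.log m ≤ a := by
    have : ∫ ω, ((1 + Real.log m) * Real.exp (U ω) - m) ∂P ≤ a := by
      refine integral_mono ((hU.const_mul _).sub (integrable_const _)) hUU fun ω => ?_
      have h2 := Real.add_one_le_exp (Real.log m - U ω)
      have h3 : Real.exp (Real.log m - U ω) * Real.exp (U ω) = m := by
        rw [← Real.exp_add, sub_add_cancel, Real.exp_log hm0]
      have h4 := mul_le_mul_of_nonneg_right h2 (Real.exp_pos (U ω)).le
      rw [h3] at h4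
      simp only
      nlinarith
    rw [integral_sub (hU.const_mul _) (integrable_const _), integral_const_mul] at this
    simp only [integral_const, probReal_univ, smul_eq_mul, one_mul] at this
    rw [← hm] at this
    linarith
  -- Young's inequality `u y ≤ y log (y / t) - y + t e^u` with `t = m / l`
  have h2 : 2 * a ≤ a - (Real.log m - Real.log l) * m := by
    have h3 : ∫ ω, 2 * (X ω * Real.exp (U ω)) ∂P ≤
        ∫ ω, (U ω * Real.exp (U ω) - (Real.log m - Real.log l + 1) * Real.exp (U ω)
          + m / l * Real.exp (2 * X ω)) ∂P := by
      refine integral_mono (hXU.const_mul _) ((hUU.sub (hU.const_mul _)).add (hX.const_mul _))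
        fun ω => ?_
      have h4 := Real.add_one_le_exp (Real.log m - Real.log l + 2 * X ω - U ω)
      have h5 : Real.exp (Real.log m - Real.log l + 2 * X ω - U ω) * Real.exp (U ω) =
          m / l * Real.exp (2 * X ω) := by
        rw [← Real.exp_add, sub_add_cancel, Real.exp_add, Real.exp_sub, Real.exp_log hm0,
          Real.exp_log hl0]
      have h6 := mul_le_mul_of_nonneg_right h4 (Real.exp_pos (U ω)).le
      rw [h5] at h6
      simp only
      nlinarith
    rw [integral_const_mul,
      integral_add (f := fun ω => U ω * Real.exp (U ω) - _ * Real.exp (U ω))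
        (hUU.sub (hU.const_mul _)) (hX.const_mul _),
      integral_sub hUU (hU.const_mul _), integral_const_mul, integral_const_mul, ← hm, ← hl, ← ha]
      at h3
    have h7 : m / l * l = m := div_mul_cancel₀ _ hl0.ne'
    rw [h7] at h3
    linarith
  have h3 : 2 * Real.log m ≤ Real.log l := by
    have : m * (2 * Real.log m) ≤ m * Real.log l := by nlinarith
    exact le_of_mul_le_mul_left this hm0
  rw [← Real.log_le_log_iff hm0 hl0]
  have := Real.log_nonneg hl1
  linarith

/-! ### Stein kernels and the quantile coupling -/

section Piece

variable (i κ F p μ σ θ : ℝ)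

/-- The Stein kernel at distance `s` to the right of an atom `i`, after each atom is smeared
uniformly over the unit interval to its right; `κ` is the discrete kernel at `i`. -/
noncomputable def smearedKernel (s : ℝ) : ℝ := κ + (1 - s) * (i - μ) + s * (1 - s) / 2

/-- The deviation `w - (μ + 1/2) - σ z` on the piece where the smeared variable is
`w = i + (Φ z - F) / p`. -/
noncomputable def pieceDev (z : ℝ) : ℝ := i + (normalCDF z - F) / p - μ - 1 / 2 - σ * z

/-- The primitive that turns the two Stein identities into a boundary term. -/
noncomputable def piecePrim (z : ℝ) : ℝ :=
  Real.exp (θ * pieceDev i F p μ σ z) *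
    (σ * normalPDF z - p * smearedKernel i κ μ ((normalCDF z - F) / p))

variable {p}

lemma hasDerivAt_pieceDev (z : ℝ) :
    HasDerivAt (pieceDev i F p μ σ) (normalPDF z / p - σ) z := by
  have h1 : HasDerivAt (fun z => i + (normalCDF z - F) / p - μ - 1 / 2)
      (normalPDF z / p) z :=
    (((((hasDerivAt_normalCDF z).sub_const F).div_const p).const_add i).sub_const μ).sub_const _
  exact (h1.sub ((hasDerivAt_id z).const_mul σ)).congr_deriv (by simp)

lemma hasDerivAt_piecePrim (hp : p ≠ 0) (z : ℝ) :
    HasDerivAt (piecePrim i κ F p μ σ θ)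
      (Real.exp (θ * pieceDev i F p μ σ z) * (θ * (normalPDF z / p - σ)) *
          (σ * normalPDF z - p * smearedKernel i κ μ ((normalCDF z - F) / p)) +
        Real.exp (θ * pieceDev i F p μ σ z) * (pieceDev i F p μ σ z * normalPDF z)) z := by
  have hs : HasDerivAt (fun z => (normalCDF z - F) / p) (normalPDF z / p) z :=
    ((hasDerivAt_normalCDF z).sub_const F).div_const p
  have hk : HasDerivAt (fun z => smearedKernel i κ μ ((normalCDF z - F) / p))
      ((-(normalPDF z / p)) * (i - μ) +
        ((normalPDF z / p) * (1 - (normalCDF z - F) / p) +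
          (normalCDF z - F) / p * (-(normalPDF z / p))) / 2) z := by
    have h1 := hs.const_sub 1
    exact ((h1.mul_const (i - μ)).const_add κ).add ((hs.mul h1).div_const 2)
  have he := ((hasDerivAt_pieceDev (p := p) i F μ σ z).const_mul θ).exp
  have hb := ((hasDerivAt_normalPDF z).const_mul σ).sub (hk.const_mul p)
  refine (he.mul hb).congr_deriv ?_
  simp only [Pi.sub_apply, pieceDev]
  generalize smearedKernel i κ μ ((normalCDF z - F) / p) = K
  field_simp
  ring

/-- The pointwise inequality behind the coupling bound: by the arithmetic-geometric mean
inequality, `(φ/p - σ) (p q - σ φ) ≤ φ (√q - σ)²`. -/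
lemma piece_pointwise (hp : 0 < p) (hσ : 0 ≤ σ) (z : ℝ) {Y : ℝ}
    (hq : 0 ≤ smearedKernel i κ μ ((normalCDF z - F) / p))
    (hY : (√(smearedKernel i κ μ ((normalCDF z - F) / p)) - σ) ^ 2 ≤ Y) :
    (θ * pieceDev i F p μ σ z - θ ^ 2 * Y) * Real.exp (θ * pieceDev i F p μ σ z) * normalPDF z ≤
      θ * (Real.exp (θ * pieceDev i F p μ σ z) * (θ * (normalPDF z / p - σ)) *
          (σ * normalPDF z - p * smearedKernel i κ μ ((normalCDF z - F) / p)) +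
        Real.exp (θ * pieceDev i F p μ σ z) * (pieceDev i F p μ σ z * normalPDF z)) := by
  set q := smearedKernel i κ μ ((normalCDF z - F) / p)
  set D := pieceDev i F p μ σ z
  set f := normalPDF z with hf
  have hf0 : 0 < f := normalPDF_pos z
  have hE := Real.exp_pos (θ * D)
  have hr : √q ^ 2 = q := Real.sq_sqrt hq
  have key : (f / p - σ) * (p * q - σ * f) ≤ f * Y := by
    have h1 : f * (√q - σ) ^ 2 - (f / p - σ) * (p * q - σ * f)
        = σ * p * (√q - f / p) ^ 2 := by
      clear_value q
      generalize √q = r at hr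
      subst hr
      field_simp
      ring
    have h2 : 0 ≤ σ * p * (√q - f / p) ^ 2 := by positivity
    nlinarith
  have h3 : 0 ≤ θ ^ 2 * Real.exp (θ * D) * (f * Y - (f / p - σ) * (p * q - σ * f)) :=
    mul_nonneg (by positivity) (by linarith)
  nlinarith

lemma continuous_pieceDev : Continuous (pieceDev i F p μ σ) :=
  continuous_iff_continuousAt.2 fun z => (hasDerivAt_pieceDev i F μ σ z).continuousAt

lemma continuous_smearedKernel : Continuous (smearedKernel i κ μ) := by
  unfold smearedKernel
  fun_prop

/-- Integrated form of the pointwise bound. The right-hand sides telescope over consecutive pieces,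
since the density of the smeared variable times its kernel is continuous across the atoms. -/
lemma integral_piece_le (hp : 0 < p) (hσ : 0 ≤ σ) {a b Y : ℝ} (hab : a ≤ b)
    (ha : F ≤ normalCDF a) (hb : normalCDF b ≤ F + p)
    (hq : ∀ s ∈ Icc (0 : ℝ) 1, 0 ≤ smearedKernel i κ μ s)
    (hY : ∀ s ∈ Icc (0 : ℝ) 1, (√(smearedKernel i κ μ s) - σ) ^ 2 ≤ Y) :
    ∫ z in a..b, (θ * pieceDev i F p μ σ z - θ ^ 2 * Y) *
        Real.exp (θ * pieceDev i F p μ σ z) * normalPDF z ≤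
      θ * (piecePrim i κ F p μ σ θ b - piecePrim i κ F p μ σ θ a) := by
  have hcD := continuous_pieceDev (p := p) i F μ σ
  have hcK : Continuous fun z => smearedKernel i κ μ ((normalCDF z - F) / p) :=
    (continuous_smearedKernel i κ μ).comp ((continuous_normalCDF.sub continuous_const).div_const p)
  have hcP := continuous_normalPDF
  rw [← intervalIntegral.integral_eq_sub_of_hasDerivAt
    (fun z _ => hasDerivAt_piecePrim i κ F μ σ θ hp.ne' z)
    (Continuous.intervalIntegrable (by fun_prop) _ _), ← intervalIntegral.integral_const_mul]
  refine intervalIntegral.integral_mono_on hab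
    (Continuous.intervalIntegrable (by fun_prop) _ _)
    (Continuous.intervalIntegrable (by fun_prop) _ _) fun z hz => ?_
  have hs : (normalCDF z - F) / p ∈ Icc (0 : ℝ) 1 := by
    have h1 := strictMono_normalCDF.monotone hz.1
    have h2 := strictMono_normalCDF.monotone hz.2
    refine ⟨div_nonneg (by linarith) hp.le, (div_le_one hp).2 (by linarith)⟩
  exact piece_pointwise i κ F μ σ θ hp hσ z (hq _ hs) (hY _ hs)

end Piece

/-- The quantile index: the number of levels `F 1, …, F L` below `Φ z`. -/
noncomputable def quantileIndex (F : ℕ → ℝ) (L : ℕ) (z : ℝ) : ℕ :=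
  ∑ j ∈ Finset.Icc 1 L, if F j < normalCDF z then 1 else 0

lemma measurable_quantileIndex (F : ℕ → ℝ) (L : ℕ) : Measurable (quantileIndex F L) := by
  unfold quantileIndex
  refine Finset.measurable_sum _ fun j _ => ?_
  exact Measurable.ite (measurableSet_lt measurable_const continuous_normalCDF.measurable)
    measurable_const measurable_const

lemma quantileIndex_eq {F : ℕ → ℝ} (hF : Monotone F) {L i : ℕ} (hi : i ≤ L) {z : ℝ}
    (h1 : i = 0 ∨ F i < normalCDF z) (h2 : i = L ∨ normalCDF z ≤ F (i + 1)) :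
    quantileIndex F L z = i := by
  unfold quantileIndex
  rw [Finset.sum_ite, Finset.sum_const_zero, add_zero, Finset.sum_const, smul_eq_mul, mul_one]
  have : (Finset.Icc 1 L).filter (fun j => F j < normalCDF z) = Finset.Icc 1 i := by
    ext j
    simp only [Finset.mem_filter, Finset.mem_Icc]
    constructor
    · rintro ⟨⟨h3, h4⟩, h5⟩
      refine ⟨h3, ?_⟩
      by_contra! hc
      rcases h2 with h2 | h2
      · omega
      · have := hF (show i + 1 ≤ j by omega)
        linarith
    · rintro ⟨h3, h4⟩
      refine ⟨⟨h3, by omega⟩, ?_⟩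
      rcases h1 with h1 | h1
      · omega
      · exact (hF h4).trans_lt h1
  rw [this, Nat.card_Icc]
  omega

lemma exists_quantileIndex {F : ℕ → ℝ} (hF : Monotone F) (L : ℕ) (z : ℝ) :
    quantileIndex F L z ≤ L ∧
      (quantileIndex F L z = 0 ∨ F (quantileIndex F L z) < normalCDF z) ∧
      (quantileIndex F L z = L ∨ normalCDF z ≤ F (quantileIndex F L z + 1)) := by
  classical
  have : ∃ i ≤ L, (i = 0 ∨ F i < normalCDF z) ∧ (i = L ∨ normalCDF z ≤ F (i + 1)) := by
    by_cases h : ∃ i, i = L ∨ normalCDF z ≤ F (i + 1)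
    · refine ⟨Nat.find h, ?_, ?_, Nat.find_spec h⟩
      · exact Nat.find_min' h (Or.inl rfl)
      · rcases Nat.eq_zero_or_pos (Nat.find h) with h0 | h0
        · exact Or.inl h0
        · right
          have := Nat.find_min h (Nat.sub_lt h0 one_pos)
          push Not at this
          rw [show Nat.find h - 1 + 1 = Nat.find h by omega] at this
          exact this.2
    · exact absurd ⟨L, Or.inl rfl⟩ h
  obtain ⟨i, hi, h1, h2⟩ := this
  rw [quantileIndex_eq hF hi h1 h2]
  exact ⟨hi, h1, h2⟩

lemma stdNormal_normalCDF_le {u : ℝ} (h0 : 0 ≤ u) (h1 : u ≤ 1) :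
    stdNormal.real {z | normalCDF z ≤ u} = u := by
  rcases h0.eq_or_lt with rfl | h0
  · have : {z | normalCDF z ≤ 0} = ∅ := by
      ext z
      simpa using normalCDF_pos z
    simp [this]
  rcases h1.eq_or_lt with rfl | h1
  · have : {z | normalCDF z ≤ 1} = univ := by
      ext z
      simpa using normalCDF_le_one z
    simp [this]
  obtain ⟨x, hx⟩ := exists_normalCDF_eq h0 h1
  have : {z | normalCDF z ≤ u} = Iic x := by
    ext z
    rw [mem_ofPred_eq, ← hx, strictMono_normalCDF.le_iff_le, mem_Iic]
  rw [this, stdNormal_real_Iic, hx]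

/-- A function of at most exponential growth is integrable for the standard normal law. -/
lemma integrable_of_exp_growth {f : ℝ → ℝ} (hf : Measurable f) {K c : ℝ}
    (h : ∀ z, |f z| ≤ K * Real.exp (c * |z|)) : Integrable f stdNormal := by
  have hK : 0 ≤ K := by simpa using (abs_nonneg _).trans (h 0)
  refine Integrable.mono' (g := fun z => K * (Real.exp (c * z) + Real.exp (-c * z)))
    (((integrable_exp_mul_gaussianReal c).add (integrable_exp_mul_gaussianReal (-c))).const_mul K)
    hf.aestronglyMeasurable (Eventually.of_forall fun z => ?_)
  refine (h z).trans (mul_le_mul_of_nonneg_left ?_ hK)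
  rcases abs_cases z with ⟨h1, _⟩ | ⟨h1, _⟩ <;> rw [h1]
  · linarith [Real.exp_pos (-c * z)]
  · have : c * -z = -c * z := by ring
    rw [this]
    linarith [Real.exp_pos (c * z)]

lemma integrable_mul_normalPDF {f : ℝ → ℝ} (hf : Integrable f stdNormal) :
    Integrable (fun z => f z * normalPDF z) := by
  rw [stdNormal, gaussianReal_of_var_ne_zero _ one_ne_zero,
    integrable_withDensity_iff_integrable_smul' (measurable_gaussianPDF _ _)
      (Eventually.of_forall fun _ => gaussianPDF_lt_top)] at hf
  simpa [mul_comm] using hf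

lemma integral_stdNormal (f : ℝ → ℝ) :
    ∫ z, f z ∂stdNormal = ∫ z, f z * normalPDF z := by
  rw [integral_gaussianReal_eq_integral_smul one_ne_zero]
  simp [mul_comm]

lemma abs_pieceDev_quantile_le {F p μ σ i : ℝ} {L : ℝ} (hi0 : 0 ≤ i) (hi : i ≤ L) (hσ : 0 ≤ σ)
    {z : ℝ} (hs : (normalCDF z - F) / p ∈ Icc (0 : ℝ) 1) :
    |pieceDev i F p μ σ z| ≤ L + |μ| + 2 + σ * |z| := by
  have h1 : σ * |z| = |σ * z| := by rw [abs_mul, abs_of_nonneg hσ]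
  rw [h1, pieceDev, abs_le]
  have := neg_abs_le (σ * z)
  have := le_abs_self (σ * z)
  have := neg_abs_le μ
  have := le_abs_self μ
  obtain ⟨h2, h3⟩ := hs
  constructor <;> linarith

/-- The boundary term of the Stein identity vanishes at infinity: if the kernel vanishes linearly
at the relevant end of the piece, it is controlled by the Gaussian tail. -/
lemma tendsto_boundary {f : ℝ → ℝ} {A B c σ : ℝ}
    (T : ℝ → ℝ) (hT : ∀ R, |T R| ≤ Real.exp (-((c + 1) * R) + (c + 1) ^ 2 / 2))
    (z : ℝ → ℝ) (hz : ∀ R, |z R| = |R|)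
    (hf : ∀ᶠ R in atTop, |f R| ≤ A * Real.exp (c * R) * (σ * normalPDF (z R) + B * |T R|))
    (hA : 0 ≤ A) (hB : 0 ≤ B) (hσ : 0 ≤ σ) : Tendsto f atTop (𝓝 0) := by
  have hpdf : ∀ R, normalPDF (z R) ≤ Real.exp (-((c + 1) * R) + (c + 1) ^ 2 / 2) := by
    intro R
    have h1 : normalPDF (z R) = (√(2 * Real.pi))⁻¹ * Real.exp (-R ^ 2 / 2) := by
      simp only [normalPDF, gaussianPDFReal, NNReal.coe_one, mul_one, sub_zero]
      rw [← sq_abs (z R), hz, sq_abs]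
    have h2 : (√(2 * Real.pi))⁻¹ ≤ 1 := by
      apply inv_le_one_of_one_le₀
      rw [Real.one_le_sqrt]
      linarith [Real.pi_gt_three]
    rw [h1]
    calc _ ≤ 1 * Real.exp (-R ^ 2 / 2) := mul_le_mul_of_nonneg_right h2 (Real.exp_pos _).le
      _ ≤ _ := by
        rw [one_mul]
        apply Real.exp_le_exp.2
        nlinarith [sq_nonneg (R - (c + 1))]
  have hlim : Tendsto (fun R : ℝ => A * (σ + B) * Real.exp ((c + 1) ^ 2 / 2) * Real.exp (-R))
      atTop (𝓝 0) := by
    simpa using (Real.tendsto_exp_neg_atTop_nhds_zero).const_mul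
      (A * (σ + B) * Real.exp ((c + 1) ^ 2 / 2))
  refine squeeze_zero_norm' ?_ hlim
  filter_upwards [hf] with R hR
  refine hR.trans ?_
  have h1 : σ * normalPDF (z R) + B * |T R| ≤
      (σ + B) * Real.exp (-((c + 1) * R) + (c + 1) ^ 2 / 2) := by
    have := mul_le_mul_of_nonneg_left (hpdf R) hσ
    have := mul_le_mul_of_nonneg_left (hT R) hB
    linarith
  calc _ ≤ A * Real.exp (c * R) * ((σ + B) * Real.exp (-((c + 1) * R) + (c + 1) ^ 2 / 2)) :=
        mul_le_mul_of_nonneg_left h1 (by positivity)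
    _ = A * (σ + B) * (Real.exp (c * R) * Real.exp (-((c + 1) * R) + (c + 1) ^ 2 / 2)) := by ring
    _ = A * (σ + B) * (Real.exp ((c + 1) ^ 2 / 2) * Real.exp (-R)) := by
        rw [← Real.exp_add, ← Real.exp_add]
        congr 2
        ring
    _ = _ := by ring

/-- **Transport bound.** Let `p` be a positive probability vector on `0, …, L` with mean `μ`, and
`κ` its discrete Stein kernel. The quantile coupling `J` of `p` with a standard normal variable
`z` satisfies `𝔼 e^{θ (J - μ - σ z)} ≤ e^{|θ|/2} 𝔼 e^{2 θ² Y_J}`, where `Y` bounds the squared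
distance between the square root of the kernel of the smeared variable and `σ`. -/
theorem exists_quantile_coupling (L : ℕ) (p κ Y : ℕ → ℝ) (μ σ : ℝ) (hσ : 0 ≤ σ)
    (hp : ∀ i ≤ L, 0 < p i) (hp0 : ∀ i, L < i → p i = 0)
    (hsum : ∑ i ∈ Finset.range (L + 1), p i = 1)
    (hκ0 : κ 0 = μ) (hκL : κ L = 0)
    (hrec : ∀ i < L, p i * κ i = p (i + 1) * (κ (i + 1) + (((i + 1 : ℕ) : ℝ) - μ)))
    (hκ : ∀ i ≤ L, 0 ≤ κ i) (hκ' : ∀ i ≤ L, 0 ≤ κ i + (i - μ))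
    (hY : ∀ i ≤ L, ∀ s ∈ Icc (0 : ℝ) 1, (√(smearedKernel i (κ i) μ s) - σ) ^ 2 ≤ Y i) :
    ∃ J : ℝ → ℕ, Measurable J ∧ (∀ i, stdNormal (J ⁻¹' {i}) = ENNReal.ofReal (p i)) ∧
      ∀ θ : ℝ, Integrable (fun z => Real.exp (θ * (J z - μ - σ * z))) stdNormal ∧
        ∫ z, Real.exp (θ * (J z - μ - σ * z)) ∂stdNormal ≤
          Real.exp (|θ| / 2) * ∑ i ∈ Finset.range (L + 1), p i * Real.exp (2 * θ ^ 2 * Y i) := by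
  set F : ℕ → ℝ := fun i => ∑ j ∈ Finset.range i, p j with hFdef
  have hpn : ∀ i, 0 ≤ p i := fun i => by
    rcases le_or_gt i L with h | h
    · exact (hp i h).le
    · exact (hp0 i h).ge
  have hFs : ∀ i, F (i + 1) = F i + p i := fun i => Finset.sum_range_succ _ _
  have hF0 : F 0 = 0 := Finset.sum_range_zero _
  have hFL : F (L + 1) = 1 := hsum
  have hFm : Monotone F := monotone_nat_of_le_succ fun i => by rw [hFs]; linarith [hpn i]
  have hF1 : ∀ i, F i ≤ 1 := fun i => by
    rcases le_or_gt i (L + 1) with h | h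
    · exact (hFm h).trans hFL.le
    · have : F i = F (L + 1) := by
        rw [hFdef]
        refine (Finset.sum_subset (Finset.range_mono h.le) fun j _ hj => hp0 j ?_).symm
        rw [Finset.mem_range] at hj
        omega
      rw [this, hFL]
  have hFn : ∀ i, 0 ≤ F i := fun i => hF0 ▸ hFm (Nat.zero_le i)
  set J := quantileIndex F L with hJdef
  have hJm : Measurable J := measurable_quantileIndex F L
  have hJL : ∀ z, J z ≤ L := fun z => (exists_quantileIndex hFm L z).1
  have hJ1 : ∀ z, F (J z) ≤ normalCDF z := fun z => by
    rcases (exists_quantileIndex hFm L z).2.1 with h | h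
    · rw [hJdef, h, hF0]
      exact normalCDF_nonneg z
    · exact h.le
  have hJ2 : ∀ z, normalCDF z ≤ F (J z + 1) := fun z => by
    rcases (exists_quantileIndex hFm L z).2.2 with h | h
    · rw [hJdef, h, hFL]
      exact normalCDF_le_one z
    · exact h
  have hJs : ∀ z, (normalCDF z - F (J z)) / p (J z) ∈ Icc (0 : ℝ) 1 := fun z => by
    have h1 := hJ1 z
    have h2 := hJ2 z
    rw [hFs] at h2
    have h3 := hp _ (hJL z)
    exact ⟨div_nonneg (by linarith) h3.le, (div_le_one h3).2 (by linarith)⟩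
  have hmass : ∀ i, stdNormal.real (J ⁻¹' {i}) = p i := by
    intro i
    rcases le_or_gt i L with hi | hi
    · have h1 : J ⁻¹' {i} = {z | normalCDF z ≤ F (i + 1)} \ {z | normalCDF z ≤ F i} := by
        ext z
        simp only [mem_preimage, mem_singleton_iff, Set.mem_sdiff, mem_ofPred_eq, not_le]
        constructor
        · intro h
          refine ⟨h ▸ hJ2 z, ?_⟩
          rcases (exists_quantileIndex hFm L z).2.1 with h' | h'
          · rw [← h, hJdef, h', hF0]
            exact normalCDF_pos z
          · rw [← h]
            exact h'
        · rintro ⟨h2, h3⟩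
          exact quantileIndex_eq hFm hi (Or.inr h3) (Or.inr h2)
      rw [h1, measureReal_sdiff, stdNormal_normalCDF_le (hFn _) (hF1 _),
        stdNormal_normalCDF_le (hFn _) (hF1 _), hFs]
      · ring
      · intro z hz
        exact le_trans hz (hFm (Nat.le_succ i))
      · exact measurableSet_le continuous_normalCDF.measurable measurable_const
    · have h1 : J ⁻¹' {i} = ∅ := by
        ext z
        have := hJL z
        simp only [mem_preimage, mem_singleton_iff, mem_empty_iff_false, iff_false]
        omega
      rw [h1, hp0 i hi]
      simp
  refine ⟨J, hJm, fun i => ?_, fun θ => ?_⟩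
  · rw [← hmass i, measureReal_def, ENNReal.ofReal_toReal (measure_ne_top _ _)]
  -- the deviation of the smeared quantile coupling
  set D : ℝ → ℝ := fun z => pieceDev (J z) (F (J z)) (p (J z)) μ σ z with hD
  have hcomp : ∀ f : ℕ → ℝ, Measurable fun z => f (J z) := fun f =>
    (measurable_of_countable f).comp hJm
  have hDm : Measurable D := by
    have h1 := hcomp (fun i => (i : ℝ))
    have h2 := hcomp F
    have h3 := hcomp p
    have h4 := continuous_normalCDF.measurable
    simp only [hD, pieceDev]
    fun_prop
  have hDb : ∀ z, |D z| ≤ L + |μ| + 2 + σ * |z| := fun z =>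
    abs_pieceDev_quantile_le (Nat.cast_nonneg _) (Nat.cast_le.2 (hJL z)) hσ (hJs z)
  set c := |θ| * σ with hc
  set c0 := |θ| * (L + |μ| + 2) with hc0
  have hUb : ∀ z, |θ * D z| ≤ c0 + c * |z| := fun z => by
    rw [abs_mul]
    calc |θ| * |D z| ≤ |θ| * (L + |μ| + 2 + σ * |z|) :=
          mul_le_mul_of_nonneg_left (hDb z) (abs_nonneg _)
      _ = _ := by rw [hc, hc0]; ring
  have hc00 : 0 ≤ c0 := by positivity
  have hcn : 0 ≤ c := by positivity
  have hexpb : ∀ z, Real.exp (θ * D z) ≤ Real.exp c0 * Real.exp (c * |z|) := fun z => by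
    rw [← Real.exp_add]
    exact Real.exp_le_exp.2 ((le_abs_self _).trans (hUb z))
  have hYn : ∀ i ≤ L, 0 ≤ Y i := fun i hi =>
    (sq_nonneg _).trans (hY i hi 0 ⟨le_rfl, zero_le_one⟩)
  have hYb : ∀ z, |Y (J z)| ≤ ∑ i ∈ Finset.range (L + 1), |Y i| := fun z =>
    Finset.single_le_sum (f := fun i => |Y i|) (fun _ _ => abs_nonneg _)
      (Finset.mem_range.2 (Nat.lt_succ_of_le (hJL z)))
  have hYm : Measurable fun z => Y (J z) := hcomp Y
  have hi1 : Integrable (fun z => Real.exp (θ * D z)) stdNormal :=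
    integrable_of_exp_growth (by fun_prop) (K := Real.exp c0) (c := c) fun z => by
      rw [abs_of_pos (Real.exp_pos _)]
      exact hexpb z
  have hi2 : Integrable (fun z => θ * D z * Real.exp (θ * D z)) stdNormal :=
    integrable_of_exp_growth (by fun_prop) (K := Real.exp (2 * c0)) (c := 2 * c) fun z => by
      rw [abs_mul, abs_of_pos (Real.exp_pos _)]
      have h1 : |θ * D z| ≤ Real.exp (c0 + c * |z|) := by
        have := Real.add_one_le_exp (c0 + c * |z|)
        linarith [hUb z]
      calc _ ≤ Real.exp (c0 + c * |z|) * (Real.exp c0 * Real.exp (c * |z|)) :=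
            mul_le_mul h1 (hexpb z) (Real.exp_pos _).le (Real.exp_pos _).le
        _ = _ := by rw [← Real.exp_add, ← Real.exp_add, ← Real.exp_add]; congr 1; ring
  have hi3 : Integrable (fun z => θ ^ 2 * Y (J z) * Real.exp (θ * D z)) stdNormal :=
    integrable_of_exp_growth (by fun_prop)
      (K := θ ^ 2 * (∑ i ∈ Finset.range (L + 1), |Y i|) * Real.exp c0) (c := c) fun z => by
      rw [abs_mul, abs_mul, abs_of_pos (Real.exp_pos _), abs_of_nonneg (sq_nonneg θ), mul_assoc _ _
        (Real.exp (c * |z|))]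
      exact mul_le_mul (mul_le_mul_of_nonneg_left (hYb z) (sq_nonneg _)) (hexpb z)
        (Real.exp_pos _).le (by positivity)
  have hi4 : Integrable (fun z => Real.exp (2 * (θ ^ 2 * Y (J z)))) stdNormal :=
    integrable_of_exp_growth (by fun_prop)
      (K := Real.exp (2 * (θ ^ 2 * ∑ i ∈ Finset.range (L + 1), |Y i|))) (c := 0) fun z => by
      rw [abs_of_pos (Real.exp_pos _), zero_mul, Real.exp_zero, mul_one]
      refine Real.exp_le_exp.2 ?_
      have := mul_le_mul_of_nonneg_left ((le_abs_self _).trans (hYb z)) (sq_nonneg θ)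
      linarith
  have hXexp : ∫ z, Real.exp (2 * (θ ^ 2 * Y (J z))) ∂stdNormal =
      ∑ i ∈ Finset.range (L + 1), p i * Real.exp (2 * θ ^ 2 * Y i) := by
    have h1 : ∀ z, Real.exp (2 * (θ ^ 2 * Y (J z))) = ∑ i ∈ Finset.range (L + 1),
        (J ⁻¹' {i}).indicator (fun _ => Real.exp (2 * θ ^ 2 * Y i)) z := fun z => by
      rw [Finset.sum_eq_single (J z)]
      · rw [indicator_of_mem (by simp)]
        congr 1
        ring
      · intro j _ hj
        exact indicator_of_notMem (by simpa using hj.symm) _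
      · intro h
        exact absurd (Finset.mem_range.2 (Nat.lt_succ_of_le (hJL z))) h
    simp_rw [h1]
    rw [integral_finsetSum]
    · refine Finset.sum_congr rfl fun i _ => ?_
      rw [integral_indicator_const _ (hJm (measurableSet_singleton i)), hmass, smul_eq_mul]
    · intro i _
      exact (integrable_const _).indicator (hJm (measurableSet_singleton i))
  -- the key estimate, by telescoping over the pieces and letting the truncation tend to infinity
  have key : ∫ z, θ * D z * Real.exp (θ * D z) ∂stdNormal ≤
      ∫ z, θ ^ 2 * Y (J z) * Real.exp (θ * D z) ∂stdNormal := by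
    set g : ℝ → ℝ := fun z =>
      (θ * D z - θ ^ 2 * Y (J z)) * Real.exp (θ * D z) * normalPDF z with hg
    have hgi : Integrable g := by
      have := integrable_mul_normalPDF (hi2.sub hi3)
      refine this.congr (Eventually.of_forall fun z => ?_)
      simp only [hg, Pi.sub_apply]
      ring
    have hgint : ∫ z, g z = ∫ z, θ * D z * Real.exp (θ * D z) ∂stdNormal -
        ∫ z, θ ^ 2 * Y (J z) * Real.exp (θ * D z) ∂stdNormal := by
      rw [← integral_sub hi2 hi3, integral_stdNormal]
      congr 1
      funext z
      simp only [hg]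
      ring
    suffices h : ∫ z, g z ≤ 0 by
      rw [hgint] at h
      linarith
    have hex : ∀ i, 1 ≤ i ∧ i ≤ L → ∃ x, normalCDF x = F i := by
      rintro i ⟨h1, h2⟩
      refine exists_normalCDF_eq ?_ ?_
      · have h3 := hFm h1
        have h4 := hFs 0
        rw [hF0, zero_add] at h4
        have := hp 0 (Nat.zero_le L)
        rw [zero_add] at h4
        linarith
      · have := hFs i
        have := hF1 (i + 1)
        have := hp i h2
        linarith
    choose! x hx using hex
    set R0 := ∑ i ∈ Finset.range (L + 1), |x i| with hR0
    have hxR : ∀ i ≤ L, |x i| ≤ R0 := fun i hi =>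
      Finset.single_le_sum (f := fun i => |x i|) (fun _ _ => abs_nonneg _)
        (Finset.mem_range.2 (Nat.lt_succ_of_le hi))
    set G : ℕ → ℝ → ℝ := fun i => piecePrim i (κ i) (F i) (p i) μ σ θ with hG
    have hpn0 : ∀ i ≤ L, ∀ s ∈ Icc (0 : ℝ) 1, 0 ≤ smearedKernel i (κ i) μ s := by
      rintro i hi s ⟨hs0, hs1⟩
      have h1 := hκ i hi
      have h2 := hκ' i hi
      have h3 : smearedKernel i (κ i) μ s =
          s * κ i + (1 - s) * (κ i + (i - μ)) + s * (1 - s) / 2 := by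
        unfold smearedKernel
        ring
      have h4 : 0 ≤ 1 - s := by linarith
      rw [h3]
      positivity
    have htrunc : ∀ R, R0 ≤ R →
        ∫ z in (-R)..R, g z ≤ θ * (G L R - G 0 (-R)) := by
      intro R hR
      have hR00 : 0 ≤ R := (Finset.sum_nonneg fun _ _ => abs_nonneg _).trans hR
      set t : ℕ → ℝ := fun i => if i = 0 then -R else if i ≤ L then x i else R with ht
      have ht0 : t 0 = -R := by simp [ht]
      have htL : ∀ i, L < i → t i = R := fun i hi => by
        simp only [ht]
        rw [if_neg (by omega), if_neg (by omega)]
      have htm : ∀ i, 1 ≤ i → i ≤ L → t i = x i := fun i h1 h2 => by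
        simp only [ht]
        rw [if_neg (by omega), if_pos h2]
      have hpiece : ∀ i ≤ L, t i ≤ t (i + 1) ∧ F i ≤ normalCDF (t i) ∧
          normalCDF (t (i + 1)) ≤ F i + p i ∧ ∀ z ∈ Ioo (t i) (t (i + 1)), J z = i := by
        intro i hi
        have hlow : F i ≤ normalCDF (t i) ∧ (i = 0 ∨ F i = normalCDF (t i)) := by
          rcases Nat.eq_zero_or_pos i with h | h
          · rw [h, hF0]
            exact ⟨normalCDF_nonneg _, Or.inl rfl⟩
          · rw [htm i h hi, hx i ⟨h, hi⟩]
            exact ⟨le_rfl, Or.inr rfl⟩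
        have hup : normalCDF (t (i + 1)) ≤ F (i + 1) ∧
            (i = L ∨ F (i + 1) = normalCDF (t (i + 1))) := by
          rcases hi.eq_or_lt with h | h
          · rw [h, hFL]
            exact ⟨normalCDF_le_one _, Or.inl rfl⟩
          · rw [htm (i + 1) (by omega) h, hx (i + 1) ⟨by omega, h⟩]
            exact ⟨le_rfl, Or.inr rfl⟩
        refine ⟨?_, hlow.1, ?_, fun z hz => quantileIndex_eq hFm hi ?_ ?_⟩
        · rcases Nat.eq_zero_or_pos i with h | h
          · rw [h, ht0]
            rcases Nat.lt_or_ge L (0 + 1) with h' | h'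
            · rw [htL _ h']
              linarith
            · rw [htm _ le_rfl h']
              linarith [neg_abs_le (x 1), hxR 1 h']
          · rcases hi.eq_or_lt with h' | h'
            · rw [htL (i + 1) (by omega), htm i h hi]
              linarith [le_abs_self (x i), hxR i hi]
            · rw [htm i h hi, htm (i + 1) (by omega) h', ← strictMono_normalCDF.le_iff_le,
                hx i ⟨h, hi⟩, hx (i + 1) ⟨by omega, h'⟩]
              exact hFm (Nat.le_succ i)
        · rw [← hFs]
          exact hup.1
        · rcases hlow.2 with h | h
          · exact Or.inl h
          · rw [h]
            exact Or.inr (strictMono_normalCDF hz.1)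
        · rcases hup.2 with h | h
          · exact Or.inl h
          · rw [h]
            exact Or.inr (strictMono_normalCDF hz.2).le
      have hsumint := intervalIntegral.sum_integral_adjacent_intervals (f := g) (a := t)
        (n := L + 1) (μ := volume) (fun k _ => hgi.intervalIntegrable)
      rw [ht0, htL (L + 1) (Nat.lt_succ_self L)] at hsumint
      rw [← hsumint]
      set v : ℕ → ℝ := fun i => if i ≤ L then θ * G i (t i) else θ * G L R with hv
      have hstep : ∀ i ∈ Finset.range (L + 1),
          ∫ z in (t i)..(t (i + 1)), g z ≤ v (i + 1) - v i := by
        intro i hi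
        have hi : i ≤ L := Nat.lt_succ_iff.1 (Finset.mem_range.1 hi)
        obtain ⟨h1, h2, h3, h4⟩ := hpiece i hi
        have h5 : v (i + 1) - v i = θ * (G i (t (i + 1)) - G i (t i)) := by
          simp only [hv]
          rw [if_pos hi, mul_sub]
          congr 1
          rcases hi.eq_or_lt with h | h
          · rw [if_neg (by omega), htL (i + 1) (by omega), h]
          · rw [if_pos (by omega), htm (i + 1) (by omega) h]
            -- the two primitives agree at the common endpoint of consecutive pieces
            have h6 := hx (i + 1) ⟨by omega, h⟩
            have h7 : (F i + p i - F i) / p i = 1 := by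
              rw [add_sub_cancel_left, div_self (hp i hi).ne']
            simp only [hG, piecePrim, pieceDev, smearedKernel, h6, hFs, h7, sub_self, zero_div]
            have h8 := hrec i h
            push_cast at h8 ⊢
            have h9 : (p (i + 1)) * (κ (i + 1) + (1 - 0) * ((i : ℝ) + 1 - μ) + 0 * (1 - 0) / 2) =
                p i * (κ i + 0 * (i - μ) + 1 * 0 / 2) := by linarith
            rw [h9]
            ring_nf
        rw [h5]
        refine le_trans (le_of_eq ?_) (integral_piece_le (i : ℝ) (κ i) (F i) μ σ θ (hp i hi) hσ h1
          h2 h3 (hpn0 i hi) (hY i hi))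
        refine intervalIntegral.integral_congr_uIoo fun z hz => ?_
        rw [uIoo_of_le h1] at hz
        simp only [hg, hD, h4 z hz]
      refine (Finset.sum_le_sum hstep).trans (le_of_eq ?_)
      rw [Finset.sum_range_sub]
      simp only [hv]
      rw [if_neg (by omega), if_pos (Nat.zero_le _), ht0, mul_sub]
    have hlim1 : Tendsto (fun R => ∫ z in (-R)..R, g z) atTop (𝓝 (∫ z, g z)) :=
      intervalIntegral_tendsto_integral hgi tendsto_neg_atTop_atBot tendsto_id
    have hcc : ∀ R : ℝ, 0 ≤ R → ∀ i ≤ L, ∀ z, |z| = R →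
        (normalCDF z - F i) / p i ∈ Icc (0 : ℝ) 1 →
        Real.exp (θ * pieceDev i (F i) (p i) μ σ z) ≤ Real.exp c0 * Real.exp (c * R) := by
      intro R hR i hi z hz hs
      rw [← Real.exp_add, ← hz]
      refine Real.exp_le_exp.2 ((le_abs_self _).trans ?_)
      rw [abs_mul]
      calc _ ≤ |θ| * (L + |μ| + 2 + σ * |z|) := mul_le_mul_of_nonneg_left
            (abs_pieceDev_quantile_le (Nat.cast_nonneg _) (Nat.cast_le.2 hi) hσ hs) (abs_nonneg _)
        _ = _ := by rw [hc, hc0]; ring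
    have hlimR : Tendsto (G L) atTop (𝓝 0) := by
      refine tendsto_boundary (A := Real.exp c0) (B := |(L : ℝ) - μ| + 1) (c := c) (σ := σ)
        (fun R => 1 - normalCDF R) (fun R => ?_) (fun R => R) (fun R => rfl) ?_
        (Real.exp_pos _).le (by positivity) hσ
      · rw [abs_of_nonneg (by linarith [normalCDF_le_one R])]
        exact one_sub_normalCDF_le_exp (c + 1) R (by linarith)
      filter_upwards [eventually_ge_atTop R0] with R hR
      have hR00 : 0 ≤ R := (Finset.sum_nonneg fun _ _ => abs_nonneg _).trans hR
      have hs : (normalCDF R - F L) / p L ∈ Icc (0 : ℝ) 1 := by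
        have h1 := hFs L
        rw [hFL] at h1
        have h2 := normalCDF_le_one R
        have h3 : F L ≤ normalCDF R := by
          rcases Nat.eq_zero_or_pos L with h | h
          · rw [h, hF0]
            exact normalCDF_nonneg R
          · rw [← hx L ⟨h, le_rfl⟩]
            exact strictMono_normalCDF.monotone ((le_abs_self _).trans ((hxR L le_rfl).trans hR))
        exact ⟨div_nonneg (by linarith) (hp L le_rfl).le,
          (div_le_one (hp L le_rfl)).2 (by linarith)⟩
      have he := hcc R hR00 L le_rfl R (abs_of_nonneg hR00) hs
      simp only [hG, piecePrim, abs_mul, abs_of_pos (Real.exp_pos _)]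
      refine mul_le_mul he ?_ (abs_nonneg _) (by positivity)
      set s := (normalCDF R - F L) / p L with hsdef
      have h1 : p L * smearedKernel L (κ L) μ s = (1 - normalCDF R) * (L - μ + s / 2) := by
        have h2 : p L * (1 - s) = 1 - normalCDF R := by
          have h1 := hFs L
          rw [hFL] at h1
          rw [hsdef, mul_sub, mul_div_cancel₀ _ (hp L le_rfl).ne']
          linarith
        rw [← h2, hκL]
        unfold smearedKernel
        ring
      rw [h1]
      refine (abs_sub _ _).trans (add_le_add (le_of_eq ?_) ?_)
      · exact abs_of_nonneg (mul_nonneg hσ (normalPDF_pos R).le)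
      · rw [abs_mul, mul_comm]
        refine mul_le_mul_of_nonneg_right ?_ (abs_nonneg _)
        refine (abs_add_le _ _).trans (add_le_add le_rfl ?_)
        rw [abs_of_nonneg (by linarith [hs.1])]
        linarith [hs.2]
    have hlimL : Tendsto (fun R => G 0 (-R)) atTop (𝓝 0) := by
      refine tendsto_boundary (A := Real.exp c0) (B := |μ| + 1) (c := c) (σ := σ)
        (fun R => normalCDF (-R)) (fun R => ?_) (fun R => -R) (fun R => abs_neg R) ?_
        (Real.exp_pos _).le (by positivity) hσ
      · rw [abs_of_nonneg (normalCDF_nonneg _)]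
        have := normalCDF_le_exp (c + 1) (-R) (by linarith)
        rwa [mul_neg] at this
      filter_upwards [eventually_ge_atTop R0] with R hR
      have hR00 : 0 ≤ R := (Finset.sum_nonneg fun _ _ => abs_nonneg _).trans hR
      have hp00 := hp 0 (Nat.zero_le L)
      have hs : (normalCDF (-R) - F 0) / p 0 ∈ Icc (0 : ℝ) 1 := by
        have h1 := hFs 0
        rw [hF0, zero_add, zero_add] at h1
        have h3 : normalCDF (-R) ≤ p 0 := by
          rw [← h1]
          rcases Nat.eq_zero_or_pos L with h | h
          · have : F (0 + 1) = 1 := by rw [← hFL, h]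
            rw [this]
            exact normalCDF_le_one _
          · rw [← hx 1 ⟨le_rfl, h⟩]
            refine strictMono_normalCDF.monotone ?_
            linarith [neg_abs_le (x 1), hxR 1 h]
        rw [hF0, sub_zero]
        exact ⟨div_nonneg (normalCDF_nonneg _) hp00.le, (div_le_one hp00).2 h3⟩
      have he := hcc R hR00 0 (Nat.zero_le L) (-R) (by rw [abs_neg, abs_of_nonneg hR00]) hs
      simp only [hG, piecePrim, abs_mul, abs_of_pos (Real.exp_pos _)]
      refine mul_le_mul he ?_ (abs_nonneg _) (by positivity)
      set s := (normalCDF (-R) - F 0) / p 0 with hsdef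
      have h1 : p 0 * smearedKernel (0 : ℕ) (κ 0) μ s =
          normalCDF (-R) * (μ + (1 - s) / 2) := by
        have h2 : p 0 * s = normalCDF (-R) := by
          rw [hsdef, mul_div_cancel₀ _ hp00.ne', hF0, sub_zero]
        rw [← h2, hκ0]
        unfold smearedKernel
        push_cast
        ring
      rw [h1]
      refine (abs_sub _ _).trans (add_le_add (le_of_eq ?_) ?_)
      · exact abs_of_nonneg (mul_nonneg hσ (normalPDF_pos _).le)
      · rw [abs_mul, mul_comm]
        refine mul_le_mul_of_nonneg_right ?_ (abs_nonneg _)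
        refine (abs_add_le _ _).trans (add_le_add le_rfl ?_)
        rw [abs_of_nonneg (by linarith [hs.2])]
        linarith [hs.1]
    have hlim2 : Tendsto (fun R => θ * (G L R - G 0 (-R))) atTop (𝓝 0) := by
      simpa using (hlimR.sub hlimL).const_mul θ
    exact le_of_tendsto_of_tendsto hlim1 hlim2 ((eventually_ge_atTop R0).mono htrunc)
  have hmain := integral_exp_le_of_entropy hi1 hi2 hi3 hi4
    (fun z => mul_nonneg (sq_nonneg θ) (hYn _ (hJL z))) key
  rw [hXexp] at hmain
  have hdiff : ∀ z, Real.exp (θ * (J z - μ - σ * z)) ≤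
      Real.exp (|θ| / 2) * Real.exp (θ * D z) := fun z => by
    rw [← Real.exp_add]
    refine Real.exp_le_exp.2 ?_
    have h1 : θ * (J z - μ - σ * z) =
        θ * D z + θ * (1 / 2 - (normalCDF z - F (J z)) / p (J z)) := by
      simp only [hD, pieceDev]
      ring
    have h2 : θ * (1 / 2 - (normalCDF z - F (J z)) / p (J z)) ≤ |θ| * (1 / 2) := by
      refine (le_abs_self _).trans ?_
      rw [abs_mul]
      refine mul_le_mul_of_nonneg_left (abs_le.2 ?_) (abs_nonneg _)
      obtain ⟨h3, h4⟩ := hJs z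
      constructor <;> linarith
    linarith
  have hint : Integrable (fun z => Real.exp (θ * (J z - μ - σ * z))) stdNormal := by
    have h1 := hcomp (fun i => (i : ℝ))
    refine Integrable.mono' (hi1.const_mul (Real.exp (|θ| / 2)))
      (Measurable.aestronglyMeasurable (by fun_prop)) (Eventually.of_forall fun z => ?_)
    rw [Real.norm_of_nonneg (Real.exp_pos _).le]
    exact hdiff z
  refine ⟨hint, ?_⟩
  calc _ ≤ ∫ z, Real.exp (|θ| / 2) * Real.exp (θ * D z) ∂stdNormal :=
        integral_mono hint (hi1.const_mul _) hdiff
    _ ≤ _ := by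
        rw [integral_const_mul]
        exact mul_le_mul_of_nonneg_left hmain (Real.exp_pos _).le

/-! ### An inequality of Bernstein type -/

/-- **Bernstein-type integrability.** If `𝔼 e^{t δ} ≤ e^{2 v t²}` for `|t| ≤ 1`, then the variable
`min (|δ|, δ² / v)` has a universally bounded exponential moment. The Chernoff bounds for all the
levels `i ≤ X < i + 1` are summed up, each with its own exponent `t_i = min (1, √(i/v)) / 4`. -/
theorem lintegral_exp_le_of_subgamma {Ω : Type*} [MeasurableSpace Ω] (P : Measure Ω)
    (δ X : Ω → ℝ) (hδ : Measurable δ) (v : ℝ) (hv : 0 ≤ v)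
    (hmgf : ∀ t : ℝ, |t| ≤ 1 → ∫⁻ ω, ENNReal.ofReal (Real.exp (t * δ ω)) ∂P ≤
      ENNReal.ofReal (Real.exp (2 * v * t ^ 2)))
    (hX1 : ∀ ω, X ω ≤ |δ ω|) (hX2 : ∀ ω, v * X ω ≤ δ ω ^ 2) :
    ∫⁻ ω, ENNReal.ofReal (Real.exp (X ω / 16)) ∂P ≤ 68 := by
  set t : ℕ → ℝ := fun i => if v ≤ i then 1 / 4 else √(i / v) / 4 with ht
  have ht0 : ∀ i, 0 ≤ t i := fun i => by
    simp only [ht]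
    split_ifs <;> positivity
  have ht1 : ∀ i, t i ≤ 1 := fun i => by
    simp only [ht]
    split_ifs with h
    · norm_num
    · have h2 : √((i : ℝ) / v) ≤ 1 :=
        (Real.sqrt_le_sqrt (div_le_one_of_le₀ (not_le.1 h).le hv)).trans_eq Real.sqrt_one
      linarith
  set c : ℕ → ℝ := fun i => Real.exp ((1 - i) / 16 - 2 * v * t i ^ 2) with hc
  have hpt : ∀ ω, ENNReal.ofReal (Real.exp (X ω / 16)) ≤ ∑' i : ℕ, ENNReal.ofReal (c i) *
      (ENNReal.ofReal (Real.exp (t i * δ ω)) + ENNReal.ofReal (Real.exp (-t i * δ ω))) := by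
    intro ω
    set i := ⌊X ω⌋₊ with hi
    refine le_trans ?_ (ENNReal.le_tsum i)
    rw [← ENNReal.ofReal_add (Real.exp_pos _).le (Real.exp_pos _).le,
      ← ENNReal.ofReal_mul (Real.exp_pos _).le]
    refine ENNReal.ofReal_le_ofReal ?_
    have h1 : Real.exp (t i * |δ ω|) ≤ Real.exp (t i * δ ω) + Real.exp (-t i * δ ω) := by
      rcases abs_cases (δ ω) with ⟨h, _⟩ | ⟨h, _⟩ <;> rw [h]
      · linarith [Real.exp_pos (-t i * δ ω)]
      · rw [mul_neg, ← neg_mul]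
        linarith [Real.exp_pos (t i * δ ω)]
    refine le_trans ?_ (mul_le_mul_of_nonneg_left h1 (Real.exp_pos _).le)
    rw [← Real.exp_add]
    refine Real.exp_le_exp.2 ?_
    have h2 : X ω < i + 1 := Nat.lt_floor_add_one _
    have h3 : (i : ℝ) / 8 ≤ t i * |δ ω| - 2 * v * t i ^ 2 := by
      rcases Nat.eq_zero_or_pos i with h | h
      · simp only [ht, h]
        split_ifs with h4
        · have h5 : v = 0 := le_antisymm (by simpa using h4) hv
          simp [h5]
        · simp
      · have h4 : (i : ℝ) ≤ X ω := by
          refine Nat.floor_le ?_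
          by_contra! h5
          rw [Nat.floor_of_nonpos h5.le] at hi
          omega
        have h5 : (0 : ℝ) < i := Nat.cast_pos.2 h
        have h6 := hX1 ω
        have h7 := hX2 ω
        simp only [ht]
        split_ifs with h8
        · nlinarith
        · push Not at h8
          have hv0 : 0 < v := h5.trans h8
          have h9 : √((i : ℝ) / v) ^ 2 = i / v := Real.sq_sqrt (by positivity)
          have h10 : (i : ℝ) ≤ √((i : ℝ) / v) * |δ ω| := by
            refine abs_le_of_sq_le_sq' ?_ (by positivity) |>.2
            rw [mul_pow, h9, sq_abs]
            calc (i : ℝ) ^ 2 = i / v * (v * i) := by field_simp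
              _ ≤ i / v * δ ω ^ 2 := by
                refine mul_le_mul_of_nonneg_left ?_ (by positivity)
                nlinarith
          have h11 : 2 * v * (√((i : ℝ) / v) / 4) ^ 2 = i / 8 := by
            rw [div_pow, h9]
            field_simp
            norm_num
          linarith
    linarith
  calc ∫⁻ ω, ENNReal.ofReal (Real.exp (X ω / 16)) ∂P
      ≤ ∫⁻ ω, ∑' i : ℕ, ENNReal.ofReal (c i) * (ENNReal.ofReal (Real.exp (t i * δ ω)) +
          ENNReal.ofReal (Real.exp (-t i * δ ω))) ∂P := lintegral_mono hpt
    _ = ∑' i : ℕ, ENNReal.ofReal (c i) * (∫⁻ ω, ENNReal.ofReal (Real.exp (t i * δ ω)) ∂P +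
          ∫⁻ ω, ENNReal.ofReal (Real.exp (-t i * δ ω)) ∂P) := by
        rw [lintegral_tsum fun i => by fun_prop]
        refine tsum_congr fun i => ?_
        rw [lintegral_const_mul _ (by fun_prop), lintegral_add_left (by fun_prop)]
    _ ≤ ∑' i : ℕ, ENNReal.ofReal (4 * (16 / 17) ^ i) := by
        refine ENNReal.tsum_le_tsum fun i => ?_
        have h1 := hmgf (t i) (by rw [abs_of_nonneg (ht0 i)]; exact ht1 i)
        have h2 := hmgf (-t i) (by rw [abs_neg, abs_of_nonneg (ht0 i)]; exact ht1 i)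
        rw [neg_sq] at h2
        refine (mul_le_mul_right (add_le_add h1 h2) _).trans ?_
        rw [← ENNReal.ofReal_add (Real.exp_pos _).le (Real.exp_pos _).le,
          ← ENNReal.ofReal_mul (Real.exp_pos _).le]
        refine ENNReal.ofReal_le_ofReal ?_
        have h3 : c i * (Real.exp (2 * v * t i ^ 2) + Real.exp (2 * v * t i ^ 2)) =
            2 * (Real.exp (1 / 16) * Real.exp (-(1 / 16)) ^ i) := by
          rw [← two_mul, mul_left_comm, hc, ← Real.exp_add, ← Real.exp_nat_mul, ← Real.exp_add]
          congr 2
          ring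
        rw [h3]
        have h4 : Real.exp (1 / 16) ≤ 2 := by
          have := Real.exp_bound_div_one_sub_of_interval (x := 1 / 16) (by norm_num) (by norm_num)
          linarith
        have h5 : Real.exp (-(1 / 16)) ≤ 16 / 17 := by
          have := Real.add_one_le_exp (1 / 16 : ℝ)
          rw [Real.exp_neg, inv_le_comm₀ (Real.exp_pos _) (by norm_num)]
          linarith
        have h6 := pow_le_pow_left₀ (Real.exp_pos _).le h5 i
        have h7 := mul_le_mul h4 h6 (by positivity) (by norm_num)
        linarith
    _ = 68 := by
        have h := (hasSum_geometric_of_lt_one (r := (16 / 17 : ℝ)) (by norm_num)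
          (by norm_num)).mul_left 4
        rw [← ENNReal.ofReal_tsum_of_nonneg (fun i => by positivity) h.summable, h.tsum_eq]
        norm_num

/-! ### The hypergeometric distribution -/

/-- The hypergeometric probability `C(m, j) C(N - m, k - j) / C(N, k)` of drawing `j` marked items
in `k` draws without replacement from `N` items, `m` of which are marked. -/
noncomputable def hypergeom (N m k j : ℕ) : ℝ :=
  if j ≤ k then (m.choose j : ℝ) * ((N - m).choose (k - j) : ℝ) / (N.choose k : ℝ) else 0

/-- The normalization of the hypergeometric variance without finite population correction,
`N⁻³ k m (N - k) (N - m)`. -/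
noncomputable def hypergeomVar (N m k : ℕ) : ℝ :=
  (m : ℝ) * k * (N - m) * (N - k) / (N : ℝ) ^ 3

/-- The Stein kernel `(m - j) (k - j) / N` of the hypergeometric distribution. -/
noncomputable def hypergeomKernel (N m k j : ℕ) : ℝ := ((m : ℝ) - j) * (k - j) / N

lemma cast_choose_succ_mul (n t : ℕ) :
    (n.choose (t + 1) : ℝ) * (t + 1) = n.choose t * (n - t) := by
  rcases le_or_gt t n with h | h
  · have := Nat.choose_succ_right_eq n t
    rw [← Nat.cast_sub h]
    exact_mod_cast this
  · rw [Nat.choose_eq_zero_of_lt h, Nat.choose_eq_zero_of_lt (h.trans (Nat.lt_succ_self t))]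
    simp

section Hypergeom

variable {N m k : ℕ}

lemma hypergeom_nonneg (j : ℕ) : 0 ≤ hypergeom N m k j := by
  unfold hypergeom
  split_ifs <;> positivity

lemma hypergeom_of_gt {j : ℕ} (h : k < j) : hypergeom N m k j = 0 := by
  unfold hypergeom
  rw [if_neg (by omega)]

lemma hypergeom_eq_zero {j : ℕ} (h : m < j ∨ N - m < k - j) : hypergeom N m k j = 0 := by
  unfold hypergeom
  split_ifs
  · rcases h with h | h <;> simp [Nat.choose_eq_zero_of_lt h]
  · rfl

lemma hypergeom_pos (hk : k ≤ N) {j : ℕ} (h1 : j ≤ m) (h2 : j ≤ k) (h3 : k - j ≤ N - m) :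
    0 < hypergeom N m k j := by
  unfold hypergeom
  rw [if_pos h2]
  have := Nat.choose_pos h1
  have := Nat.choose_pos h3
  have := Nat.choose_pos hk
  positivity

lemma sum_hypergeom (hm : m ≤ N) (hk : k ≤ N) :
    ∑ j ∈ Finset.range (k + 1), hypergeom N m k j = 1 := by
  have h := Nat.add_choose_eq m (N - m) k
  rw [Nat.add_sub_cancel' hm, Finset.Nat.sum_antidiagonal_eq_sum_range_succ
    (f := fun i j => m.choose i * (N - m).choose j)] at h
  have hpos : (0 : ℝ) < N.choose k := Nat.cast_pos.2 (Nat.choose_pos hk)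
  have h2 : ∀ j ∈ Finset.range (k + 1), hypergeom N m k j =
      ((m.choose j * (N - m).choose (k - j) : ℕ) : ℝ) / N.choose k := fun j hj => by
    rw [hypergeom, if_pos (Nat.lt_succ_iff.1 (Finset.mem_range.1 hj))]
    push_cast
    rfl
  rw [Finset.sum_congr rfl h2, ← Finset.sum_div, ← Nat.cast_sum, ← h, div_self hpos.ne']

/-- The recursion that characterizes the Stein kernel: at each atom, the flow to the right equals the
kernel of the next atom, corrected by its deviation from the mean. -/
lemma hypergeom_rec (hm : m ≤ N) (hN : 0 < N) (j : ℕ) :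
    hypergeom N m k j * hypergeomKernel N m k j = hypergeom N m k (j + 1) *
      (hypergeomKernel N m k (j + 1) + (((j + 1 : ℕ) : ℝ) - (m : ℝ) * k / N)) := by
  have hN0 : (N : ℝ) ≠ 0 := Nat.cast_ne_zero.2 hN.ne'
  have h0 : hypergeomKernel N m k (j + 1) + (((j + 1 : ℕ) : ℝ) - (m : ℝ) * k / N) =
      ((j : ℝ) + 1) * (N - m - (k - j - 1)) / N := by
    unfold hypergeomKernel
    push_cast
    field_simp
    ring
  rw [h0]
  unfold hypergeomKernel
  rcases lt_trichotomy j k with h | h | h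
  · unfold hypergeom
    rw [if_pos h.le, if_pos (show j + 1 ≤ k from h)]
    obtain ⟨t, rfl⟩ : ∃ t, k = j + 1 + t := ⟨k - (j + 1), by omega⟩
    have e1 : j + 1 + t - j = t + 1 := by omega
    have e2 : j + 1 + t - (j + 1) = t := by omega
    rw [e1, e2]
    have h1 := cast_choose_succ_mul m j
    have h2 := cast_choose_succ_mul (N - m) t
    rw [Nat.cast_sub hm] at h2
    push_cast
    have h3 : ((j : ℝ) + 1 + t - j - 1) = t := by ring
    have h4 : ((j : ℝ) + 1 + t - j) = t + 1 := by ring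
    rw [h3, h4]
    calc _ = (m.choose j * ((m : ℝ) - j)) * ((N - m).choose (t + 1) * (t + 1)) /
          (N.choose (j + 1 + t)) / N := by ring
      _ = (m.choose (j + 1) * ((j : ℝ) + 1)) * ((N - m).choose t * ((N : ℝ) - m - t)) /
          (N.choose (j + 1 + t)) / N := by rw [h1, h2]
      _ = _ := by ring
  · subst h
    rw [hypergeom_of_gt (Nat.lt_succ_self j)]
    simp
  · rw [hypergeom_of_gt h, hypergeom_of_gt (h.trans (Nat.lt_succ_self j))]
    simp

/-- The discrete Stein identity of the hypergeometric distribution. -/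
lemma hypergeom_stein (hm : m ≤ N) (hN : 0 < N) (f : ℕ → ℝ) :
    ∑ j ∈ Finset.range (k + 1), hypergeom N m k j * (j - (m : ℝ) * k / N) * f j =
      ∑ j ∈ Finset.range (k + 1),
        hypergeom N m k j * hypergeomKernel N m k j * (f (j + 1) - f j) := by
  have h : ∀ n, ∑ j ∈ Finset.range (n + 1), hypergeom N m k j * (j - (m : ℝ) * k / N) * f j =
      ∑ j ∈ Finset.range (n + 1),
        hypergeom N m k j * hypergeomKernel N m k j * (f (j + 1) - f j) -
        hypergeom N m k n * hypergeomKernel N m k n * f (n + 1) := by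
    intro n
    induction n with
    | zero =>
      simp only [zero_add, Finset.sum_range_one]
      have : hypergeomKernel N m k 0 = (m : ℝ) * k / N := by simp [hypergeomKernel]
      rw [this]
      push_cast
      ring
    | succ n ih =>
      rw [Finset.sum_range_succ, ih, Finset.sum_range_succ _ (n + 1)]
      have := hypergeom_rec (k := k) hm hN n
      rw [mul_add] at this
      linear_combination -(f (n + 1)) * this
  rw [h k]
  have : hypergeomKernel N m k k = 0 := by simp [hypergeomKernel]
  rw [this]
  ring

lemma hypergeomKernel_eq (hN : 0 < N) (j : ℕ) :
    hypergeomKernel N m k j = hypergeomVar N m k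
      - (j - (m : ℝ) * k / N) * ((m : ℝ) + k - 2 * ((m : ℝ) * k / N)) / N
      + (j - (m : ℝ) * k / N) ^ 2 / N := by
  have hN0 : (N : ℝ) ≠ 0 := Nat.cast_ne_zero.2 hN.ne'
  unfold hypergeomKernel hypergeomVar
  field_simp
  ring

lemma hypergeomVar_nonneg (hm : m ≤ N) (hk : k ≤ N) : 0 ≤ hypergeomVar N m k := by
  have h1 : (0 : ℝ) ≤ N - m := sub_nonneg.2 (Nat.cast_le.2 hm)
  have h2 : (0 : ℝ) ≤ N - k := sub_nonneg.2 (Nat.cast_le.2 hk)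
  unfold hypergeomVar
  positivity

/-- The mean of the Stein kernel is the true variance `N / (N - 1) * hypergeomVar`; the case `N = 1`
is degenerate. -/
lemma sum_hypergeom_kernel_le (hm : m ≤ N) (hk : k ≤ N) (hN : 0 < N) :
    ∑ j ∈ Finset.range (k + 1), hypergeom N m k j * hypergeomKernel N m k j ≤
      2 * hypergeomVar N m k := by
  set V := ∑ j ∈ Finset.range (k + 1), hypergeom N m k j * hypergeomKernel N m k j with hV
  have hN0 : (0 : ℝ) < N := Nat.cast_pos.2 hN
  rcases Nat.lt_or_ge 1 N with h1 | h1
  · have h2 : (2 : ℝ) ≤ N := by exact_mod_cast h1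
    have e1 : ∑ j ∈ Finset.range (k + 1), hypergeom N m k j * (j - (m : ℝ) * k / N) = 0 := by
      have := hypergeom_stein (k := k) hm hN (fun _ => 1)
      simpa using this
    have e2 : ∑ j ∈ Finset.range (k + 1), hypergeom N m k j * (j - (m : ℝ) * k / N) ^ 2 = V := by
      have := hypergeom_stein (k := k) hm hN (fun j => (j : ℝ) - (m : ℝ) * k / N)
      rw [hV]
      convert this using 2 with j _ j _
      · ring
      · push_cast
        ring
    have e3 : V = hypergeomVar N m k + V / N := by
      calc V = ∑ j ∈ Finset.range (k + 1), (hypergeom N m k j * hypergeomVar N m k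
            - hypergeom N m k j * (j - (m : ℝ) * k / N) *
              (((m : ℝ) + k - 2 * ((m : ℝ) * k / N)) / N)
            + hypergeom N m k j * (j - (m : ℝ) * k / N) ^ 2 / N) := by
            rw [hV]
            refine Finset.sum_congr rfl fun j _ => ?_
            rw [hypergeomKernel_eq hN]
            ring
        _ = _ := by
            rw [Finset.sum_add_distrib, Finset.sum_sub_distrib, ← Finset.sum_mul,
              ← Finset.sum_mul, ← Finset.sum_div, e1, e2, sum_hypergeom hm hk]
            ring
    have h3 := hypergeomVar_nonneg hm hk
    have h4 : V * (N - 1) = hypergeomVar N m k * N := by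
      field_simp at e3
      linarith
    nlinarith
  · have h2 : N = 1 := by omega
    subst h2
    have : V = 0 := by
      rw [hV]
      interval_cases m <;> interval_cases k <;>
        simp [hypergeom, hypergeomKernel, Finset.sum_range_succ]
    rw [this]
    linarith [hypergeomVar_nonneg hm hk]

/-- Chebyshev's association inequality for a discrete probability vector. -/
lemma sum_mul_le_of_antivary {s : Finset ℕ} {p f g : ℕ → ℝ} (hp : ∀ i ∈ s, 0 ≤ p i)
    (hsum : ∑ i ∈ s, p i = 1)
    (h : ∀ i ∈ s, ∀ j ∈ s, 0 < p i → 0 < p j → (f i - f j) * (g i - g j) ≤ 0) :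
    ∑ i ∈ s, p i * f i * g i ≤ (∑ i ∈ s, p i * f i) * ∑ i ∈ s, p i * g i := by
  have h1 : ∑ i ∈ s, ∑ j ∈ s, p i * p j * ((f i - f j) * (g i - g j)) ≤ 0 := by
    refine Finset.sum_nonpos fun i hi => Finset.sum_nonpos fun j hj => ?_
    rcases (hp i hi).eq_or_lt with h2 | h2
    · rw [← h2]
      simp
    rcases (hp j hj).eq_or_lt with h3 | h3
    · rw [← h3]
      simp
    exact mul_nonpos_of_nonneg_of_nonpos (by positivity) (h i hi j hj h2 h3)
  have h2 : ∑ i ∈ s, ∑ j ∈ s, p i * p j * ((f i - f j) * (g i - g j)) =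
      2 * ((∑ i ∈ s, p i * f i * g i) * ∑ i ∈ s, p i) -
      2 * ((∑ i ∈ s, p i * f i) * ∑ i ∈ s, p i * g i) := by
    have e : ∀ i j, p i * p j * ((f i - f j) * (g i - g j)) =
        (p i * f i * g i) * p j + p i * (p j * f j * g j) - (p i * f i) * (p j * g j)
          - (p i * g i) * (p j * f j) := fun i j => by ring
    simp_rw [e, Finset.sum_sub_distrib, Finset.sum_add_distrib, ← Finset.mul_sum,
      ← Finset.sum_mul]
    ring
  rw [h2, hsum] at h1
  linarith

/-- Laplace transform of the centred hypergeometric distribution, for nonnegative arguments. -/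
lemma hypergeom_mgf_le_of_nonneg (hm : m ≤ N) (hk : k ≤ N) (hN : 0 < N) {t : ℝ} (ht0 : 0 ≤ t)
    (ht1 : t ≤ 1) :
    ∑ j ∈ Finset.range (k + 1), hypergeom N m k j * Real.exp (t * (j - (m : ℝ) * k / N)) ≤
      Real.exp (2 * hypergeomVar N m k * t ^ 2) := by
  set V := 2 * hypergeomVar N m k with hV
  set M : ℝ → ℝ := fun t =>
    ∑ j ∈ Finset.range (k + 1), hypergeom N m k j * Real.exp (t * (j - (m : ℝ) * k / N)) with hM
  set M' : ℝ → ℝ := fun t => ∑ j ∈ Finset.range (k + 1),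
    hypergeom N m k j * (j - (m : ℝ) * k / N) * Real.exp (t * (j - (m : ℝ) * k / N)) with hM'
  have hder : ∀ t, HasDerivAt M (M' t) t := by
    intro t
    refine HasDerivAt.fun_sum fun j _ => ?_
    have := (((hasDerivAt_id t).mul_const (j - (m : ℝ) * k / N)).exp).const_mul
      (hypergeom N m k j)
    refine this.congr_deriv ?_
    simp only [id, one_mul]
    ring
  have hM0 : ∀ t, 0 ≤ M t := fun t =>
    Finset.sum_nonneg fun j _ => mul_nonneg (hypergeom_nonneg j) (Real.exp_pos _).le
  have hM'le : ∀ t, 0 ≤ t → t ≤ 1 → M' t ≤ 2 * t * V * M t := by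
    intro t ht0 ht1
    have h1 : M' t = (Real.exp t - 1) * ∑ j ∈ Finset.range (k + 1),
        hypergeom N m k j * hypergeomKernel N m k j * Real.exp (t * (j - (m : ℝ) * k / N)) := by
      rw [hM']
      simp only
      rw [hypergeom_stein hm hN (fun j => Real.exp (t * (j - (m : ℝ) * k / N))), Finset.mul_sum]
      refine Finset.sum_congr rfl fun j _ => ?_
      have : Real.exp (t * (((j + 1 : ℕ) : ℝ) - (m : ℝ) * k / N)) =
          Real.exp t * Real.exp (t * (j - (m : ℝ) * k / N)) := by
        rw [← Real.exp_add]
        congr 1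
        push_cast
        ring
      rw [this]
      ring
    have h2 : ∑ j ∈ Finset.range (k + 1),
        hypergeom N m k j * hypergeomKernel N m k j * Real.exp (t * (j - (m : ℝ) * k / N)) ≤
        V * M t := by
      refine (sum_mul_le_of_antivary (fun j _ => hypergeom_nonneg j) (sum_hypergeom hm hk)
        fun i _ j _ hi hj => ?_).trans
        (mul_le_mul_of_nonneg_right (sum_hypergeom_kernel_le hm hk hN) (hM0 t))
      -- the kernel decreases and the exponential increases on the support
      have hsupp : ∀ i, 0 < hypergeom N m k i → i ≤ m ∧ i ≤ k := fun i hi => by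
        constructor
        · by_contra! h
          rw [hypergeom_eq_zero (Or.inl h)] at hi
          exact lt_irrefl _ hi
        · by_contra! h
          rw [hypergeom_of_gt h] at hi
          exact lt_irrefl _ hi
      have hmono : ∀ i j : ℕ, i ≤ j → 0 < hypergeom N m k j →
          (hypergeomKernel N m k i - hypergeomKernel N m k j) *
          (Real.exp (t * (i - (m : ℝ) * k / N)) - Real.exp (t * (j - (m : ℝ) * k / N))) ≤ 0 := by
        intro i j hij hj
        obtain ⟨h3, h4⟩ := hsupp j hj
        have h5 : (i : ℝ) ≤ j := Nat.cast_le.2 hij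
        have h6 : (j : ℝ) ≤ m := Nat.cast_le.2 h3
        have h7 : (j : ℝ) ≤ k := Nat.cast_le.2 h4
        refine mul_nonpos_of_nonneg_of_nonpos ?_ ?_
        · unfold hypergeomKernel
          rw [← sub_div]
          refine div_nonneg ?_ (Nat.cast_nonneg _)
          nlinarith
        · rw [sub_nonpos]
          refine Real.exp_le_exp.2 (mul_le_mul_of_nonneg_left (by linarith) ht0)
      rcases le_total i j with hij | hij
      · exact hmono i j hij hj
      · have := hmono j i hij hi
        nlinarith
    have h3 : Real.exp t - 1 ≤ 2 * t := by
      have := Real.abs_exp_sub_one_sub_id_le (x := t) (by rw [abs_of_nonneg ht0]; exact ht1)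
      have := (abs_le.1 this).2
      nlinarith
    have h4 : 0 ≤ Real.exp t - 1 := by linarith [Real.add_one_le_exp t]
    have h5 : 0 ≤ V * M t := mul_nonneg (by linarith [hypergeomVar_nonneg hm hk]) (hM0 t)
    rw [h1]
    calc _ ≤ (Real.exp t - 1) * (V * M t) := mul_le_mul_of_nonneg_left h2 h4
      _ ≤ 2 * t * (V * M t) := mul_le_mul_of_nonneg_right h3 h5
      _ = _ := by ring
  set G : ℝ → ℝ := fun t => M t * Real.exp (-(V * t ^ 2)) with hG
  have hGd : ∀ t, HasDerivAt G (M' t * Real.exp (-(V * t ^ 2)) +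
      M t * (Real.exp (-(V * t ^ 2)) * -(V * (2 * t)))) t := by
    intro t
    refine (hder t).mul ?_
    have := (((hasDerivAt_id t).fun_pow 2).const_mul V).fun_neg.exp
    refine this.congr_deriv ?_
    simp
  have hanti : AntitoneOn G (Icc 0 1) := by
    refine antitoneOn_of_deriv_nonpos (convex_Icc 0 1)
      (fun t _ => (hGd t).continuousAt.continuousWithinAt)
      (fun t _ => (hGd t).differentiableAt.differentiableWithinAt) fun t ht => ?_
    rw [interior_Icc] at ht
    rw [(hGd t).deriv]
    have := hM'le t ht.1.le ht.2.le
    have hE := Real.exp_pos (-(V * t ^ 2))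
    nlinarith
  have h := hanti ⟨le_rfl, zero_le_one⟩ ⟨ht0, ht1⟩ ht0
  have hG0 : G 0 = 1 := by
    simp only [hG, hM]
    simp [sum_hypergeom hm hk]
  rw [hG0] at h
  simp only [hG] at h
  rw [Real.exp_neg, ← div_eq_mul_inv, div_le_one (Real.exp_pos _)] at h
  exact h

/-- Laplace transform of the centred hypergeometric distribution. -/
lemma hypergeom_mgf_le (hm : m ≤ N) (hk : k ≤ N) (hN : 0 < N) {t : ℝ} (ht : |t| ≤ 1) :
    ∑ j ∈ Finset.range (k + 1), hypergeom N m k j * Real.exp (t * (j - (m : ℝ) * k / N)) ≤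
      Real.exp (2 * hypergeomVar N m k * t ^ 2) := by
  rcases le_total 0 t with h | h
  · exact hypergeom_mgf_le_of_nonneg hm hk hN h ((le_abs_self t).trans ht)
  · -- exchange marked and unmarked items
    have h1 := hypergeom_mgf_le_of_nonneg (m := N - m) (Nat.sub_le N m) hk hN
      (neg_nonneg.2 h) ((neg_le_abs t).trans ht)
    have hN0 : (N : ℝ) ≠ 0 := Nat.cast_ne_zero.2 hN.ne'
    have h2 : hypergeomVar N (N - m) k = hypergeomVar N m k := by
      unfold hypergeomVar
      rw [Nat.cast_sub hm]
      ring
    rw [h2, neg_sq] at h1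
    refine le_trans (le_of_eq ?_) h1
    rw [← Finset.sum_range_reflect]
    refine Finset.sum_congr rfl fun j hj => ?_
    have hj : j ≤ k := Nat.lt_succ_iff.1 (Finset.mem_range.1 hj)
    have e : k + 1 - 1 - j = k - j := by omega
    rw [e]
    congr 1
    · unfold hypergeom
      rw [if_pos (Nat.sub_le k j), if_pos hj, Nat.sub_sub_self hj, Nat.sub_sub_self hm]
      ring
    · congr 1
      rw [Nat.cast_sub hj, Nat.cast_sub hm]
      field_simp
      ring

/-- The hypergeometric distribution as a measure. -/
noncomputable def hypergeomMeasure (N m k : ℕ) : Measure ℕ :=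
  ∑ j ∈ Finset.range (k + 1), ENNReal.ofReal (hypergeom N m k j) • Measure.dirac j

lemma lintegral_hypergeomMeasure (f : ℕ → ℝ≥0∞) :
    ∫⁻ j, f j ∂(hypergeomMeasure N m k) = ∑ j ∈ Finset.range (k + 1),
      ENNReal.ofReal (hypergeom N m k j) * f j := by
  rw [hypergeomMeasure, lintegral_finsetSum_measure]
  simp

/-- A universal exponential moment for the centred hypergeometric distribution. -/
lemma sum_hypergeom_exp_le (hm : m ≤ N) (hk : k ≤ N) (hN : 0 < N) {v : ℝ}
    (hv : hypergeomVar N m k ≤ v) (X : ℕ → ℝ)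
    (hX1 : ∀ j, X j ≤ |(j : ℝ) - (m : ℝ) * k / N|)
    (hX2 : ∀ j, v * X j ≤ ((j : ℝ) - (m : ℝ) * k / N) ^ 2) :
    ∑ j ∈ Finset.range (k + 1), hypergeom N m k j * Real.exp (X j / 16) ≤ 68 := by
  have hconv : ∀ f : ℕ → ℝ, ∫⁻ j, ENNReal.ofReal (Real.exp (f j)) ∂(hypergeomMeasure N m k) =
      ENNReal.ofReal (∑ j ∈ Finset.range (k + 1), hypergeom N m k j * Real.exp (f j)) := by
    intro f
    rw [lintegral_hypergeomMeasure, ENNReal.ofReal_sum_of_nonneg fun j _ =>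
      mul_nonneg (hypergeom_nonneg j) (Real.exp_pos _).le]
    refine Finset.sum_congr rfl fun j _ => ?_
    rw [ENNReal.ofReal_mul (hypergeom_nonneg j)]
  have h := lintegral_exp_le_of_subgamma (hypergeomMeasure N m k)
    (fun j => (j : ℝ) - (m : ℝ) * k / N) X (measurable_of_countable _) v
    ((hypergeomVar_nonneg hm hk).trans hv)
    (fun t ht => by
      rw [hconv]
      refine ENNReal.ofReal_le_ofReal ((hypergeom_mgf_le hm hk hN ht).trans
        (Real.exp_le_exp.2 ?_))
      exact mul_le_mul_of_nonneg_right (by linarith) (sq_nonneg t)) hX1 hX2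
  rw [hconv (fun j => X j / 16)] at h
  have h68 : (68 : ℝ≥0∞) = ENNReal.ofReal 68 := by norm_num
  rw [h68] at h
  exact (ENNReal.ofReal_le_ofReal_iff (by norm_num)).1 h

/-! ### Normal coupling of the hypergeometric distribution -/

lemma sq_sqrt_sub_sqrt_le {q v : ℝ} (hq : 0 ≤ q) (hv : 0 ≤ v) :
    (√q - √v) ^ 2 ≤ |q - v| ∧ v * (√q - √v) ^ 2 ≤ (q - v) ^ 2 := by
  have h1 : (√q - √v) * (√q + √v) = q - v := by
    linear_combination Real.sq_sqrt hq - Real.sq_sqrt hv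
  have hsq := Real.sqrt_nonneg q
  have hsv := Real.sqrt_nonneg v
  constructor
  · rw [← h1, abs_mul, abs_of_nonneg (add_nonneg hsq hsv), ← sq_abs, sq]
    refine mul_le_mul_of_nonneg_left ?_ (abs_nonneg _)
    rw [abs_le]
    constructor <;> linarith
  · rw [← h1, mul_pow, mul_comm]
    refine mul_le_mul_of_nonneg_left ?_ (sq_nonneg _)
    calc v = √v ^ 2 := (Real.sq_sqrt hv).symm
      _ ≤ _ := pow_le_pow_left₀ hsv (by linarith) 2

/-- The squared distance between the square root of the smeared hypergeometric kernel and the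
standard deviation is at most of the order of both `|δ| + 1` and `(|δ| + 1)² / σ²`. -/
lemma sq_sqrt_kernel_sub_le (hm : m ≤ N) (hk : k ≤ N) (hN : 0 < N) {j : ℕ} (hj : j ≤ m)
    {X s : ℝ} (hs : s ∈ Icc (0 : ℝ) 1)
    (hq : 0 ≤ hypergeomKernel N m k j + (1 - s) * (j - (m : ℝ) * k / N) + s * (1 - s) / 2)
    (hX0 : 0 ≤ X)
    (hX : ∀ a, a ≤ |(j : ℝ) - (m : ℝ) * k / N| →
      hypergeomVar N m k * a ≤ ((j : ℝ) - (m : ℝ) * k / N) ^ 2 → a ≤ X) :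
    (√(hypergeomKernel N m k j + (1 - s) * (j - (m : ℝ) * k / N) + s * (1 - s) / 2) -
      √(hypergeomVar N m k)) ^ 2 ≤ 4 + 16 * X := by
  have hv := hypergeomVar_nonneg hm hk
  rw [hypergeomKernel_eq hN] at hq ⊢
  set δ := (j : ℝ) - (m : ℝ) * k / N with hδ
  set v := hypergeomVar N m k
  have hN0 : (0 : ℝ) < N := Nat.cast_pos.2 hN
  have hm' : (m : ℝ) ≤ N := Nat.cast_le.2 hm
  have hk' : (k : ℝ) ≤ N := Nat.cast_le.2 hk
  have hj' : (j : ℝ) ≤ m := Nat.cast_le.2 hj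
  have hmn : (0 : ℝ) ≤ m := Nat.cast_nonneg m
  have hkn : (0 : ℝ) ≤ k := Nat.cast_nonneg k
  have hjn : (0 : ℝ) ≤ j := Nat.cast_nonneg j
  have hμ : (m : ℝ) * k / N ≤ m := by
    rw [div_le_iff₀ hN0]
    nlinarith
  have hμ0 : 0 ≤ (m : ℝ) * k / N := by positivity
  have hμ' : (m : ℝ) * k / N ≤ k := by
    rw [div_le_iff₀ hN0]
    nlinarith
  have hδN : |δ| ≤ N := by
    rw [abs_le]
    constructor <;> linarith
  set b := ((m : ℝ) + k - 2 * ((m : ℝ) * k / N)) / N with hb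
  have hb0 : 0 ≤ b := div_nonneg (by linarith) hN0.le
  have hb1 : b ≤ 1 := by
    rw [hb, div_le_one hN0]
    have : (m : ℝ) * k / N * N = m * k := div_mul_cancel₀ _ hN0.ne'
    nlinarith
  set q := v - δ * ((m : ℝ) + k - 2 * ((m : ℝ) * k / N)) / N + δ ^ 2 / N + (1 - s) * δ
    + s * (1 - s) / 2 with hqdef
  have hqv : |q - v| ≤ 3 * |δ| + 1 := by
    have e : q - v = -(b * δ) + δ * (δ / N) + (1 - s) * δ + s * (1 - s) / 2 := by
      rw [hqdef, hb]
      ring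
    have h1 : |b * δ| ≤ |δ| := by
      rw [abs_mul, abs_of_nonneg hb0]
      exact mul_le_of_le_one_left (abs_nonneg _) hb1
    have h2 : |δ * (δ / N)| ≤ |δ| := by
      rw [abs_mul, abs_div, abs_of_pos hN0]
      exact mul_le_of_le_one_right (abs_nonneg _) ((div_le_one hN0).2 hδN)
    have h3 : |(1 - s) * δ| ≤ |δ| := by
      rw [abs_mul, abs_of_nonneg (by linarith [hs.2])]
      exact mul_le_of_le_one_left (abs_nonneg _) (by linarith [hs.1])
    have h4 : |s * (1 - s) / 2| ≤ 1 := by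
      obtain ⟨hs0, hs1⟩ := hs
      rw [abs_le]
      constructor <;> nlinarith
    rw [e]
    refine (abs_add_le _ _).trans ?_
    have h5 := abs_add_three (-(b * δ)) (δ * (δ / N)) ((1 - s) * δ)
    rw [abs_neg] at h5
    linarith
  obtain ⟨hA, hB⟩ := sq_sqrt_sub_sqrt_le hq hv
  rw [← sq_abs (q - v)] at hB
  rcases lt_or_ge |δ| 1 with h | h
  · linarith
  · have h2 : |q - v| ≤ 4 * |δ| := by linarith
    have h3 : |q - v| ^ 2 ≤ 16 * δ ^ 2 := by
      rw [← sq_abs δ]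
      nlinarith [abs_nonneg (q - v)]
    have := hX ((√q - √v) ^ 2 / 16) (by linarith [abs_nonneg δ]) (by linarith)
    linarith

/-- **Uniform Tusnády-type coupling.** All hypergeometric distributions are coupled with normal
variables of the same (uncorrected) variance with uniformly bounded exponential moments of the
difference. -/
theorem exists_hypergeom_coupling (hm : m ≤ N) (hk : k ≤ N) (hN : 0 < N) :
    ∃ J : ℝ → ℕ, Measurable J ∧
      (∀ j, stdNormal (J ⁻¹' {j}) = ENNReal.ofReal (hypergeom N m k j)) ∧
      ∀ t : ℝ, 0 ≤ t → t ≤ 1 / 32 →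
        ∫⁻ z, ENNReal.ofReal (Real.exp (t * |(J z : ℝ) - (m : ℝ) * k / N -
          √(hypergeomVar N m k) * z|)) ∂stdNormal ≤ 272 := by
  have hN0 : (0 : ℝ) < N := Nat.cast_pos.2 hN
  have hv := hypergeomVar_nonneg hm hk
  -- the support is `j0, …, j0 + L`
  set j0 := m + k - N with hj0
  set L := min m k - j0 with hL
  have hjL : j0 + L = min m k := by omega
  set μ := (m : ℝ) * k / N with hμ
  set X : ℕ → ℝ := fun j => if hypergeomVar N m k = 0 then |(j : ℝ) - μ| else
    min |(j : ℝ) - μ| (((j : ℝ) - μ) ^ 2 / hypergeomVar N m k) with hX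
  have hX0 : ∀ j, 0 ≤ X j := fun j => by
    simp only [hX]
    split_ifs <;> positivity
  have hX1 : ∀ j, X j ≤ |(j : ℝ) - μ| := fun j => by
    simp only [hX]
    split_ifs
    · exact le_rfl
    · exact min_le_left _ _
  have hX2 : ∀ j, hypergeomVar N m k * X j ≤ ((j : ℝ) - μ) ^ 2 := fun j => by
    simp only [hX]
    split_ifs with h
    · rw [h, zero_mul]
      positivity
    · have hv' : 0 < hypergeomVar N m k := lt_of_le_of_ne hv (Ne.symm h)
      calc _ ≤ hypergeomVar N m k * (((j : ℝ) - μ) ^ 2 / hypergeomVar N m k) :=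
            mul_le_mul_of_nonneg_left (min_le_right _ _) hv
        _ = _ := by field_simp
  have hXmax : ∀ j : ℕ, ∀ a, a ≤ |(j : ℝ) - μ| →
      hypergeomVar N m k * a ≤ ((j : ℝ) - μ) ^ 2 → a ≤ X j := fun j a h1 h2 => by
    simp only [hX]
    split_ifs with h
    · exact h1
    · have hv' : 0 < hypergeomVar N m k := lt_of_le_of_ne hv (Ne.symm h)
      refine le_min h1 ((le_div_iff₀ hv').2 (by linarith))
  have hk0 : ∀ j : ℕ, j ≤ m → j ≤ k → 0 ≤ hypergeomKernel N m k j := fun j h1 h2 => by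
    have h1' : (j : ℝ) ≤ m := Nat.cast_le.2 h1
    have h2' : (j : ℝ) ≤ k := Nat.cast_le.2 h2
    exact div_nonneg (mul_nonneg (by linarith) (by linarith)) hN0.le
  have hk1' : ∀ j : ℕ, hypergeomKernel N m k j + (j - μ) = j * ((N : ℝ) - m - k + j) / N :=
    fun j => by
      rw [hypergeomKernel, hμ]
      field_simp
      ring
  have hk1 : ∀ j : ℕ, j0 ≤ j → 0 ≤ hypergeomKernel N m k j + (j - μ) := fun j h1 => by
    rw [hk1']
    have h2 : m + k ≤ N + j := by omega
    have h3 : (m : ℝ) + k ≤ N + j := by exact_mod_cast h2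
    exact div_nonneg (mul_nonneg (Nat.cast_nonneg _) (by linarith)) hN0.le
  have hsm : ∀ (i : ℕ) (s : ℝ), smearedKernel i (hypergeomKernel N m k (j0 + i)) (μ - j0) s =
      hypergeomKernel N m k (j0 + i) + (1 - s) * (((j0 + i : ℕ) : ℝ) - μ) + s * (1 - s) / 2 :=
    fun i s => by
      unfold smearedKernel
      push_cast
      ring
  have hzero : ∀ j, (j < j0 ∨ j0 + L < j) → hypergeom N m k j = 0 := fun j hj => by
    rcases Nat.lt_or_ge k j with h | h
    · exact hypergeom_of_gt h
    · refine hypergeom_eq_zero ?_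
      omega
  obtain ⟨J, hJm, hJ, hJt⟩ := exists_quantile_coupling L (fun i => hypergeom N m k (j0 + i))
    (fun i => hypergeomKernel N m k (j0 + i)) (fun i => 4 + 16 * X (j0 + i)) (μ - j0)
    (√(hypergeomVar N m k)) (Real.sqrt_nonneg _)
    (fun i hi => hypergeom_pos hk (by omega) (by omega) (by omega))
    (fun i hi => hzero _ (Or.inr (by omega)))
    (by
      rw [← sum_hypergeom hm hk, Finset.range_eq_Ico, Finset.range_eq_Ico,
        Finset.sum_Ico_add (fun j => hypergeom N m k j) 0 (L + 1) j0]
      refine Finset.sum_subset (fun j hj => ?_) fun j hj hj' => hzero j ?_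
      · simp only [Finset.mem_Ico] at hj ⊢
        omega
      · simp only [Finset.mem_Ico] at hj hj'
        omega)
    (by
      have h1 := hk1' j0
      have h2 : (j0 : ℝ) * ((N : ℝ) - m - k + j0) = 0 := by
        rcases Nat.lt_or_ge N (m + k) with h | h
        · have h3 : m + k = N + j0 := by omega
          have h4 : (m : ℝ) + k = N + j0 := by exact_mod_cast h3
          rw [show (N : ℝ) - m - k + j0 = 0 by linarith, mul_zero]
        · have h3 : j0 = 0 := by omega
          rw [h3, Nat.cast_zero, zero_mul]
      rw [h2, zero_div] at h1
      simp only [add_zero]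
      linarith)
    (by
      simp only [hjL, hypergeomKernel]
      rcases le_total m k with h | h
      · rw [min_eq_left h]
        simp
      · rw [min_eq_right h]
        simp)
    (fun i _ => by
      have h1 := hypergeom_rec (k := k) hm hN (j0 + i)
      rw [h1, add_assoc]
      congr 2
      push_cast
      ring)
    (fun i hi => hk0 _ (by omega) (by omega))
    (fun i hi => by
      have h1 := hk1 (j0 + i) (by omega)
      push_cast at h1
      linarith)
    (fun i hi s hs => by
      have hq : 0 ≤ hypergeomKernel N m k (j0 + i) + (1 - s) * (((j0 + i : ℕ) : ℝ) - μ)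
          + s * (1 - s) / 2 := by
        have h1 := hk0 (j0 + i) (by omega) (by omega)
        have h2 := hk1 (j0 + i) (by omega)
        obtain ⟨hs0, hs1⟩ := hs
        nlinarith
      rw [hsm]
      exact sq_sqrt_kernel_sub_le hm hk hN (by omega) hs hq (hX0 _) (hXmax _))
  have hbound : ∀ t : ℝ, |t| ≤ 1 / 32 →
      ∫⁻ z, ENNReal.ofReal (Real.exp (t * (((j0 + J z : ℕ) : ℝ) - μ -
        √(hypergeomVar N m k) * z))) ∂stdNormal ≤ 136 := by
    intro t ht
    obtain ⟨hi, hle⟩ := hJt t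
    have e : ∀ z, t * (((j0 + J z : ℕ) : ℝ) - μ - √(hypergeomVar N m k) * z) =
        t * (J z - (μ - j0) - √(hypergeomVar N m k) * z) := fun z => by
      push_cast
      ring
    simp_rw [e]
    rw [← ofReal_integral_eq_lintegral_ofReal hi
      (Eventually.of_forall fun z => (Real.exp_pos _).le)]
    have h136 : (136 : ℝ≥0∞) = ENNReal.ofReal 136 := by norm_num
    rw [h136]
    refine ENNReal.ofReal_le_ofReal (hle.trans ?_)
    have ht2 : t ^ 2 ≤ 1 / 1024 := by
      rw [← sq_abs]
      nlinarith [abs_nonneg t]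
    have h1 : ∑ i ∈ Finset.range (L + 1), hypergeom N m k (j0 + i) *
        Real.exp (2 * t ^ 2 * (4 + 16 * X (j0 + i))) ≤
        Real.exp (1 / 64) * 68 := by
      calc _ ≤ ∑ i ∈ Finset.range (L + 1), Real.exp (1 / 64) * (hypergeom N m k (j0 + i) *
            Real.exp (X (j0 + i) / 16)) := by
            refine Finset.sum_le_sum fun i _ => ?_
            rw [mul_left_comm, ← Real.exp_add]
            refine mul_le_mul_of_nonneg_left (Real.exp_le_exp.2 ?_) (hypergeom_nonneg _)
            have := mul_le_mul_of_nonneg_right ht2 (hX0 (j0 + i))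
            linarith [hX0 (j0 + i)]
        _ ≤ Real.exp (1 / 64) * ∑ j ∈ Finset.range (k + 1), hypergeom N m k j *
            Real.exp (X j / 16) := by
            rw [← Finset.mul_sum]
            refine mul_le_mul_of_nonneg_left ?_ (Real.exp_pos _).le
            rw [Finset.range_eq_Ico, Finset.range_eq_Ico, Finset.sum_Ico_add
              (fun j => hypergeom N m k j * Real.exp (X j / 16)) 0 (L + 1) j0]
            refine Finset.sum_le_sum_of_subset_of_nonneg (fun j hj => ?_) fun j _ _ =>
              mul_nonneg (hypergeom_nonneg j) (Real.exp_pos _).le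
            simp only [Finset.mem_Ico] at hj ⊢
            omega
        _ ≤ _ := mul_le_mul_of_nonneg_left
            (sum_hypergeom_exp_le hm hk hN le_rfl X hX1 hX2) (Real.exp_pos _).le
    have h2 : Real.exp (|t| / 2) * Real.exp (1 / 64) ≤ 2 := by
      rw [← Real.exp_add]
      calc Real.exp (|t| / 2 + 1 / 64) ≤ Real.exp (1 / 32) := Real.exp_le_exp.2 (by linarith)
        _ ≤ 2 := by
          have := Real.exp_bound_div_one_sub_of_interval (x := 1 / 32) (by norm_num) (by norm_num)
          linarith
    calc _ ≤ Real.exp (|t| / 2) * (Real.exp (1 / 64) * 68) :=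
          mul_le_mul_of_nonneg_left h1 (Real.exp_pos _).le
      _ ≤ 136 := by nlinarith
  refine ⟨fun z => j0 + J z, by fun_prop, fun j => ?_, fun t ht0 ht1 => ?_⟩
  · rcases Nat.lt_or_ge j j0 with h | h
    · have : (fun z => j0 + J z) ⁻¹' {j} = ∅ := by
        ext z
        simp only [mem_preimage, mem_singleton_iff, mem_empty_iff_false, iff_false]
        omega
      rw [this, hzero j (Or.inl h)]
      simp
    · obtain ⟨i, rfl⟩ := Nat.exists_eq_add_of_le h
      rw [← hJ i]
      congr 1
      ext z
      simp
  · have hJr : Measurable fun z => ((j0 + J z : ℕ) : ℝ) :=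
      (measurable_of_countable (fun n : ℕ => ((j0 + n : ℕ) : ℝ))).comp hJm
    calc _ ≤ ∫⁻ z, (ENNReal.ofReal (Real.exp (t * (((j0 + J z : ℕ) : ℝ) - μ -
            √(hypergeomVar N m k) * z))) + ENNReal.ofReal (Real.exp (-t * (((j0 + J z : ℕ) : ℝ)
            - μ - √(hypergeomVar N m k) * z)))) ∂stdNormal := by
          refine lintegral_mono fun z => ?_
          set x := ((j0 + J z : ℕ) : ℝ) - μ - √(hypergeomVar N m k) * z
          rcases abs_cases x with ⟨h, _⟩ | ⟨h, _⟩ <;> simp only [h]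
          · exact le_self_add
          · rw [mul_neg, ← neg_mul]
            exact le_add_self
      _ ≤ 136 + 136 := by
          rw [lintegral_add_left (by fun_prop)]
          refine add_le_add (hbound t ?_) (hbound (-t) ?_)
          · rwa [abs_of_nonneg ht0]
          · rwa [abs_neg, abs_of_nonneg ht0]
      _ = 272 := by norm_num

end Hypergeom

/-! ### The multivariate hypergeometric distribution -/

/-- The probability that `k` draws without replacement from a population with `m i` items of type
`i` produce `j i` items of type `i` for all `i`. -/
noncomputable def multiHypergeom {r : ℕ} (m : Fin r → ℕ) (k : ℕ) (j : Fin r → ℕ) : ℝ :=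
  if ∑ i, j i = k then (∏ i, ((m i).choose (j i) : ℝ)) / ((∑ i, m i).choose k : ℝ) else 0

/-- The deviation of the sum of the values `a i` of the drawn items from its mean. -/
noncomputable def drawDev {r : ℕ} (a : Fin r → ℝ) (m : Fin r → ℕ) (k : ℕ) (j : Fin r → ℕ) : ℝ :=
  ∑ i, a i * (j i - k * m i / ((∑ i, m i : ℕ) : ℝ))

/-- The variance of a population with `m i` items of value `a i`. -/
noncomputable def popVar {r : ℕ} (a : Fin r → ℝ) (m : Fin r → ℕ) : ℝ :=
  (∑ i, m i * a i ^ 2) / ((∑ i, m i : ℕ) : ℝ) - ((∑ i, m i * a i) / ((∑ i, m i : ℕ) : ℝ)) ^ 2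

section

variable {r : ℕ}

lemma multiHypergeom_nonneg (m : Fin r → ℕ) (k : ℕ) (j : Fin r → ℕ) :
    0 ≤ multiHypergeom m k j := by
  unfold multiHypergeom
  split_ifs <;> positivity

lemma multiHypergeom_cons (m : Fin (r + 1) → ℕ) {k : ℕ} (j₀ : ℕ) (j : Fin r → ℕ) :
    multiHypergeom m k (Fin.cons j₀ j) =
      hypergeom (∑ i, m i) (m 0) k j₀ * multiHypergeom (Fin.tail m) (k - j₀) j := by
  have hN : ∑ i, m i = m 0 + ∑ i, Fin.tail m i := Fin.sum_univ_succ m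
  have hs : ∑ i, (Fin.cons j₀ j : Fin (r + 1) → ℕ) i = j₀ + ∑ i, j i := by
    rw [Fin.sum_univ_succ]
    simp
  have hp : ∏ i, ((m i).choose ((Fin.cons j₀ j : Fin (r + 1) → ℕ) i) : ℝ) =
      (m 0).choose j₀ * ∏ i, ((Fin.tail m i).choose (j i) : ℝ) := by
    rw [Fin.prod_univ_succ]
    simp [Fin.tail]
  unfold multiHypergeom hypergeom
  rw [hs, hp]
  rcases le_or_gt j₀ k with h | h
  · rw [if_pos h]
    by_cases h1 : ∑ i, j i = k - j₀
    · rw [if_pos (by omega), if_pos h1]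
      have e : ∑ i, m i - m 0 = ∑ i, Fin.tail m i := by omega
      rw [e]
      rcases Nat.eq_zero_or_pos ((∑ i, Fin.tail m i).choose (k - j₀)) with h2 | h2
      · -- more draws than items: some type is overdrawn
        have h3 : ∏ i, ((Fin.tail m i).choose (j i) : ℝ) = 0 := by
          by_contra h4
          have h4 := Finset.prod_ne_zero_iff.1 h4
          have h5 : ∑ i, j i ≤ ∑ i, Fin.tail m i := Finset.sum_le_sum fun i hi => by
            by_contra! h6
            exact h4 i hi (by rw [Nat.choose_eq_zero_of_lt h6, Nat.cast_zero])
          rw [h1] at h5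
          exact (Nat.choose_pos h5).ne' h2
        rw [h3]
        simp
      · have h3 : ((∑ i, Fin.tail m i).choose (k - j₀) : ℝ) ≠ 0 := Nat.cast_ne_zero.2 h2.ne'
        field_simp
    · rw [if_neg (by omega), if_neg h1, mul_zero]
  · rw [if_neg (by omega), if_neg (by omega), zero_mul]

lemma popVar_eq (a : Fin r → ℝ) (m : Fin r → ℕ) (hN : 0 < ∑ i, m i) :
    popVar a m = (∑ i, m i * (a i - (∑ i, m i * a i) / ((∑ i, m i : ℕ) : ℝ)) ^ 2) /
      ((∑ i, m i : ℕ) : ℝ) := by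
  have hN0 : ((∑ i, m i : ℕ) : ℝ) ≠ 0 := Nat.cast_ne_zero.2 hN.ne'
  set N : ℝ := ((∑ i, m i : ℕ) : ℝ) with hNdef
  set b := (∑ i, m i * a i) / N with hb
  have h1 : ∑ i, (m i : ℝ) = N := by rw [hNdef]; push_cast; rfl
  have h2 : ∑ i, (m i : ℝ) * a i = b * N := by rw [hb]; field_simp
  have h3 : ∑ i, m i * (a i - b) ^ 2 = ∑ i, m i * a i ^ 2 - b ^ 2 * N := by
    have e : ∀ i, m i * (a i - b) ^ 2 = m i * a i ^ 2 - 2 * b * (m i * a i) + b ^ 2 * m i :=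
      fun i => by ring
    simp_rw [e]
    rw [Finset.sum_add_distrib, Finset.sum_sub_distrib, ← Finset.mul_sum, ← Finset.mul_sum, h1, h2]
    ring
  rw [h3, popVar, ← hNdef, ← hb]
  field_simp

lemma popVar_nonneg (a : Fin r → ℝ) (m : Fin r → ℕ) : 0 ≤ popVar a m := by
  rcases Nat.eq_zero_or_pos (∑ i, m i) with h | h
  · simp [popVar, h]
  · rw [popVar_eq a m h]
    positivity

lemma abs_sub_mean_le {a : Fin r → ℝ} {m : Fin r → ℕ} {M : ℝ} (hN : 0 < ∑ i, m i) {x : ℝ}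
    (ha : ∀ i, |x - a i| ≤ M) :
    |x - (∑ i, m i * a i) / ((∑ i, m i : ℕ) : ℝ)| ≤ M := by
  have hN0 : (0 : ℝ) < ((∑ i, m i : ℕ) : ℝ) := Nat.cast_pos.2 hN
  have h1 : x - (∑ i, m i * a i) / ((∑ i, m i : ℕ) : ℝ) =
      (∑ i, m i * (x - a i)) / ((∑ i, m i : ℕ) : ℝ) := by
    rw [eq_div_iff hN0.ne', sub_mul, div_mul_cancel₀ _ hN0.ne']
    push_cast
    rw [Finset.mul_sum, ← Finset.sum_sub_distrib]
    exact Finset.sum_congr rfl fun i _ => by ring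
  rw [h1, abs_div, abs_of_pos hN0, div_le_iff₀ hN0]
  push_cast
  rw [Finset.mul_sum]
  refine (Finset.abs_sum_le_sum_abs _ _).trans (Finset.sum_le_sum fun i _ => ?_)
  rw [abs_mul, abs_of_nonneg (Nat.cast_nonneg _), mul_comm]
  exact mul_le_mul_of_nonneg_right (ha i) (Nat.cast_nonneg _)

lemma popVar_le {a : Fin r → ℝ} {m : Fin r → ℕ} {M : ℝ} (ha : ∀ i i', |a i - a i'| ≤ M) :
    popVar a m ≤ M ^ 2 := by
  rcases Nat.eq_zero_or_pos (∑ i, m i) with h | h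
  · simp only [popVar, h, Nat.cast_zero, div_zero]
    nlinarith [sq_nonneg M]
  · have hN0 : (0 : ℝ) < ((∑ i, m i : ℕ) : ℝ) := Nat.cast_pos.2 h
    rw [popVar_eq a m h, div_le_iff₀ hN0]
    have h1 : ∀ i, (m i : ℝ) * (a i - (∑ i, m i * a i) / ((∑ i, m i : ℕ) : ℝ)) ^ 2 ≤
        m i * M ^ 2 := fun i => by
      refine mul_le_mul_of_nonneg_left ?_ (Nat.cast_nonneg _)
      rw [← sq_abs]
      exact pow_le_pow_left₀ (abs_nonneg _) (abs_sub_mean_le h (ha i)) 2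
    refine (Finset.sum_le_sum fun i _ => h1 i).trans (le_of_eq ?_)
    rw [← Finset.sum_mul]
    push_cast
    ring

/-- The mean value of the items of the types other than the first; if there are no such items, the
value of the first type, which makes the contribution of the first count to `drawDev` vanish. -/
noncomputable def tailMean (a : Fin (r + 1) → ℝ) (m : Fin (r + 1) → ℕ) : ℝ :=
  if ∑ i, Fin.tail m i = 0 then a 0 else
    (∑ i, (Fin.tail m i : ℝ) * Fin.tail a i) / ((∑ i, Fin.tail m i : ℕ) : ℝ)

/-- Given the count of the first type, the remaining counts are a draw from the other types; their
conditional mean contributes the value `tailMean` for each draw that is not of the first type. -/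
lemma drawDev_cons (a : Fin (r + 1) → ℝ) (m : Fin (r + 1) → ℕ) {k : ℕ} (hN : 0 < ∑ i, m i)
    {j₀ : ℕ} (h1 : j₀ ≤ k) (h2 : k - j₀ ≤ ∑ i, Fin.tail m i) (j : Fin r → ℕ) :
    drawDev a m k (Fin.cons j₀ j) = drawDev (Fin.tail a) (Fin.tail m) (k - j₀) j +
      (a 0 - tailMean a m) * (j₀ - m 0 * k / ((∑ i, m i : ℕ) : ℝ)) := by
  have hNs : ∑ i, m i = m 0 + ∑ i, Fin.tail m i := Fin.sum_univ_succ m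
  have hN0 : ((∑ i, m i : ℕ) : ℝ) ≠ 0 := Nat.cast_ne_zero.2 hN.ne'
  unfold drawDev
  rw [Fin.sum_univ_succ]
  simp only [Fin.cons_zero, Fin.cons_succ]
  set N : ℝ := ((∑ i, m i : ℕ) : ℝ) with hNdef
  unfold tailMean
  split_ifs with h
  · have h3 : ∀ i, Fin.tail m i = 0 := fun i => by
      have := Finset.single_le_sum (f := Fin.tail m) (fun _ _ => Nat.zero_le _) (Finset.mem_univ i)
      omega
    have h4 : j₀ = k := by omega
    have h5 : (m 0 : ℝ) = N := by
      rw [hNdef, hNs, h, add_zero]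
    have h6 : ∀ i : Fin r, m i.succ = 0 := h3
    have h7 : (k : ℝ) - N * k / N = 0 := by
      field_simp
      ring
    simp only [h6, h4, h5, Fin.tail]
    rw [mul_comm (k : ℝ) N, h7]
    simp
  · have hN' : ((∑ i, Fin.tail m i : ℕ) : ℝ) ≠ 0 := Nat.cast_ne_zero.2 h
    have hNr : N = m 0 + ((∑ i, Fin.tail m i : ℕ) : ℝ) := by
      rw [hNdef, hNs]
      push_cast
      rfl
    set N' : ℝ := ((∑ i, Fin.tail m i : ℕ) : ℝ) with hN'def
    have e : ∀ i : Fin r, a i.succ * ((j i : ℝ) - k * m i.succ / N) =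
        Fin.tail a i * ((j i : ℝ) - ((k - j₀ : ℕ) : ℝ) * Fin.tail m i / N') +
        (Fin.tail m i * Fin.tail a i) * (((k - j₀ : ℕ) : ℝ) / N' - k / N) := fun i => by
      simp only [Fin.tail]
      ring
    simp_rw [e]
    rw [Finset.sum_add_distrib, ← Finset.sum_mul]
    have h3 : ((k - j₀ : ℕ) : ℝ) / N' - k / N = -((j₀ : ℝ) - m 0 * k / N) / N' := by
      rw [Nat.cast_sub h1]
      field_simp
      rw [hNr]
      ring
    rw [h3]
    ring

/-- Decomposition of the variance of a draw in the variance explained by the count of the first type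
and the variance of the draw from the other types. -/
lemma popVar_cons (a : Fin (r + 1) → ℝ) (m : Fin (r + 1) → ℕ) (k : ℕ) (hN : 0 < ∑ i, m i) :
    k * (((∑ i, m i : ℕ) : ℝ) - k) / ((∑ i, m i : ℕ) : ℝ) * popVar a m =
      hypergeomVar (∑ i, m i) (m 0) k * (a 0 - tailMean a m) ^ 2 +
      k * (((∑ i, m i : ℕ) : ℝ) - k) * ((∑ i, Fin.tail m i : ℕ) : ℝ) /
        ((∑ i, m i : ℕ) : ℝ) ^ 2 * popVar (Fin.tail a) (Fin.tail m) := by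
  have hNs : ∑ i, m i = m 0 + ∑ i, Fin.tail m i := Fin.sum_univ_succ m
  have hN0 : ((∑ i, m i : ℕ) : ℝ) ≠ 0 := Nat.cast_ne_zero.2 hN.ne'
  have hNr : ((∑ i, m i : ℕ) : ℝ) = m 0 + ((∑ i, Fin.tail m i : ℕ) : ℝ) := by
    rw [hNs]
    push_cast
    rfl
  unfold popVar hypergeomVar tailMean
  rw [Fin.sum_univ_succ (fun i => (m i : ℝ) * a i ^ 2), Fin.sum_univ_succ (fun i => (m i : ℝ) * a i)]
  set N : ℝ := ((∑ i, m i : ℕ) : ℝ) with hNdef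
  have e1 : ∑ i : Fin r, (m i.succ : ℝ) * a i.succ ^ 2 =
      ∑ i, (Fin.tail m i : ℝ) * Fin.tail a i ^ 2 := rfl
  have e2 : ∑ i : Fin r, (m i.succ : ℝ) * a i.succ =
      ∑ i, (Fin.tail m i : ℝ) * Fin.tail a i := rfl
  rw [e1, e2]
  split_ifs with h
  · have h3 : ∀ i, Fin.tail m i = 0 := fun i => by
      have := Finset.single_le_sum (f := Fin.tail m) (fun _ _ => Nat.zero_le _) (Finset.mem_univ i)
      omega
    rw [h] at hNr
    simp only [Nat.cast_zero, add_zero] at hNr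
    simp only [h3, ← hNr, Nat.cast_zero]
    simp
    right
    field_simp
    ring
  · have hN' : ((∑ i, Fin.tail m i : ℕ) : ℝ) ≠ 0 := Nat.cast_ne_zero.2 h
    set N' : ℝ := ((∑ i, Fin.tail m i : ℕ) : ℝ) with hN'def
    set S := ∑ i, (Fin.tail m i : ℝ) * Fin.tail a i
    set Q := ∑ i, (Fin.tail m i : ℝ) * Fin.tail a i ^ 2
    have hm0 : (m 0 : ℝ) = N - N' := by linarith
    rw [hm0]
    field_simp
    ring

/-! ### Coupling of a multivariate hypergeometric vector with one Gaussian variable -/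

lemma tsum_cons (f : (Fin (r + 1) → ℕ) → ℝ≥0∞) :
    ∑' j, f j = ∑' j₀, ∑' j, f (Fin.cons j₀ j) := by
  rw [← (Fin.consEquiv fun _ : Fin (r + 1) => ℕ).tsum_eq f, ← ENNReal.tsum_prod]
  rfl

lemma Measure.sum_cons {X : Type*} [MeasurableSpace X] (μ : (Fin (r + 1) → ℕ) → Measure X) :
    Measure.sum μ = Measure.sum fun j₀ => Measure.sum fun j => μ (Fin.cons j₀ j) := by
  ext s hs
  rw [Measure.sum_apply _ hs, Measure.sum_apply _ hs, tsum_cons]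
  exact tsum_congr fun j₀ => (Measure.sum_apply _ hs).symm

lemma Measure.sum_ite_eq {X ι : Type*} [MeasurableSpace X] [DecidableEq ι] (i : ι)
    (μ : Measure X) : Measure.sum (fun j => if j = i then μ else 0) = μ := by
  ext s hs
  rw [Measure.sum_apply _ hs, tsum_eq_single i fun j hj => by simp [hj]]
  simp

lemma isFiniteMeasure_of_sum_eq {X ι : Type*} [MeasurableSpace X] {ν : ι → Measure X}
    {μ : Measure X} [IsFiniteMeasure μ] (h : Measure.sum ν = μ) (i : ι) :
    IsFiniteMeasure (ν i) :=
  isFiniteMeasure_of_le μ (h ▸ Measure.le_sum ν i)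

lemma sum_restrict_preimage_singleton {X : Type*} [MeasurableSpace X] (μ : Measure X) {J : X → ℕ}
    (hJ : Measurable J) : Measure.sum (fun j => μ.restrict (J ⁻¹' {j})) = μ := by
  rw [← Measure.restrict_iUnion (fun i j hij => ?_) fun j => hJ (measurableSet_singleton j)]
  · rw [← preimage_iUnion, iUnion_of_singleton, preimage_univ, Measure.restrict_univ]
  · exact Disjoint.preimage _ (disjoint_singleton.2 hij)

lemma stdNormal_prod_map {c s : ℝ} (h : c ^ 2 + s ^ 2 = 1) :
    (stdNormal.prod stdNormal).map (fun p : ℝ × ℝ => c * p.1 + s * p.2) = stdNormal := by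
  have h1 : (stdNormal.prod stdNormal).map (fun p : ℝ × ℝ => c * p.1 + s * p.2) =
      (stdNormal.map (fun x => c * x)) ∗ (stdNormal.map fun x => s * x) := by
    rw [Measure.conv, Measure.map_prod_map _ _ (by fun_prop) (by fun_prop),
      Measure.map_map (by fun_prop) (by fun_prop)]
    rfl
  rw [h1, gaussianReal_map_const_mul, gaussianReal_map_const_mul, gaussianReal_conv_gaussianReal]
  congr 1
  · simp
  · ext
    simpa using h

/-- The coefficients `c`, `s` for which `α g + β z` is `√(α ^ 2 + β ^ 2)` times a standard normal
variable, when `g` and `z` are independent and standard normal. -/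
lemma exists_rotation (α β : ℝ) :
    ∃ c s : ℝ, c ^ 2 + s ^ 2 = 1 ∧ √(α ^ 2 + β ^ 2) * c = α ∧ √(α ^ 2 + β ^ 2) * s = β := by
  rcases eq_or_ne (α ^ 2 + β ^ 2) 0 with h | h
  · have h1 : α = 0 := by nlinarith [sq_nonneg α, sq_nonneg β]
    have h2 : β = 0 := by nlinarith [sq_nonneg α, sq_nonneg β]
    exact ⟨1, 0, by norm_num, by simp [h1, h2], by simp [h1, h2]⟩
  · have h1 : √(α ^ 2 + β ^ 2) ≠ 0 := Real.sqrt_ne_zero'.2 (lt_of_le_of_ne (by positivity) h.symm)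
    refine ⟨α / √(α ^ 2 + β ^ 2), β / √(α ^ 2 + β ^ 2), ?_, by field_simp, by field_simp⟩
    rw [div_pow, div_pow, Real.sq_sqrt (by positivity), ← add_div, div_self h]

lemma exp_add_add_le (x y z : ℝ) :
    Real.exp (x + y + z) ≤ Real.exp (3 * x) + Real.exp (3 * y) + Real.exp (3 * z) := by
  have h : ∀ w, x + y + z ≤ 3 * w → Real.exp (x + y + z) ≤ Real.exp (3 * w) :=
    fun w hw => Real.exp_le_exp.2 hw
  have hx := Real.exp_pos (3 * x)
  have hy := Real.exp_pos (3 * y)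
  have hz := Real.exp_pos (3 * z)
  rcases le_total x y with h1 | h1
  · rcases le_total y z with h2 | h2
    · linarith [h z (by linarith)]
    · linarith [h y (by linarith)]
  · rcases le_total x z with h2 | h2
    · linarith [h z (by linarith)]
    · linarith [h x (by linarith)]

lemma lintegral_exp_mul_stdNormal (c : ℝ) :
    ∫⁻ z, ENNReal.ofReal (Real.exp (c * z)) ∂stdNormal = ENNReal.ofReal (Real.exp (c ^ 2 / 2)) := by
  rw [← ofReal_integral_eq_lintegral_ofReal (integrable_exp_mul_gaussianReal c)
    (ae_of_all _ fun z => (Real.exp_pos _).le)]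
  have h := congrFun (mgf_fun_id_gaussianReal (μ := 0) (v := 1)) c
  simp only [mgf] at h
  rw [h]
  simp

lemma lintegral_exp_mul_abs_stdNormal_le (c : ℝ) :
    ∫⁻ z, ENNReal.ofReal (Real.exp (c * |z|)) ∂stdNormal ≤
      ENNReal.ofReal (2 * Real.exp (c ^ 2 / 2)) := by
  calc _ ≤ ∫⁻ z, (ENNReal.ofReal (Real.exp (c * z)) + ENNReal.ofReal (Real.exp (-c * z)))
        ∂stdNormal := by
        refine lintegral_mono fun z => ?_
        rcases abs_cases z with ⟨h, _⟩ | ⟨h, _⟩ <;> simp only [h]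
        · exact le_self_add
        · rw [mul_neg, ← neg_mul]
          exact le_add_self
    _ = _ := by
        rw [lintegral_add_left (by fun_prop), lintegral_exp_mul_stdNormal,
          lintegral_exp_mul_stdNormal, neg_sq, ← ENNReal.ofReal_add (Real.exp_pos _).le
          (Real.exp_pos _).le, two_mul]

/-- The conditional variance of the remaining draws, given `j₀` draws of the first type, is close
to its typical value. -/
lemma sq_sqrt_tail_sub_le {N m k N' j₀ : ℕ} (hN : 0 < N) (hNN : N = m + N') (hk : k ≤ N)
    (h1 : j₀ ≤ k) (h2 : k - j₀ ≤ N') :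
    (√(((k - j₀ : ℕ) : ℝ) * (N' - (k - j₀ : ℕ)) / N') - √((k : ℝ) * (N - k) * N' / N ^ 2)) ^ 2 ≤
        |(j₀ : ℝ) - m * k / N| ∧
      hypergeomVar N m k *
        (√(((k - j₀ : ℕ) : ℝ) * (N' - (k - j₀ : ℕ)) / N') - √((k : ℝ) * (N - k) * N' / N ^ 2)) ^ 2 ≤
        ((j₀ : ℝ) - m * k / N) ^ 2 := by
  have hN0 : (0 : ℝ) < N := Nat.cast_pos.2 hN
  have hNr : (N : ℝ) = m + N' := by rw [hNN]; push_cast; rfl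
  have hkr : (0 : ℝ) ≤ N - k := sub_nonneg.2 (Nat.cast_le.2 hk)
  have hA1 : (0 : ℝ) ≤ N' - (k - j₀ : ℕ) := sub_nonneg.2 (Nat.cast_le.2 h2)
  set A : ℝ := ((k - j₀ : ℕ) : ℝ) * (N' - (k - j₀ : ℕ)) / N' with hA
  set B : ℝ := (k : ℝ) * (N - k) * N' / N ^ 2 with hB
  have hA0 : 0 ≤ A := by positivity
  have hB0 : 0 ≤ B := by positivity
  have hd : |A - B| ≤ |(j₀ : ℝ) - m * k / N| := by
    rcases Nat.eq_zero_or_pos N' with h | h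
    · simp [hA, hB, h]
    · have hN'0 : (0 : ℝ) < N' := Nat.cast_pos.2 h
      have hx1 : (0 : ℝ) ≤ (k - j₀ : ℕ) := Nat.cast_nonneg _
      set x : ℝ := ((k - j₀ : ℕ) : ℝ) with hx
      have hxe : x = k - j₀ := by rw [hx, Nat.cast_sub h1]
      set y : ℝ := k * N' / N with hy
      have hy0 : 0 ≤ y := by positivity
      have hy1 : y ≤ N' := by
        rw [hy, div_le_iff₀ hN0, mul_comm]
        exact mul_le_mul_of_nonneg_left (by linarith) hN'0.le
      have e1 : A - B = (x - y) * (1 - (x + y) / N') := by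
        rw [hA, hB, hy]
        field_simp
        ring
      have e2 : (j₀ : ℝ) - m * k / N = -(x - y) := by
        rw [hxe, hy, show (m : ℝ) = N - N' by linarith]
        field_simp
        ring
      rw [e1, e2, abs_neg, abs_mul]
      refine mul_le_of_le_one_right (abs_nonneg _) (abs_le.2 ⟨?_, ?_⟩)
      · have : (x + y) / N' ≤ 2 := by
          rw [div_le_iff₀ hN'0]
          linarith
        linarith
      · have : 0 ≤ (x + y) / N' := by positivity
        linarith
  have h := sq_sqrt_sub_sqrt_le hA0 hB0
  refine ⟨h.1.trans hd, ?_⟩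
  have hv : hypergeomVar N m k ≤ B := by
    have : hypergeomVar N m k = m / N * B := by
      rw [hypergeomVar, hB, hNr]
      rw [hNr] at hN0
      field_simp
      ring
    rw [this]
    refine mul_le_of_le_one_left hB0 ((div_le_one hN0).2 ?_)
    rw [hNr]
    have : (0 : ℝ) ≤ N' := Nat.cast_nonneg _
    linarith
  calc _ ≤ B * (√A - √B) ^ 2 := mul_le_mul_of_nonneg_right hv (sq_nonneg _)
    _ ≤ _ := h.2.trans (by
      rw [← sq_abs, ← sq_abs (_ - _)]
      exact pow_le_pow_left₀ (abs_nonneg _) hd 2)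

/-- The three errors of the coupling that draws the first count and then the others: the errors of
the two couplings, and the dependence of the conditional variance on the first count. -/
lemma drawDev_cons_sub_eq (a : Fin (r + 1) → ℝ) (m : Fin (r + 1) → ℕ) {k : ℕ} (hN : 0 < ∑ i, m i)
    {j₀ : ℕ} (h1 : j₀ ≤ k) (h2 : k - j₀ ≤ ∑ i, Fin.tail m i) {τ c s : ℝ}
    (hc : τ * c = (a 0 - tailMean a m) * √(hypergeomVar (∑ i, m i) (m 0) k))
    (hs : τ * s = √((k : ℝ) * ((∑ i, m i : ℕ) - k) * (∑ i, Fin.tail m i : ℕ) /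
      (∑ i, m i : ℕ) ^ 2) * √(popVar (Fin.tail a) (Fin.tail m)))
    (j : Fin r → ℕ) (g z : ℝ) :
    drawDev a m k (Fin.cons j₀ j) - τ * (c * g + s * z) =
      (drawDev (Fin.tail a) (Fin.tail m) (k - j₀) j -
        √(((k - j₀ : ℕ) : ℝ) * ((∑ i, Fin.tail m i : ℕ) - (k - j₀ : ℕ)) /
          (∑ i, Fin.tail m i : ℕ)) * √(popVar (Fin.tail a) (Fin.tail m)) * z) +
      (a 0 - tailMean a m) * (j₀ - m 0 * k / ((∑ i, m i : ℕ) : ℝ) -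
        √(hypergeomVar (∑ i, m i) (m 0) k) * g) +
      √(popVar (Fin.tail a) (Fin.tail m)) *
        (√(((k - j₀ : ℕ) : ℝ) * ((∑ i, Fin.tail m i : ℕ) - (k - j₀ : ℕ)) /
          (∑ i, Fin.tail m i : ℕ)) - √((k : ℝ) * ((∑ i, m i : ℕ) - k) *
          (∑ i, Fin.tail m i : ℕ) / (∑ i, m i : ℕ) ^ 2)) * z := by
  rw [drawDev_cons a m hN h1 h2]
  linear_combination (-g) * hc + (-z) * hs

lemma abs_sub_tailMean_le {a : Fin (r + 1) → ℝ} {M : ℝ} (hM : 0 ≤ M)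
    (ha : ∀ i i', |a i - a i'| ≤ M) (m : Fin (r + 1) → ℕ) : |a 0 - tailMean a m| ≤ M := by
  unfold tailMean
  split_ifs with h
  · simpa using hM
  · exact abs_sub_mean_le (Nat.pos_of_ne_zero h) fun i => ha 0 i.succ

lemma tsum_eq_sum_range_hypergeom {N m k : ℕ} (f : ℕ → ℝ≥0∞) :
    ∑' j, ENNReal.ofReal (hypergeom N m k j) * f j =
      ∑ j ∈ Finset.range (k + 1), ENNReal.ofReal (hypergeom N m k j) * f j :=
  tsum_eq_sum fun j hj => by
    rw [hypergeom_of_gt (by simpa using hj)]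
    simp

lemma tsum_hypergeom {N m k : ℕ} (hm : m ≤ N) (hk : k ≤ N) :
    ∑' j, ENNReal.ofReal (hypergeom N m k j) = 1 := by
  have h := tsum_eq_sum_range_hypergeom (N := N) (m := m) (k := k) fun _ => 1
  simp only [mul_one] at h
  rw [h, ← ENNReal.ofReal_sum_of_nonneg fun j _ => hypergeom_nonneg j, sum_hypergeom hm hk,
    ENNReal.ofReal_one]

lemma tsum_hypergeom_exp_le {N m k : ℕ} (hm : m ≤ N) (hk : k ≤ N) (hN : 0 < N) {v : ℝ}
    (hv : hypergeomVar N m k ≤ v) (X : ℕ → ℝ)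
    (hX1 : ∀ j, X j ≤ |(j : ℝ) - (m : ℝ) * k / N|)
    (hX2 : ∀ j, v * X j ≤ ((j : ℝ) - (m : ℝ) * k / N) ^ 2) :
    ∑' j, ENNReal.ofReal (hypergeom N m k j) * ENNReal.ofReal (Real.exp (X j / 16)) ≤ 68 := by
  rw [tsum_eq_sum_range_hypergeom]
  simp_rw [← ENNReal.ofReal_mul (hypergeom_nonneg _)]
  rw [← ENNReal.ofReal_sum_of_nonneg fun j _ =>
    mul_nonneg (hypergeom_nonneg j) (Real.exp_pos _).le]
  have h68 : (68 : ℝ≥0∞) = ENNReal.ofReal 68 := by norm_num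
  rw [h68]
  exact ENNReal.ofReal_le_ofReal (sum_hypergeom_exp_le hm hk hN hv X hX1 hX2)

/-- The counts `j` obtained in `k` draws without replacement from a population with `m i` items of
type `i` can be coupled with one standard Gaussian variable `g` in such a way that the sum of the
drawn values, centred, differs from `√(k (N - k) / N · popVar a m) g` by a variable with a bounded
exponential moment. The coupling is encoded as a decomposition `∑ j, ν j` of the standard Gaussian
law, where `ν j` is the law of `g` on the event that the counts are `j`. -/
theorem exists_multiHypergeom_coupling (r : ℕ) (M : ℝ) (hM : 0 ≤ M) :
    ∃ θ : ℝ, 0 < θ ∧ ∃ K : ℝ≥0∞, K ≠ ⊤ ∧ ∀ a : Fin r → ℝ, (∀ i i', |a i - a i'| ≤ M) →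
      ∀ (m : Fin r → ℕ) (k : ℕ), k ≤ ∑ i, m i →
      ∃ ν : (Fin r → ℕ) → Measure ℝ, Measure.sum ν = stdNormal ∧
        (∀ j, ν j univ = ENNReal.ofReal (multiHypergeom m k j)) ∧
        ∀ t : ℝ, 0 ≤ t → t ≤ θ →
          ∑' j, ∫⁻ z, ENNReal.ofReal (Real.exp (t * |drawDev a m k j -
            √(k * ((∑ i, m i : ℕ) - k) / (∑ i, m i : ℕ)) * √(popVar a m) * z|)) ∂(ν j) ≤ K := by
  induction r with
  | zero =>
    refine ⟨1, one_pos, 1, ENNReal.one_ne_top, fun a _ m k hk => ⟨fun _ => stdNormal, ?_, ?_, ?_⟩⟩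
    · ext s hs
      rw [Measure.sum_apply _ hs, tsum_fintype]
      simp
    · intro j
      have hk0 : k = 0 := by simpa using hk
      simp [multiHypergeom, hk0]
    · intro t _ _
      rw [tsum_fintype]
      simp [drawDev, popVar]
  | succ r ih =>
    obtain ⟨θ', hθ', K', hK', ih⟩ := ih
    refine ⟨min (θ' / 3) (1 / (96 * (M + 1))), by positivity, 1 + (K' + 272 + 136),
      by simp [hK'], fun a ha m k hk => ?_⟩
    have hNs : ∑ i, m i = m 0 + ∑ i, Fin.tail m i := Fin.sum_univ_succ m
    rcases Nat.eq_zero_or_pos (∑ i, m i) with hN | hN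
    · -- an empty population
      have hk0 : k = 0 := by omega
      have hm0 : ∀ i, m i = 0 := fun i => by
        have := Finset.single_le_sum (f := m) (fun _ _ => Nat.zero_le _) (Finset.mem_univ i)
        omega
      refine ⟨fun j => if j = 0 then stdNormal else 0, Measure.sum_ite_eq 0 _, fun j => ?_,
        fun t _ _ => ?_⟩
      · rcases eq_or_ne j 0 with rfl | hj
        · simp [multiHypergeom, hk0]
        · obtain ⟨i, hi⟩ : ∃ i, j i ≠ 0 := by
            by_contra! h
            exact hj (funext h)
          simp only [if_neg hj]
          rw [multiHypergeom, if_neg]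
          · simp
          · have := Finset.single_le_sum (f := j) (fun _ _ => Nat.zero_le _) (Finset.mem_univ i)
            omega
      · rw [tsum_eq_single 0 fun j hj => by simp [hj]]
        simp [drawDev, hN]
    have hm : m 0 ≤ ∑ i, m i := by omega
    obtain ⟨J, hJm, hJ, hJt⟩ := exists_hypergeom_coupling hm hk hN
    have ha' : ∀ i i', |Fin.tail a i - Fin.tail a i'| ≤ M := fun i i' => ha _ _
    -- for an impossible first count `j₀`, which has probability zero, `ν` is a default value
    have hfam : ∀ j₀ : ℕ, ∃ ν : (Fin r → ℕ) → Measure ℝ, Measure.sum ν = stdNormal ∧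
        (j₀ ≤ k → k - j₀ ≤ ∑ i, Fin.tail m i →
          (∀ j, ν j univ = ENNReal.ofReal (multiHypergeom (Fin.tail m) (k - j₀) j)) ∧
          ∀ t : ℝ, 0 ≤ t → t ≤ θ' →
            ∑' j, ∫⁻ z, ENNReal.ofReal (Real.exp (t * |drawDev (Fin.tail a) (Fin.tail m) (k - j₀) j
              - √(((k - j₀ : ℕ) : ℝ) * ((∑ i, Fin.tail m i : ℕ) - (k - j₀ : ℕ)) /
                (∑ i, Fin.tail m i : ℕ)) * √(popVar (Fin.tail a) (Fin.tail m)) * z|)) ∂(ν j) ≤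
              K') := by
      intro j₀
      by_cases h : k - j₀ ≤ ∑ i, Fin.tail m i
      · obtain ⟨ν, h1, h2, h3⟩ := ih (Fin.tail a) ha' (Fin.tail m) (k - j₀) h
        exact ⟨ν, h1, fun _ _ => ⟨h2, h3⟩⟩
      · exact ⟨fun j => if j = 0 then stdNormal else 0, Measure.sum_ite_eq 0 _,
          fun _ h' => absurd h' h⟩
    choose ν' hν's hν' using hfam
    have hfin : ∀ j₀ j, IsFiniteMeasure (ν' j₀ j) := fun j₀ j =>
      isFiniteMeasure_of_sum_eq (hν's j₀) j
    have hinv : ∀ j₀, ¬ (j₀ ≤ k ∧ k - j₀ ≤ ∑ i, Fin.tail m i) →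
        stdNormal (J ⁻¹' {j₀}) = 0 := fun j₀ h => by
      rw [hJ]
      rcases le_or_gt j₀ k with h1 | h1
      · rw [hypergeom_eq_zero (Or.inr (by omega)), ENNReal.ofReal_zero]
      · rw [hypergeom_of_gt h1, ENNReal.ofReal_zero]
    set N := ∑ i, m i with hNdef
    set N' := ∑ i, Fin.tail m i with hN'def
    set α := (a 0 - tailMean a m) * √(hypergeomVar N (m 0) k) with hα
    set β := √((k : ℝ) * (N - k) * N' / N ^ 2) * √(popVar (Fin.tail a) (Fin.tail m)) with hβ
    obtain ⟨c, s, hcs, hc, hs⟩ := exists_rotation α β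
    have hkr : (0 : ℝ) ≤ N - k := sub_nonneg.2 (Nat.cast_le.2 hk)
    have hτ : √(k * (N - k) / N) * √(popVar a m) = √(α ^ 2 + β ^ 2) := by
      rw [← Real.sqrt_mul (by positivity), popVar_cons a m k hN, hα, hβ, mul_pow, mul_pow,
        Real.sq_sqrt (hypergeomVar_nonneg hm hk), Real.sq_sqrt (by positivity),
        Real.sq_sqrt (popVar_nonneg _ _)]
      congr 1
      ring
    -- The first count is driven by `g`, through the quantile map `J`, and the remaining counts by an
    -- independent `z`. The counts are coupled with the standard normal variable `c g + s z`.
    refine ⟨fun j => ((stdNormal.restrict (J ⁻¹' {j 0})).prod (ν' (j 0) (Fin.tail j))).map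
      (fun p : ℝ × ℝ => c * p.1 + s * p.2), ?_, ?_, ?_⟩
    · rw [Measure.sum_cons]
      simp only [Fin.cons_zero, Fin.tail_cons]
      have h1 : ∀ j₀, Measure.sum (fun j => ((stdNormal.restrict (J ⁻¹' {j₀})).prod
          (ν' j₀ j)).map (fun p : ℝ × ℝ => c * p.1 + s * p.2)) =
          ((stdNormal.restrict (J ⁻¹' {j₀})).prod stdNormal).map
            (fun p : ℝ × ℝ => c * p.1 + s * p.2) := fun j₀ => by
        rw [← Measure.map_sum (by fun_prop), ← Measure.prod_sum_right, hν's]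
      simp_rw [h1]
      rw [← Measure.map_sum (by fun_prop), ← Measure.prod_sum_left,
        sum_restrict_preimage_singleton _ hJm, stdNormal_prod_map hcs]
    · intro j
      rw [← Fin.cons_self_tail j]
      simp only [Fin.cons_zero, Fin.tail_cons]
      rw [Measure.map_apply (by fun_prop) MeasurableSet.univ, preimage_univ, ← univ_prod_univ,
        Measure.prod_prod, Measure.restrict_apply_univ, hJ, multiHypergeom_cons,
        ENNReal.ofReal_mul (hypergeom_nonneg _)]
      by_cases h : j 0 ≤ k ∧ k - j 0 ≤ N'
      · rw [(hν' _ h.1 h.2).1]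
      · rw [← hJ, hinv _ h, zero_mul, zero_mul]
    · intro t ht0 ht
      have ht1 : 3 * t ≤ θ' := by linarith [ht.trans (min_le_left _ _)]
      have ht2 : 3 * t * M ≤ 1 / 32 := by
        have h1 := ht.trans (min_le_right _ _)
        rw [le_div_iff₀ (by positivity)] at h1
        nlinarith
      rw [hτ]
      set τ := √(α ^ 2 + β ^ 2) with hτdef
      -- conditional exponential moments given the first count
      set E₂ : ℝ → ℝ≥0∞ := fun g => ENNReal.ofReal (Real.exp ((3 * t * M) *
        |(J g : ℝ) - m 0 * k / N - √(hypergeomVar N (m 0) k) * g|)) with hE₂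
      set ρ : ℕ → ℝ := fun j₀ => if j₀ ≤ k ∧ k - j₀ ≤ N' then
        √(((k - j₀ : ℕ) : ℝ) * (N' - (k - j₀ : ℕ)) / N') - √((k : ℝ) * (N - k) * N' / N ^ 2)
        else 0 with hρ
      have hJr : Measurable fun g => ((J g : ℕ) : ℝ) :=
        (measurable_of_countable (fun n : ℕ => (n : ℝ))).comp hJm
      have hE₂m : Measurable E₂ := by
        simp only [hE₂]
        fun_prop
      have hσ : √(popVar (Fin.tail a) (Fin.tail m)) ≤ M :=
        Real.sqrt_le_iff.2 ⟨hM, popVar_le ha'⟩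
      have hstep : ∀ j₀, ∑' j, ∫⁻ y, ENNReal.ofReal (Real.exp (t * |drawDev a m k (Fin.cons j₀ j) -
          τ * y|)) ∂(((stdNormal.restrict (J ⁻¹' {j₀})).prod (ν' j₀ j)).map
            (fun p : ℝ × ℝ => c * p.1 + s * p.2)) ≤
          stdNormal (J ⁻¹' {j₀}) * K' + ∫⁻ g in J ⁻¹' {j₀}, E₂ g ∂stdNormal +
            stdNormal (J ⁻¹' {j₀}) * (2 * ENNReal.ofReal (Real.exp (ρ j₀ ^ 2 / 16))) := by
        intro j₀
        by_cases h : j₀ ≤ k ∧ k - j₀ ≤ N'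
        swap
        · have h0 : stdNormal.restrict (J ⁻¹' {j₀}) = 0 :=
            Measure.restrict_eq_zero.2 (hinv j₀ h)
          simp only [h0, Measure.zero_prod, Measure.map_zero, lintegral_zero_measure, tsum_zero]
          exact zero_le
        have hρj : ρ j₀ = √(((k - j₀ : ℕ) : ℝ) * (N' - (k - j₀ : ℕ)) / N') -
            √((k : ℝ) * (N - k) * N' / N ^ 2) := if_pos h
        set F : (Fin r → ℕ) → ℝ → ℝ≥0∞ := fun j z => ENNReal.ofReal (Real.exp ((3 * t) *
          |drawDev (Fin.tail a) (Fin.tail m) (k - j₀) j -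
            √(((k - j₀ : ℕ) : ℝ) * (N' - (k - j₀ : ℕ)) / N') *
              √(popVar (Fin.tail a) (Fin.tail m)) * z|)) with hF
        have hpt : ∀ j, ∀ g ∈ J ⁻¹' {j₀}, ∀ z, ENNReal.ofReal (Real.exp (t *
            |drawDev a m k (Fin.cons j₀ j) - τ * (c * g + s * z)|)) ≤
            F j z + E₂ g + ENNReal.ofReal (Real.exp ((3 * t * M * |ρ j₀|) * |z|)) := by
          intro j g hg z
          rw [hF, hE₂, ← ENNReal.ofReal_add (Real.exp_pos _).le (Real.exp_pos _).le,
            ← ENNReal.ofReal_add (by positivity) (Real.exp_pos _).le]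
          refine ENNReal.ofReal_le_ofReal ?_
          have hJg : J g = j₀ := hg
          rw [drawDev_cons_sub_eq a m hN h.1 h.2 hc hs j g z, ← hρj]
          simp only [hJg]
          have habs := (abs_add_three (drawDev (Fin.tail a) (Fin.tail m) (k - j₀) j -
            √(((k - j₀ : ℕ) : ℝ) * (N' - (k - j₀ : ℕ)) / N') *
              √(popVar (Fin.tail a) (Fin.tail m)) * z)
            ((a 0 - tailMean a m) * (j₀ - m 0 * k / (N : ℝ) - √(hypergeomVar N (m 0) k) * g))
            (√(popVar (Fin.tail a) (Fin.tail m)) * ρ j₀ * z))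
          rw [abs_mul (a 0 - tailMean a m), abs_mul _ z, abs_mul _ (ρ j₀),
            abs_of_nonneg (Real.sqrt_nonneg (popVar (Fin.tail a) (Fin.tail m)))] at habs
          refine (Real.exp_le_exp.2 (mul_le_mul_of_nonneg_left habs ht0)).trans ?_
          rw [mul_add, mul_add]
          refine (exp_add_add_le _ _ _).trans ?_
          refine add_le_add (add_le_add (le_of_eq (by ring_nf)) (Real.exp_le_exp.2 ?_))
            (Real.exp_le_exp.2 ?_)
          · have := mul_le_mul_of_nonneg_right (abs_sub_tailMean_le hM ha m)
              (abs_nonneg (j₀ - m 0 * k / (N : ℝ) - √(hypergeomVar N (m 0) k) * g))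
            nlinarith
          · have := mul_le_mul_of_nonneg_right hσ
              (mul_nonneg (abs_nonneg (ρ j₀)) (abs_nonneg z))
            nlinarith
        have hFm : ∀ j, Measurable (F j) := fun j => by
          simp only [hF]
          fun_prop
        have hin : ∀ j, ∫⁻ y, ENNReal.ofReal (Real.exp (t * |drawDev a m k (Fin.cons j₀ j) -
            τ * y|)) ∂(((stdNormal.restrict (J ⁻¹' {j₀})).prod (ν' j₀ j)).map
              (fun p : ℝ × ℝ => c * p.1 + s * p.2)) ≤
            ∫⁻ g in J ⁻¹' {j₀}, ((∫⁻ z, F j z ∂(ν' j₀ j)) + ∫⁻ _, E₂ g ∂(ν' j₀ j) +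
              ∫⁻ z, ENNReal.ofReal (Real.exp ((3 * t * M * |ρ j₀|) * |z|)) ∂(ν' j₀ j))
              ∂stdNormal := by
          intro j
          rw [lintegral_map (by fun_prop) (by fun_prop), lintegral_prod _ (by fun_prop)]
          refine setLIntegral_mono' (hJm (measurableSet_singleton j₀)) fun g hg => ?_
          rw [← lintegral_add_left (hFm j), ← lintegral_add_left (by fun_prop)]
          exact lintegral_mono fun z => hpt j g hg z
        refine (ENNReal.tsum_le_tsum hin).trans ?_
        rw [← lintegral_tsum fun j => by fun_prop]
        have hsum : ∀ g, ∑' j, ((∫⁻ z, F j z ∂(ν' j₀ j)) + ∫⁻ _, E₂ g ∂(ν' j₀ j) +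
            ∫⁻ z, ENNReal.ofReal (Real.exp ((3 * t * M * |ρ j₀|) * |z|)) ∂(ν' j₀ j)) ≤
            K' + E₂ g + 2 * ENNReal.ofReal (Real.exp (ρ j₀ ^ 2 / 16)) := by
          intro g
          rw [ENNReal.tsum_add, ENNReal.tsum_add, ← lintegral_sum_measure, ← lintegral_sum_measure,
            hν's]
          refine add_le_add (add_le_add ((hν' j₀ h.1 h.2).2 (3 * t) (by positivity) ht1)
            (by simp)) ?_
          refine (lintegral_exp_mul_abs_stdNormal_le _).trans ?_
          rw [ENNReal.ofReal_mul (by norm_num), ENNReal.ofReal_ofNat]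
          refine mul_le_mul_right (ENNReal.ofReal_le_ofReal (Real.exp_le_exp.2 ?_)) 2
          rw [mul_pow, sq_abs]
          have h0 : 0 ≤ 3 * t * M := by positivity
          have : (3 * t * M) ^ 2 ≤ 1 / 8 := by nlinarith
          nlinarith [sq_nonneg (ρ j₀)]
        refine (lintegral_mono hsum).trans ?_
        rw [lintegral_add_right _ measurable_const, lintegral_add_right _ hE₂m]
        simp only [lintegral_const, Measure.restrict_apply_univ]
        rw [mul_comm K', mul_comm (2 * _)]
      rw [tsum_cons]
      simp only [Fin.cons_zero, Fin.tail_cons]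
      refine (ENNReal.tsum_le_tsum hstep).trans (le_trans ?_ le_add_self)
      rw [ENNReal.tsum_add, ENNReal.tsum_add, ENNReal.tsum_mul_right, ← lintegral_sum_measure,
        sum_restrict_preimage_singleton _ hJm]
      simp_rw [hJ]
      rw [tsum_hypergeom hm hk, one_mul]
      refine add_le_add (add_le_add le_rfl (hJt _ (by positivity) ht2)) ?_
      simp_rw [mul_left_comm _ (2 : ℝ≥0∞)]
      rw [ENNReal.tsum_mul_left]
      have hρ2 : ∀ j₀, ρ j₀ ^ 2 ≤ |(j₀ : ℝ) - m 0 * k / N| ∧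
          hypergeomVar N (m 0) k * ρ j₀ ^ 2 ≤ ((j₀ : ℝ) - m 0 * k / N) ^ 2 := fun j₀ => by
        by_cases h : j₀ ≤ k ∧ k - j₀ ≤ N'
        · rw [hρ]
          simp only [if_pos h]
          exact sq_sqrt_tail_sub_le hN hNs hk h.1 h.2
        · rw [hρ]
          simp only [if_neg h]
          constructor <;> simp [sq_nonneg]
      refine (mul_le_mul_right (tsum_hypergeom_exp_le hm hk hN le_rfl (fun j₀ => ρ j₀ ^ 2)
        (fun j₀ => (hρ2 j₀).1) fun j₀ => (hρ2 j₀).2) 2).trans (le_of_eq (by norm_num))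

lemma tsum_multiHypergeom_le_one {m : Fin r → ℕ} {k : ℕ} (hk : k ≤ ∑ i, m i) :
    ∑' j, ENNReal.ofReal (multiHypergeom m k j) ≤ 1 := by
  obtain ⟨θ, hθ, K, hK, h⟩ := exists_multiHypergeom_coupling r 0 le_rfl
  obtain ⟨ν, h1, h2, -⟩ := h 0 (by simp) m k hk
  simp_rw [← h2]
  rw [← Measure.sum_apply _ MeasurableSet.univ, h1, measure_univ]

/-- The deviation of the drawn values from their mean is sub-Gaussian at scale `√N`, uniformly in
the composition of the population. -/
theorem tsum_multiHypergeom_exp_sq_le (r : ℕ) (M : ℝ) :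
    ∃ c : ℝ, 0 < c ∧ ∃ K : ℝ≥0∞, K ≠ ⊤ ∧ ∀ a : Fin r → ℝ, (∀ i i', |a i - a i'| ≤ M) →
      ∀ (m : Fin r → ℕ) (k : ℕ), k ≤ ∑ i, m i → ∀ t : ℝ, 0 ≤ t → t ≤ c →
        ∑' j, ENNReal.ofReal (multiHypergeom m k j) *
          ENNReal.ofReal (Real.exp (t * drawDev a m k j ^ 2 / (∑ i, m i : ℕ))) ≤ K := by
  induction r with
  | zero =>
    refine ⟨1, one_pos, 1, ENNReal.one_ne_top, fun a _ m k hk t _ _ => ?_⟩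
    have hk0 : k = 0 := by simpa using hk
    rw [tsum_fintype]
    simp [multiHypergeom, hk0]
  | succ r ih =>
    obtain ⟨c', hc', K', hK', ih⟩ := ih
    refine ⟨min (c' / 4) (1 / (64 * (M ^ 2 + 1))), by positivity, 1 + (K' + 68),
      by simp [hK'], fun a ha m k hk t ht0 ht => ?_⟩
    have hM : 0 ≤ M := (abs_nonneg _).trans (ha 0 0)
    have hNs : ∑ i, m i = m 0 + ∑ i, Fin.tail m i := Fin.sum_univ_succ m
    rcases Nat.eq_zero_or_pos (∑ i, m i) with hN | hN
    · -- an empty population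
      have hk0 : k = 0 := by omega
      rw [tsum_eq_single 0 fun j hj => ?_]
      · simp only [hN, Nat.cast_zero, div_zero, Real.exp_zero, ENNReal.ofReal_one, mul_one]
        refine le_trans ?_ le_self_add
        simp [multiHypergeom, hk0]
      · obtain ⟨i, hi⟩ : ∃ i, j i ≠ 0 := by
          by_contra! h
          exact hj (funext h)
        rw [multiHypergeom, if_neg]
        · simp
        · have := Finset.single_le_sum (f := j) (fun _ _ => Nat.zero_le _) (Finset.mem_univ i)
          omega
    have hm : m 0 ≤ ∑ i, m i := by omega
    have ha' : ∀ i i', |Fin.tail a i - Fin.tail a i'| ≤ M := fun i i' => ha _ _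
    have ht1 : 4 * t ≤ c' := by linarith [ht.trans (min_le_left _ _)]
    have ht2 : 4 * t * M ^ 2 ≤ 1 / 16 := by
      have h1 := ht.trans (min_le_right _ _)
      rw [le_div_iff₀ (by positivity)] at h1
      nlinarith
    set N := ∑ i, m i with hNdef
    set N' := ∑ i, Fin.tail m i with hN'def
    have hNr : (0 : ℝ) < N := Nat.cast_pos.2 hN
    set X : ℕ → ℝ := fun j₀ =>
      if j₀ ≤ N then ((j₀ : ℝ) - m 0 * k / N) ^ 2 / N else 0 with hX
    have hstep : ∀ j₀, ∑' j, ENNReal.ofReal (multiHypergeom m k (Fin.cons j₀ j)) *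
        ENNReal.ofReal (Real.exp (t * drawDev a m k (Fin.cons j₀ j) ^ 2 / N)) ≤
        ENNReal.ofReal (hypergeom N (m 0) k j₀) * K' +
          ENNReal.ofReal (hypergeom N (m 0) k j₀) * ENNReal.ofReal (Real.exp (X j₀ / 16)) := by
      intro j₀
      simp_rw [multiHypergeom_cons, ENNReal.ofReal_mul (hypergeom_nonneg _), mul_assoc]
      rw [ENNReal.tsum_mul_left, ← mul_add]
      by_cases h : j₀ ≤ k ∧ k - j₀ ≤ N'
      swap
      · have : hypergeom N (m 0) k j₀ = 0 := by
          rcases le_or_gt j₀ k with h1 | h1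
          · exact hypergeom_eq_zero (Or.inr (by omega))
          · exact hypergeom_of_gt h1
        rw [this, ENNReal.ofReal_zero, zero_mul, zero_mul]
      refine mul_le_mul_right ?_ _
      have hXj : X j₀ = ((j₀ : ℝ) - m 0 * k / N) ^ 2 / N := if_pos (h.1.trans hk)
      have hpt : ∀ j, ∑ i, j i = k - j₀ →
          ENNReal.ofReal (Real.exp (t * drawDev a m k (Fin.cons j₀ j) ^ 2 / N)) ≤
          ENNReal.ofReal (Real.exp (4 * t * drawDev (Fin.tail a) (Fin.tail m) (k - j₀) j ^ 2 / N'))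
            + ENNReal.ofReal (Real.exp (X j₀ / 16)) := by
        intro j hj
        rw [← ENNReal.ofReal_add (Real.exp_pos _).le (Real.exp_pos _).le]
        refine ENNReal.ofReal_le_ofReal ?_
        rw [drawDev_cons a m hN h.1 h.2]
        set W := drawDev (Fin.tail a) (Fin.tail m) (k - j₀) j with hW
        set δ := (j₀ : ℝ) - m 0 * k / N with hδ
        set u := a 0 - tailMean a m
        have hu : u ^ 2 ≤ M ^ 2 := by
          rw [← sq_abs]
          exact pow_le_pow_left₀ (abs_nonneg _) (abs_sub_tailMean_le hM ha m) 2
        have hWN : W ^ 2 / N ≤ W ^ 2 / N' := by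
          rcases Nat.eq_zero_or_pos N' with h0 | h0
          · have : W = 0 := by
              have h3 : ∀ i, j i = 0 := fun i => by
                have := Finset.single_le_sum (f := j) (fun _ _ => Nat.zero_le _)
                  (Finset.mem_univ i)
                have := h.2
                omega
              rw [hW, drawDev, ← hN'def, h0]
              simp [h3]
            simp [this]
          · exact div_le_div_of_nonneg_left (sq_nonneg _) (Nat.cast_pos.2 h0)
              (Nat.cast_le.2 (by omega))
        have h1 : t * (W + u * δ) ^ 2 / N ≤ 2 * t * (W ^ 2 / N') + 2 * t * M ^ 2 * (δ ^ 2 / N) := by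
          have h2 : (W + u * δ) ^ 2 / N ≤ 2 * (W ^ 2 / N) + 2 * M ^ 2 * (δ ^ 2 / N) := by
            rw [← mul_div_assoc, ← mul_div_assoc, ← add_div]
            refine div_le_div_of_nonneg_right ?_ hNr.le
            nlinarith [sq_nonneg (W - u * δ), mul_le_mul_of_nonneg_right hu (sq_nonneg δ)]
          rw [mul_div_assoc]
          nlinarith [mul_le_mul_of_nonneg_left h2 ht0]
        have hδN : 0 ≤ δ ^ 2 / N := by positivity
        set A := W ^ 2 / (N' : ℝ) with hA
        refine (Real.exp_le_exp.2 h1).trans ?_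
        rw [hXj, mul_div_assoc, ← hA]
        have h3 := Real.exp_pos (4 * t * A)
        have h4 := Real.exp_pos (δ ^ 2 / N / 16)
        rcases le_total (2 * t * A) (2 * t * M ^ 2 * (δ ^ 2 / N)) with h5 | h5
        · have := Real.exp_le_exp.2 (show 2 * t * A + 2 * t * M ^ 2 * (δ ^ 2 / N) ≤
            δ ^ 2 / N / 16 by nlinarith)
          linarith
        · have := Real.exp_le_exp.2 (show 2 * t * A + 2 * t * M ^ 2 * (δ ^ 2 / N) ≤
            4 * t * A by nlinarith)
          linarith
      calc _ ≤ ∑' j, (ENNReal.ofReal (multiHypergeom (Fin.tail m) (k - j₀) j) *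
            ENNReal.ofReal (Real.exp (4 * t *
              drawDev (Fin.tail a) (Fin.tail m) (k - j₀) j ^ 2 / N')) +
            ENNReal.ofReal (multiHypergeom (Fin.tail m) (k - j₀) j) *
              ENNReal.ofReal (Real.exp (X j₀ / 16))) := by
            refine ENNReal.tsum_le_tsum fun j => ?_
            by_cases hj : ∑ i, j i = k - j₀
            · rw [← mul_add]
              exact mul_le_mul_right (hpt j hj) _
            · rw [multiHypergeom, if_neg hj]
              simp
        _ ≤ _ := by
            rw [ENNReal.tsum_add, ENNReal.tsum_mul_right]
            refine add_le_add (ih _ ha' _ _ h.2 _ (by positivity) ht1) ?_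
            exact mul_le_of_le_one_left zero_le (tsum_multiHypergeom_le_one h.2)
    rw [tsum_cons]
    refine (ENNReal.tsum_le_tsum hstep).trans (le_trans ?_ le_add_self)
    rw [ENNReal.tsum_add, ENNReal.tsum_mul_right, tsum_hypergeom hm hk, one_mul]
    refine add_le_add le_rfl (tsum_hypergeom_exp_le hm hk hN (v := N) ?_ X ?_ ?_)
    · -- `hypergeomVar N m k ≤ N`
      have hm' : (m 0 : ℝ) ≤ N := Nat.cast_le.2 hm
      have hk' : (k : ℝ) ≤ N := Nat.cast_le.2 hk
      rw [hypergeomVar, div_le_iff₀ (by positivity)]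
      have h1 : (m 0 : ℝ) * k ≤ N * N := mul_le_mul hm' hk' (by positivity) (by positivity)
      have h2 : (N - m 0 : ℝ) * (N - k) ≤ N * N :=
        mul_le_mul (by linarith [(m 0).cast_nonneg (α := ℝ)])
          (by linarith [k.cast_nonneg (α := ℝ)]) (by linarith) (by positivity)
      have h3 := mul_le_mul h1 h2 (mul_nonneg (by linarith) (by linarith)) (by positivity)
      nlinarith
    · intro j
      simp only [hX]
      split_ifs with hj
      · have hj' : (j : ℝ) ≤ N := Nat.cast_le.2 hj
        have hm' : (m 0 : ℝ) ≤ N := Nat.cast_le.2 hm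
        have hk' : (k : ℝ) ≤ N := Nat.cast_le.2 hk
        have h1 : (m 0 : ℝ) * k / N ≤ N := by
          rw [div_le_iff₀ hNr]
          exact mul_le_mul hm' hk' (by positivity) (by positivity)
        have h2 : (0 : ℝ) ≤ (m 0 : ℝ) * k / N := by positivity
        have h3 : |(j : ℝ) - m 0 * k / N| ≤ N :=
          abs_le.2 ⟨by linarith [j.cast_nonneg (α := ℝ)], by linarith⟩
        rw [div_le_iff₀ hNr, ← sq_abs, sq]
        exact mul_le_mul_of_nonneg_left h3 (abs_nonneg _)
      · exact abs_nonneg _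
    · intro j
      simp only [hX]
      split_ifs
      · rw [mul_div_cancel₀ _ hNr.ne']
      · simpa using sq_nonneg _

end

/-! ### Centred Gaussian processes with a given covariance kernel -/

/-- `X` is a centred Gaussian process under `P` with covariance kernel `R`. -/
structure HasGaussianKernel {T Ω : Type*} [MeasurableSpace Ω] (X : T → Ω → ℝ) (R : T → T → ℝ)
    (P : Measure Ω) : Prop where
  isGaussian : IsGaussianProcess X P
  mean_eq_zero : ∀ t, P[X t] = 0
  covariance_eq : ∀ s t, cov[X s, X t; P] = R s t

namespace HasGaussianKernel

variable {S T Ω Ω' : Type*} [MeasurableSpace Ω] [MeasurableSpace Ω'] {X : T → Ω → ℝ}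
  {R : T → T → ℝ} {P : Measure Ω}

lemma isProbabilityMeasure (h : HasGaussianKernel X R P) : IsProbabilityMeasure P :=
  h.isGaussian.isProbabilityMeasure

lemma memLp (h : HasGaussianKernel X R P) (t : T) : MemLp (X t) 2 P :=
  (h.isGaussian.hasGaussianLaw_eval t).memLp_two

lemma congr_kernel (h : HasGaussianKernel X R P) {R' : T → T → ℝ} (hR : ∀ s t, R s t = R' s t) :
    HasGaussianKernel X R' P :=
  ⟨h.1, h.2, fun s t => (h.3 s t).trans (hR s t)⟩

lemma linear (h : HasGaussianKernel X R P) {ι : Type*} [Fintype ι] (w : S → ι → ℝ)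
    (f : S → ι → T) : HasGaussianKernel (fun s ω => ∑ i, w s i * X (f s i) ω)
      (fun s t => ∑ i, ∑ j, w s i * w t j * R (f s i) (f t j)) P where
  isGaussian := by
    classical
    refine IsGaussianProcess.of_isGaussianProcess h.isGaussian fun s => ⟨Finset.univ.image (f s), ?_⟩
    refine ⟨∑ i, w s i • ContinuousLinearMap.proj (R := ℝ) (φ := fun _ => ℝ)
      (⟨f s i, Finset.mem_image_of_mem _ (Finset.mem_univ i)⟩ :
        (Finset.univ.image (f s) : Finset T)), fun ω => ?_⟩
    simp
  mean_eq_zero s := by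
    have := h.isProbabilityMeasure
    rw [integral_finsetSum _ fun i _ => ((h.memLp (f s i)).integrable one_le_two).const_mul _]
    simp [integral_const_mul, h.mean_eq_zero]
  covariance_eq s t := by
    have := h.isProbabilityMeasure
    have h1 : ∀ s i, MemLp (fun ω => w s i * X (f s i) ω) 2 P := fun s i =>
      (h.memLp (f s i)).const_mul _
    rw [covariance_fun_sum_left (h1 s) (memLp_finsetSum _ fun i _ => h1 t i)]
    refine Finset.sum_congr rfl fun i _ => ?_
    rw [covariance_fun_sum_right (h1 t) (h1 s i)]
    refine Finset.sum_congr rfl fun j _ => ?_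
    rw [covariance_const_mul_left, covariance_const_mul_right, h.covariance_eq, mul_assoc]

/-- Being a centred Gaussian process is a property of the law. -/
lemma of_map {φ : Ω' → Ω} {Q : Measure Ω'} (hφ : AEMeasurable φ Q)
    (h : HasGaussianKernel X R (Q.map φ)) (hX : ∀ t, Measurable (X t)) :
    HasGaussianKernel (fun t ω => X t (φ ω)) R Q where
  isGaussian := ⟨fun I => ⟨by
    have h1 := (h.isGaussian.hasGaussianLaw I).isGaussian_map
    rwa [AEMeasurable.map_map_of_aemeasurable
      (measurable_pi_lambda (fun ω => I.restrict fun x => X x ω) fun t => hX t).aemeasurable hφ] at h1⟩⟩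
  mean_eq_zero t := by
    rw [← h.mean_eq_zero t, integral_map hφ (hX t).aestronglyMeasurable]
  covariance_eq s t := by
    rw [← h.covariance_eq s t, covariance_map (hX s).aestronglyMeasurable
      (hX t).aestronglyMeasurable hφ]
    rfl

lemma map {φ : Ω' → Ω} {Q : Measure Ω'} (hφ : AEMeasurable φ Q)
    (h : HasGaussianKernel (fun t ω => X t (φ ω)) R Q) (hX : ∀ t, Measurable (X t)) :
    HasGaussianKernel X R (Q.map φ) where
  isGaussian := ⟨fun I => ⟨by
    have h1 := (h.isGaussian.hasGaussianLaw I).isGaussian_map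
    rwa [AEMeasurable.map_map_of_aemeasurable
      (measurable_pi_lambda (fun ω => I.restrict fun x => X x ω) fun t => hX t).aemeasurable hφ]⟩⟩
  mean_eq_zero t := by
    rw [← h.mean_eq_zero t, integral_map hφ (hX t).aestronglyMeasurable]
  covariance_eq s t := by
    rw [← h.covariance_eq s t, covariance_map (hX s).aestronglyMeasurable
      (hX t).aestronglyMeasurable hφ]
    rfl

/-- Independent Gaussian processes, realized on a product space, are jointly Gaussian. -/
lemma prod (h : HasGaussianKernel X R P) {Y : S → Ω' → ℝ} {R' : S → S → ℝ} {Q : Measure Ω'}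
    (h' : HasGaussianKernel Y R' Q) :
    HasGaussianKernel (Sum.elim (fun t (p : Ω × Ω') => X t p.1) (fun s (p : Ω × Ω') => Y s p.2))
      (fun a b => Sum.elim (fun t => Sum.elim (R t) (fun _ => 0) b)
        (fun s => Sum.elim (fun _ => 0) (R' s) b) a) (P.prod Q) := by
  have := h.isProbabilityMeasure
  have := h'.isProbabilityMeasure
  have hfst : ∀ Z : Ω → ℝ, AEStronglyMeasurable Z P → ∫ p, Z p.1 ∂(P.prod Q) = ∫ ω, Z ω ∂P :=
    fun Z hZ => by
      rw [← (measurePreserving_fst (μ := P) (ν := Q)).map_eq] at hZ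
      rw [← integral_map measurable_fst.aemeasurable hZ, measurePreserving_fst.map_eq]
  have hsnd : ∀ Z : Ω' → ℝ, AEStronglyMeasurable Z Q → ∫ p, Z p.2 ∂(P.prod Q) = ∫ ω, Z ω ∂Q :=
    fun Z hZ => by
      rw [← (measurePreserving_snd (μ := P) (ν := Q)).map_eq] at hZ
      rw [← integral_map measurable_snd.aemeasurable hZ, measurePreserving_snd.map_eq]
  have hXm : ∀ t, AEStronglyMeasurable (X t) P := fun t => (h.memLp t).1
  have hYm : ∀ t, AEStronglyMeasurable (Y t) Q := fun t => (h'.memLp t).1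
  refine ⟨⟨fun I => ?_⟩, ?_, ?_⟩
  · -- the restriction to finitely many indices is a linear image of an independent pair
    have h1 : HasGaussianLaw (fun p : Ω × Ω' => I.toLeft.restrict (X · p.1)) (P.prod Q) := ⟨by
      have h2 := (h.isGaussian.hasGaussianLaw I.toLeft)
      have h3 := h2.isGaussian_map
      rw [← (measurePreserving_fst (μ := P) (ν := Q)).map_eq] at h3
      rwa [AEMeasurable.map_map_of_aemeasurable
        (by rw [measurePreserving_fst.map_eq]; exact h2.aemeasurable) (by fun_prop)] at h3⟩
    have h2 : HasGaussianLaw (fun p : Ω × Ω' => I.toRight.restrict (Y · p.2)) (P.prod Q) := ⟨by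
      have h2 := (h'.isGaussian.hasGaussianLaw I.toRight)
      have h3 := h2.isGaussian_map
      rw [← (measurePreserving_snd (μ := P) (ν := Q)).map_eq] at h3
      rwa [AEMeasurable.map_map_of_aemeasurable
        (by rw [measurePreserving_snd.map_eq]; exact h2.aemeasurable) (by fun_prop)] at h3⟩
    have h3 := IndepFun.hasGaussianLaw h1 h2 (indepFun_prod₀
      (h.isGaussian.hasGaussianLaw I.toLeft).aemeasurable
      (h'.isGaussian.hasGaussianLaw I.toRight).aemeasurable)
    let L : ((I.toLeft → ℝ) × (I.toRight → ℝ)) →L[ℝ] (I → ℝ) := ContinuousLinearMap.pi fun i =>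
      match i with
      | ⟨Sum.inl t, ht⟩ => (ContinuousLinearMap.proj (R := ℝ) (φ := fun _ => ℝ)
          (⟨t, Finset.mem_toLeft.2 ht⟩ : I.toLeft)).comp (ContinuousLinearMap.fst ℝ _ _)
      | ⟨Sum.inr t, ht⟩ => (ContinuousLinearMap.proj (R := ℝ) (φ := fun _ => ℝ)
          (⟨t, Finset.mem_toRight.2 ht⟩ : I.toRight)).comp (ContinuousLinearMap.snd ℝ _ _)
    have h4 := h3.map L
    have h5 : (fun p : Ω × Ω' => I.restrict (Sum.elim (fun t (p : Ω × Ω') => X t p.1)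
        (fun s (p : Ω × Ω') => Y s p.2) · p)) =
        L ∘ fun p => (I.toLeft.restrict (X · p.1), I.toRight.restrict (Y · p.2)) := by
      funext p i
      rcases i with ⟨t | t, ht⟩ <;> rfl
    rw [h5]
    exact h4
  · rintro (t | t)
    · simp only [Sum.elim_inl]
      rw [hfst _ (hXm t), h.mean_eq_zero]
    · simp only [Sum.elim_inr]
      rw [hsnd _ (hYm t), h'.mean_eq_zero]
  · have hcf : ∀ s t, cov[fun p : Ω × Ω' => X s p.1, fun p => X t p.1; P.prod Q] =
        cov[X s, X t; P] := fun s t => by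
      have := covariance_map (μ := P.prod Q) (Z := Prod.fst) (X := X s) (Y := X t)
        (by rw [measurePreserving_fst.map_eq]; exact hXm s)
        (by rw [measurePreserving_fst.map_eq]; exact hXm t) (by fun_prop)
      rw [measurePreserving_fst.map_eq] at this
      exact this.symm
    have hcs : ∀ s t, cov[fun p : Ω × Ω' => Y s p.2, fun p => Y t p.2; P.prod Q] =
        cov[Y s, Y t; Q] := fun s t => by
      have := covariance_map (μ := P.prod Q) (Z := Prod.snd) (X := Y s) (Y := Y t)
        (by rw [measurePreserving_snd.map_eq]; exact hYm s)
        (by rw [measurePreserving_snd.map_eq]; exact hYm t) (by fun_prop)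
      rw [measurePreserving_snd.map_eq] at this
      exact this.symm
    have hX2 : ∀ t, MemLp (fun p : Ω × Ω' => X t p.1) 2 (P.prod Q) := fun t =>
      (h.memLp t).comp_measurePreserving measurePreserving_fst
    have hY2 : ∀ t, MemLp (fun p : Ω × Ω' => Y t p.2) 2 (P.prod Q) := fun t =>
      (h'.memLp t).comp_measurePreserving measurePreserving_snd
    have hind : ∀ s t, cov[fun p : Ω × Ω' => X s p.1, fun p => Y t p.2; P.prod Q] = 0 :=
      fun s t => (indepFun_prod₀ (hXm s).aemeasurable (hYm t).aemeasurable).covariance_eq_zero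
        (hX2 s) (hY2 t)
    rintro (s | s) (t | t)
    · simpa using (hcf s t).trans (h.covariance_eq s t)
    · simpa using hind s t
    · simp only [Sum.elim_inl, Sum.elim_inr]
      rw [covariance_comm]
      exact hind t s
    · simpa using (hcs s t).trans (h'.covariance_eq s t)

end HasGaussianKernel

/-! ### Bridges on a lattice -/

/-- The law `γ` makes the coordinates `0, …, N` a Brownian bridge of duration `N` restricted to the
integers. -/
def IsLatticeBridge (N : ℕ) (γ : Measure (ℕ → ℝ)) : Prop :=
  HasGaussianKernel (fun (i : Fin (N + 1)) (b : ℕ → ℝ) => b i)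
    (fun i j => min (i : ℝ) j - i * j / N) γ

/-- The lattice bridge of duration `k + l` that is built from its value at `k`, a multiple of the
first component, and from two lattice bridges of durations `k` and `l`. -/
noncomputable def concatBridge (k l : ℕ) (p : ℝ × (ℕ → ℝ) × (ℕ → ℝ)) (i : ℕ) : ℝ :=
  if i ≤ k then p.2.1 i + i / k * √(k * l / (k + l : ℕ)) * p.1
  else p.2.2 (i - k) + ((k + l : ℕ) - i) / l * √(k * l / (k + l : ℕ)) * p.1

@[fun_prop]
lemma measurable_concatBridge (k l : ℕ) : Measurable (concatBridge k l) := by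
  refine measurable_pi_lambda _ fun i => ?_
  unfold concatBridge
  split_ifs <;> fun_prop

lemma hasGaussianKernel_stdNormal :
    HasGaussianKernel (fun (_ : Unit) (z : ℝ) => z) (fun _ _ => 1) stdNormal where
  isGaussian := ⟨fun I => by
    have h : HasGaussianLaw (fun z : ℝ => z) stdNormal := ⟨by
      rw [Measure.map_id']
      infer_instance⟩
    exact h.map (ContinuousLinearMap.pi fun _ : I => ContinuousLinearMap.id ℝ ℝ)⟩
  mean_eq_zero _ := integral_id_gaussianReal
  covariance_eq _ _ := by
    rw [covariance_self (by fun_prop)]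
    simp

lemma IsLatticeBridge.concat {k l : ℕ} (hk : 0 < k) (hl : 0 < l) {γ γ' : Measure (ℕ → ℝ)}
    (h : IsLatticeBridge k γ) (h' : IsLatticeBridge l γ') :
    IsLatticeBridge (k + l) ((stdNormal.prod (γ.prod γ')).map (concatBridge k l)) := by
  refine HasGaussianKernel.map (by fun_prop) ?_ fun t => measurable_pi_apply _
  have h1 := (hasGaussianKernel_stdNormal.prod (h.prod h')).linear (S := Fin (k + l + 1))
    (fun i (b : Bool) => if b then 1 else
      if (i : ℕ) ≤ k then (i : ℝ) / k * √(k * l / (k + l : ℕ)) else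
        ((k + l : ℕ) - i) / l * √(k * l / (k + l : ℕ)))
    (fun i (b : Bool) => if b then
      Sum.inr (if h : (i : ℕ) ≤ k then Sum.inl ⟨i, by omega⟩ else Sum.inr ⟨i - k, by omega⟩)
      else Sum.inl ())
  have hk0 : (0 : ℝ) < k := Nat.cast_pos.2 hk
  have hl0 : (0 : ℝ) < l := Nat.cast_pos.2 hl
  have hsq : √((k : ℝ) * l / (k + l : ℕ)) * √((k : ℝ) * l / (k + l : ℕ)) = k * l / (k + l) := by
    rw [Real.mul_self_sqrt (by positivity), Nat.cast_add]
  convert h1.congr_kernel ?_ using 1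
  · funext i p
    simp only [Fintype.sum_bool, concatBridge]
    by_cases hi : (i : ℕ) ≤ k <;> simp [hi]
  · intro i j
    simp only [Fintype.sum_bool]
    have hkl : (k : ℝ) + l ≠ 0 := by positivity
    by_cases hi : (i : ℕ) ≤ k <;> by_cases hj : (j : ℕ) ≤ k
    · simp only [hi, hj, if_true, Bool.false_eq_true, if_false, dif_pos, Sum.elim_inl, Sum.elim_inr,
        mul_one, mul_zero, add_zero, zero_add, one_mul]
      rw [mul_mul_mul_comm, hsq]
      push_cast
      field_simp
      ring
    · have hij : (i : ℝ) ≤ j := Nat.cast_le.2 (by omega)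
      simp only [hi, hj, if_true, Bool.false_eq_true, if_false, dif_pos, Sum.elim_inl, Sum.elim_inr,
        mul_one, mul_zero, add_zero, zero_add, one_mul, dif_neg, not_false_eq_true]
      rw [mul_mul_mul_comm, hsq, min_eq_left hij]
      push_cast
      field_simp
    · have hij : (j : ℝ) ≤ i := Nat.cast_le.2 (by omega)
      simp only [hi, hj, if_true, Bool.false_eq_true, if_false, dif_pos, Sum.elim_inl, Sum.elim_inr,
        mul_one, mul_zero, add_zero, zero_add, one_mul, dif_neg, not_false_eq_true]
      rw [mul_mul_mul_comm, hsq, min_eq_right hij]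
      push_cast
      field_simp
    · simp only [hi, hj, if_true, Bool.false_eq_true, if_false, Sum.elim_inl, Sum.elim_inr,
        mul_one, mul_zero, add_zero, zero_add, one_mul, dif_neg, not_false_eq_true]
      rw [mul_mul_mul_comm, hsq, Nat.cast_sub (by omega), Nat.cast_sub (by omega),
        min_sub_sub_right]
      push_cast
      field_simp
      ring

lemma isLatticeBridge_one : IsLatticeBridge 1 (Measure.dirac 0) := by
  have h := hasGaussianKernel_stdNormal.linear (S := Fin 2) (ι := Empty) (fun _ i => i.elim)
    (fun _ i => i.elim)
  have h1 : HasGaussianKernel (fun (i : Fin (1 + 1)) (b : ℕ → ℝ) => b i) (fun _ _ => 0)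
      (stdNormal.map fun _ => (0 : ℕ → ℝ)) :=
    HasGaussianKernel.map (by fun_prop) (by simpa using h) fun t => measurable_pi_apply _
  rw [Measure.map_const, measure_univ, one_smul] at h1
  refine h1.congr_kernel fun i j => ?_
  fin_cases i <;> fin_cases j <;> simp

/-! ### Splitting a sequence in two blocks -/

section

variable {k l : ℕ}

lemma partialSum_append_of_le (x : Fin k → ℝ) (y : Fin l → ℝ) {i : ℕ} (hi : i ≤ k) :
    partialSum (Fin.append x y) i = partialSum x i := by
  unfold partialSum
  rw [Finset.sum_filter, Finset.sum_filter, Fin.sum_univ_add]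
  have : ∀ j : Fin l, ¬ k + (j : ℕ) < i := fun j => by omega
  simp [this]

lemma partialSum_append_add (x : Fin k → ℝ) (y : Fin l → ℝ) (i : ℕ) :
    partialSum (Fin.append x y) (k + i) = partialSum x k + partialSum y i := by
  unfold partialSum
  rw [Finset.sum_filter, Finset.sum_filter, Finset.sum_filter, Fin.sum_univ_add]
  have : ∀ j : Fin k, (j : ℕ) < k + i := fun j => by omega
  simp [this]

lemma bridgeSum_append_of_le (hk : 0 < k) (x : Fin k → ℝ) (y : Fin l → ℝ) {i : ℕ} (hi : i ≤ k) :
    bridgeSum (Fin.append x y) i =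
      bridgeSum x i + i / k * bridgeSum (Fin.append x y) k := by
  have hk0 : (k : ℝ) ≠ 0 := Nat.cast_ne_zero.2 hk.ne'
  unfold bridgeSum
  rw [partialSum_append_of_le x y hi, partialSum_append_of_le x y le_rfl]
  field_simp
  ring

lemma bridgeSum_append_add (hl : 0 < l) (x : Fin k → ℝ) (y : Fin l → ℝ) (i : ℕ) :
    bridgeSum (Fin.append x y) (k + i) =
      bridgeSum y i + (l - i) / l * bridgeSum (Fin.append x y) k := by
  have hl0 : (l : ℝ) ≠ 0 := Nat.cast_ne_zero.2 hl.ne'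
  have hkl : (k : ℝ) + l ≠ 0 := by positivity
  unfold bridgeSum
  rw [partialSum_append_add, partialSum_append_add, partialSum_append_of_le x y le_rfl]
  push_cast
  field_simp
  ring

/-- The maximal distance on the lattice between the bridge of the partial sums of `x` and the
multiple `η b` of the lattice path `b`. -/
noncomputable def latticeDev {N : ℕ} (x : Fin N → ℝ) (η : ℝ) (b : ℕ → ℝ) : ℝ :=
  Finset.univ.sup' Finset.univ_nonempty fun i : Fin (N + 1) => |bridgeSum x i - η * b i|

lemma le_latticeDev {N : ℕ} (x : Fin N → ℝ) (η : ℝ) (b : ℕ → ℝ) {i : ℕ} (hi : i ≤ N) :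
    |bridgeSum x i - η * b i| ≤ latticeDev x η b :=
  Finset.le_sup'_of_le _ (b := (⟨i, Nat.lt_succ_of_le hi⟩ : Fin (N + 1))) (Finset.mem_univ _) le_rfl

lemma latticeDev_le {N : ℕ} {x : Fin N → ℝ} {η : ℝ} {b : ℕ → ℝ} {c : ℝ}
    (h : ∀ i ≤ N, |bridgeSum x i - η * b i| ≤ c) : latticeDev x η b ≤ c :=
  Finset.sup'_le _ _ fun i _ => h i (Nat.lt_succ_iff.1 i.isLt)

lemma measurable_latticeDev {N : ℕ} (x : Fin N → ℝ) (η : ℝ) : Measurable (latticeDev x η) := by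
  have h : latticeDev x η = Finset.univ.sup' Finset.univ_nonempty
      fun (i : Fin (N + 1)) (b : ℕ → ℝ) => |bridgeSum x i - η * b i| := by
    funext b
    rw [Finset.sup'_apply]
    rfl
  rw [h]
  exact Finset.measurable_sup' _ fun i _ => by fun_prop

lemma latticeDev_append_le (hk : 0 < k) (hl : 0 < l) (x : Fin k → ℝ) (y : Fin l → ℝ) (η : ℝ)
    (g : ℝ) (b b' : ℕ → ℝ) :
    latticeDev (Fin.append x y) η (concatBridge k l (g, b, b')) ≤
      max (latticeDev x η b) (latticeDev y η b') +
        |bridgeSum (Fin.append x y) k - η * (√(k * l / (k + l : ℕ)) * g)| := by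
  have hk0 : (0 : ℝ) < k := Nat.cast_pos.2 hk
  have hl0 : (0 : ℝ) < l := Nat.cast_pos.2 hl
  set E := bridgeSum (Fin.append x y) k - η * (√(k * l / (k + l : ℕ)) * g) with hE
  have hfrac : ∀ u v q : ℝ, |u| ≤ q → 0 ≤ v → v ≤ 1 → |u + v * E| ≤ q + |E| := fun u v q h1 h2 h3 => by
    refine (abs_add_le _ _).trans (add_le_add h1 ?_)
    rw [abs_mul, abs_of_nonneg h2]
    exact mul_le_of_le_one_left (abs_nonneg _) h3
  refine latticeDev_le fun i hi => ?_
  rcases le_or_gt i k with h | h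
  · have e : bridgeSum (Fin.append x y) i - η * concatBridge k l (g, b, b') i =
        (bridgeSum x i - η * b i) + (i / k) * E := by
      rw [bridgeSum_append_of_le hk x y h, concatBridge, if_pos h, hE]
      ring
    rw [e]
    exact hfrac _ _ _ ((le_latticeDev x η b h).trans (le_max_left _ _)) (by positivity)
      ((div_le_one hk0).2 (Nat.cast_le.2 h))
  · obtain ⟨i', rfl⟩ := Nat.exists_eq_add_of_le h.le
    have hi' : i' ≤ l := by omega
    have e : bridgeSum (Fin.append x y) (k + i') - η * concatBridge k l (g, b, b') (k + i') =
        (bridgeSum y i' - η * b' i') + ((l - i') / l) * E := by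
      rw [bridgeSum_append_add hl x y, concatBridge, if_neg (by omega), hE, Nat.add_sub_cancel_left]
      push_cast
      ring
    rw [e]
    have hil : (i' : ℝ) ≤ l := Nat.cast_le.2 hi'
    exact hfrac _ _ _ ((le_latticeDev y η b' hi').trans (le_max_right _ _))
      (div_nonneg (by linarith) hl0.le)
      ((div_le_one hl0).2 (by linarith [i'.cast_nonneg (α := ℝ)]))

end

/-! ### Sequences with prescribed counts -/

section

variable {r : ℕ}

/-- The number of positions at which the sequence `s` has the value `i`. -/
def count {N : ℕ} (s : Fin N → Fin r) (i : Fin r) : ℕ :=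
  (Finset.univ.filter fun p => s p = i).card

/-- The probability of the sequence `s` under the uniform distribution on the sequences in which
each value `i` has exactly `m i` occurrences. -/
noncomputable def arrangementProb {N : ℕ} (m : Fin r → ℕ) (s : Fin N → Fin r) : ℝ :=
  if count s = m then (∏ i, ((m i).factorial : ℝ)) / N.factorial else 0

lemma sum_count {N : ℕ} (s : Fin N → Fin r) : ∑ i, count s i = N := by
  have h := Finset.card_eq_sum_card_fiberwise (f := s) (s := Finset.univ) (t := Finset.univ)
    (fun _ _ => Finset.mem_coe.2 (Finset.mem_univ _))
  rw [Finset.card_univ, Fintype.card_fin] at h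
  exact h.symm

lemma sum_comp_eq_sum_count {N : ℕ} (s : Fin N → Fin r) (f : Fin r → ℝ) :
    ∑ p, f (s p) = ∑ i, count s i * f i := by
  rw [← Finset.sum_fiberwise (s := Finset.univ) (g := s)]
  refine Finset.sum_congr rfl fun i _ => ?_
  rw [Finset.sum_congr rfl (g := fun _ => f i) fun p hp => by rw [(Finset.mem_filter.1 hp).2],
    Finset.sum_const, nsmul_eq_mul]
  rfl

lemma count_append {k l : ℕ} (u : Fin k → Fin r) (v : Fin l → Fin r) :
    count (Fin.append u v) = count u + count v := by
  funext i
  simp only [count, Pi.add_apply, Finset.card_filter]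
  rw [Fin.sum_univ_add]
  simp

lemma comp_append {α β : Type*} {k l : ℕ} (a : α → β) (u : Fin k → α) (v : Fin l → α) :
    (fun p => a (Fin.append u v p)) = Fin.append (fun p => a (u p)) (fun p => a (v p)) := by
  funext p
  refine Fin.addCases (fun i => ?_) (fun i => ?_) p <;> simp

lemma arrangementProb_nonneg {N : ℕ} (m : Fin r → ℕ) (s : Fin N → Fin r) :
    0 ≤ arrangementProb m s := by
  unfold arrangementProb
  split_ifs <;> positivity

/-- A uniform arrangement is obtained by choosing the composition of the first block and then
arranging both blocks uniformly. -/
lemma multiHypergeom_mul_arrangementProb {k l : ℕ} {m : Fin r → ℕ} (hm : ∑ i, m i = k + l)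
    (u : Fin k → Fin r) (v : Fin l → Fin r) :
    multiHypergeom m k (count u) * (arrangementProb (count u) u *
      arrangementProb (m - count u) v) = arrangementProb m (Fin.append u v) := by
  rw [multiHypergeom, if_pos (sum_count u), hm]
  unfold arrangementProb
  rw [if_pos rfl, count_append]
  by_cases h : count u + count v = m
  · have h1 : count v = m - count u := by rw [← h, add_tsub_cancel_left]
    rw [if_pos h1, if_pos h, ← h1, ← h]
    have h2 : (((k + l).choose k : ℕ) : ℝ) * (k.factorial * l.factorial) = (k + l).factorial := by
      have := Nat.add_choose_mul_factorial_mul_factorial k l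
      rw [← Nat.choose_symm_add] at this
      rw [← mul_assoc]
      exact_mod_cast this
    have h3 : ∀ i, (((count u + count v) i).choose (count u i) : ℝ) *
        ((count u i).factorial * (count v i).factorial) = ((count u + count v) i).factorial :=
      fun i => by
        have := Nat.add_choose_mul_factorial_mul_factorial (count u i) (count v i)
        rw [← Nat.choose_symm_add, ← Pi.add_apply] at this
        rw [← mul_assoc]
        exact_mod_cast this
    simp_rw [← h3]
    rw [Finset.prod_mul_distrib, Finset.prod_mul_distrib, ← h2]
    have h4 : (((k + l).choose k : ℕ) : ℝ) ≠ 0 :=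
      Nat.cast_ne_zero.2 (Nat.choose_pos (Nat.le_add_right k l)).ne'
    field_simp
  · rw [if_neg h]
    by_cases h1 : count v = m - count u
    · -- some value is drawn more often than it occurs
      obtain ⟨i, hi⟩ : ∃ i, m i < count u i := by
        by_contra! h2
        exact h (by rw [h1, add_tsub_cancel_of_le h2])
      rw [Finset.prod_eq_zero (Finset.mem_univ i)
        (by rw [Nat.choose_eq_zero_of_lt hi, Nat.cast_zero])]
      simp
    · rw [if_neg h1]
      simp

lemma multiHypergeom_eq_zero {m j : Fin r → ℕ} {k : ℕ} (h : ¬ (∑ i, j i = k ∧ j ≤ m)) :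
    multiHypergeom m k j = 0 := by
  unfold multiHypergeom
  split_ifs with h1
  · obtain ⟨i, hi⟩ : ∃ i, m i < j i := by
      by_contra! h2
      exact h ⟨h1, h2⟩
    rw [Finset.prod_eq_zero (Finset.mem_univ i)
      (by rw [Nat.choose_eq_zero_of_lt hi, Nat.cast_zero]), zero_div]
  · rfl

lemma tsum_append {k l : ℕ} (f : (Fin (k + l) → Fin r) → ℝ≥0∞) :
    ∑' s, f s = ∑' u, ∑' v, f (Fin.append u v) := by
  rw [← (Fin.appendEquiv k l).tsum_eq f, ← ENNReal.tsum_prod]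
  rfl

/-! ### Energy of a composition -/

/-- The exponent that controls the coupling: the squared normalized sum of the values, and the
squared normalized distance between their second moment and `η ^ 2`. -/
noncomputable def energy (a : Fin r → ℝ) (m : Fin r → ℕ) (η : ℝ) : ℝ :=
  ((∑ i, m i * a i) ^ 2 + (∑ i, m i * (a i ^ 2 - η ^ 2)) ^ 2) / ((∑ i, m i : ℕ) : ℝ)

lemma energy_nonneg (a : Fin r → ℝ) (m : Fin r → ℕ) (η : ℝ) : 0 ≤ energy a m η := by
  unfold energy
  positivity

lemma sum_mul_eq_drawDev (f : Fin r → ℝ) (m j : Fin r → ℕ) (k : ℕ) :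
    ∑ i, j i * f i = k / ((∑ i, m i : ℕ) : ℝ) * ∑ i, m i * f i + drawDev f m k j := by
  unfold drawDev
  rw [Finset.mul_sum, ← Finset.sum_add_distrib]
  exact Finset.sum_congr rfl fun i _ => by ring

lemma sum_sub_mul_eq_drawDev (f : Fin r → ℝ) {m j : Fin r → ℕ} {k l : ℕ} (hj : j ≤ m)
    (hl : 0 < l) (hm : ∑ i, m i = k + l) :
    ∑ i, ((m - j) i : ℕ) * f i = l / ((∑ i, m i : ℕ) : ℝ) * ∑ i, m i * f i - drawDev f m k j := by
  have h : ∑ i, ((m - j) i : ℕ) * f i = ∑ i, m i * f i - ∑ i, j i * f i := by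
    rw [← Finset.sum_sub_distrib]
    refine Finset.sum_congr rfl fun i _ => ?_
    rw [Pi.sub_apply, Nat.cast_sub (hj i), sub_mul]
  rw [h, sum_mul_eq_drawDev f m j k, hm]
  push_cast
  have : (k : ℝ) + l ≠ 0 := by positivity
  field_simp
  ring

/-- Contraction of the energy. A half of proportion `k / N ≤ 2 / 3` has the fraction `k / N` of the
energy of the whole, up to the fluctuations `w₁` and `w₂`; the cross terms are absorbed by increasing
`2 / 3` to `4 / 5`. -/
lemma energy_le_of_eq {a : Fin r → ℝ} {m j : Fin r → ℕ} {η : ℝ} {k N : ℕ} {w₁ w₂ : ℝ}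
    (hm : ∑ i, m i = N) (hj : ∑ i, j i = k) (hk : 0 < k) (hkN : 3 * k ≤ 2 * N) (hNk : N ≤ 3 * k)
    (h₁ : ∑ i, j i * a i = k / N * ∑ i, m i * a i + w₁)
    (h₂ : ∑ i, j i * (a i ^ 2 - η ^ 2) = k / N * ∑ i, m i * (a i ^ 2 - η ^ 2) + w₂) :
    energy a j η ≤ 4 / 5 * energy a m η + 18 * (w₁ ^ 2 / N) + 18 * (w₂ ^ 2 / N) := by
  have hk0 : (0 : ℝ) < k := Nat.cast_pos.2 hk
  have hN0 : (0 : ℝ) < N := Nat.cast_pos.2 (by omega)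
  have hkN' : 3 * (k : ℝ) ≤ 2 * N := by exact_mod_cast hkN
  have hNk' : (N : ℝ) ≤ 3 * k := by exact_mod_cast hNk
  have key : ∀ F w : ℝ, (k / N * F + w) ^ 2 / k ≤ 4 / 5 * (F ^ 2 / N) + 18 * (w ^ 2 / N) := by
    intro F w
    have e1 : (k / N * F + w) ^ 2 ≤ 6 / 5 * (k / N * F) ^ 2 + 6 * w ^ 2 := by
      nlinarith [sq_nonneg (k / N * F - 5 * w)]
    have e2 : 6 / 5 * (k / N * F) ^ 2 / k ≤ 4 / 5 * (F ^ 2 / N) := by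
      have : 6 / 5 * (k / N * F) ^ 2 / k = 6 / 5 * (k / N) * (F ^ 2 / N) := by field_simp
      rw [this]
      refine mul_le_mul_of_nonneg_right ?_ (by positivity)
      have : (k : ℝ) / N ≤ 2 / 3 := by
        rw [div_le_div_iff₀ hN0 (by norm_num)]
        linarith
      linarith
    have e3 : 6 * w ^ 2 / k ≤ 18 * (w ^ 2 / N) := by
      rw [← mul_div_assoc, div_le_div_iff₀ hk0 hN0]
      nlinarith [sq_nonneg w]
    calc _ ≤ (6 / 5 * (k / N * F) ^ 2 + 6 * w ^ 2) / k := div_le_div_of_nonneg_right e1 hk0.le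
      _ = 6 / 5 * (k / N * F) ^ 2 / k + 6 * w ^ 2 / k := add_div _ _ _
      _ ≤ _ := add_le_add e2 e3
  unfold energy
  rw [hm, hj, h₁, h₂, add_div, add_div]
  linarith [key (∑ i, m i * a i) w₁, key (∑ i, m i * (a i ^ 2 - η ^ 2)) w₂]

/-- Replacing the standard deviation of the population by `η ≥ ν` is paid for by the energy. -/
lemma mul_sq_sqrt_popVar_sub_le {a : Fin r → ℝ} {m : Fin r → ℕ} {η ν A : ℝ} (hν : 0 < ν)
    (hη : ν ≤ η) (hA : ∀ i, |a i| ≤ A) (hm : 0 < ∑ i, m i) :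
    ((∑ i, m i : ℕ) : ℝ) * (√(popVar a m) - η) ^ 2 ≤ 2 / ν ^ 2 * (1 + A ^ 2) * energy a m η := by
  have hN0 : (0 : ℝ) < ((∑ i, m i : ℕ) : ℝ) := Nat.cast_pos.2 hm
  have hv := popVar_nonneg a m
  have hσ := Real.sqrt_nonneg (popVar a m)
  have hσ2 := Real.sq_sqrt hv
  set σ := √(popVar a m)
  set N : ℝ := ((∑ i, m i : ℕ) : ℝ) with hN
  set S := ∑ i, m i * a i with hS
  set F := ∑ i, m i * (a i ^ 2 - η ^ 2) with hF
  have hsum : ∑ i, (m i : ℝ) = N := by rw [hN]; push_cast; rfl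
  have h1 : popVar a m - η ^ 2 = F / N - S ^ 2 / N ^ 2 := by
    have : F = ∑ i, m i * a i ^ 2 - N * η ^ 2 := by
      rw [hF, ← hsum, Finset.sum_mul, ← Finset.sum_sub_distrib]
      exact Finset.sum_congr rfl fun i _ => by ring
    rw [this, popVar, ← hN, ← hS]
    field_simp
    ring
  have hSA : S ^ 2 ≤ A ^ 2 * N ^ 2 := by
    have : |S| ≤ A * N := by
      refine (Finset.abs_sum_le_sum_abs _ _).trans ?_
      rw [← hsum, Finset.mul_sum]
      refine Finset.sum_le_sum fun i _ => ?_
      rw [abs_mul, abs_of_nonneg (Nat.cast_nonneg _), mul_comm]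
      exact mul_le_mul_of_nonneg_right (hA i) (Nat.cast_nonneg _)
    rw [← sq_abs, ← mul_pow]
    exact pow_le_pow_left₀ (abs_nonneg _) this 2
  have h2 : ν ^ 2 * (σ - η) ^ 2 ≤ (popVar a m - η ^ 2) ^ 2 := by
    have e : (popVar a m - η ^ 2) ^ 2 = (σ + η) ^ 2 * (σ - η) ^ 2 := by
      rw [← hσ2]
      ring
    rw [e]
    exact mul_le_mul_of_nonneg_right (pow_le_pow_left₀ hν.le (by linarith) 2) (sq_nonneg _)
  have h3 : N * (popVar a m - η ^ 2) ^ 2 ≤ 2 * (1 + A ^ 2) * ((S ^ 2 + F ^ 2) / N) := by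
    rw [h1]
    have e1 : N * (F / N - S ^ 2 / N ^ 2) ^ 2 ≤ 2 * (F ^ 2 / N) + 2 * (S ^ 2 / N ^ 2 * (S ^ 2 / N)) := by
      have : N * (F / N - S ^ 2 / N ^ 2) ^ 2 = 2 * (F ^ 2 / N) + 2 * (S ^ 2 / N ^ 2 * (S ^ 2 / N)) -
          N * (F / N + S ^ 2 / N ^ 2) ^ 2 := by
        field_simp
        ring
      rw [this]
      nlinarith [mul_nonneg hN0.le (sq_nonneg (F / N + S ^ 2 / N ^ 2))]
    have e2 : S ^ 2 / N ^ 2 ≤ A ^ 2 := by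
      rw [div_le_iff₀ (by positivity)]
      exact hSA
    have e3 : 0 ≤ S ^ 2 / N := by positivity
    have e4 : 0 ≤ F ^ 2 / N := by positivity
    rw [add_div]
    nlinarith [mul_le_mul_of_nonneg_right e2 e3, mul_nonneg (sq_nonneg A) e4]
  have h4 : ν ^ 2 * (N * (σ - η) ^ 2) ≤ 2 * (1 + A ^ 2) * energy a m η := by
    calc _ = N * (ν ^ 2 * (σ - η) ^ 2) := by ring
      _ ≤ N * (popVar a m - η ^ 2) ^ 2 := mul_le_mul_of_nonneg_left h2 hN0.le
      _ ≤ _ := h3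
  rw [div_mul_eq_mul_div, div_mul_eq_mul_div, le_div_iff₀ (by positivity)]
  linarith

/-- The bridge of the partial sums at the splitting time is the deviation of the first block. -/
lemma bridgeSum_append_eq_drawDev {a : Fin r → ℝ} {m : Fin r → ℕ} {k l : ℕ} {u : Fin k → Fin r}
    {v : Fin l → Fin r} (h : count (Fin.append u v) = m) :
    bridgeSum (fun p => a (Fin.append u v p)) k = drawDev a m k (count u) := by
  have hN : ∑ i, m i = k + l := by rw [← h, sum_count]
  have h1 : partialSum (fun p => a (Fin.append u v p)) (k + l) = ∑ i, m i * a i := by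
    rw [← h, ← sum_comp_eq_sum_count]
    unfold partialSum
    rw [Finset.filter_true_of_mem fun p _ => p.isLt]
  have h2 : partialSum (fun p => a (Fin.append u v p)) k = ∑ i, count u i * a i := by
    rw [← sum_comp_eq_sum_count, comp_append, partialSum_append_of_le _ _ le_rfl]
    unfold partialSum
    rw [Finset.filter_true_of_mem fun p _ => p.isLt]
  rw [bridgeSum, h1, h2, sum_mul_eq_drawDev a m (count u) k, hN]
  ring

end

/-! ### Coupling of exchangeable sequences with lattice bridges -/

section

variable {r : ℕ}

lemma tsum_measure_univ_eq_one {X ι : Type*} [MeasurableSpace X] {ρ : ι → Measure X}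
    {γ : Measure X} [IsProbabilityMeasure γ] (h : Measure.sum ρ = γ) : ∑' i, ρ i univ = 1 := by
  rw [← Measure.sum_apply _ MeasurableSet.univ, h, measure_univ]

lemma lintegral_prod_mul_mul {X Y Z : Type*} [MeasurableSpace X] [MeasurableSpace Y]
    [MeasurableSpace Z] {μ : Measure X} {ν : Measure Y} {ρ : Measure Z} [IsFiniteMeasure μ]
    [IsFiniteMeasure ν] [IsFiniteMeasure ρ] {f : X → ℝ≥0∞} {g : Y → ℝ≥0∞} {h : Z → ℝ≥0∞}
    (hf : Measurable f) (hg : Measurable g) (hh : Measurable h) :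
    ∫⁻ p, f p.1 * (g p.2.1 * h p.2.2) ∂(μ.prod (ν.prod ρ)) =
      (∫⁻ x, f x ∂μ) * ((∫⁻ y, g y ∂ν) * ∫⁻ z, h z ∂ρ) := by
  rw [lintegral_prod_mul (f := f) (g := fun p : Y × Z => g p.1 * h p.2) hf.aemeasurable
    (by fun_prop), lintegral_prod_mul hg.aemeasurable hh.aemeasurable]

/-- The exponential moment of the deviation of a concatenation, for a given composition of the
first block. -/
lemma tsum_lintegral_concat_le {a : Fin r → ℝ} {k l : ℕ} (hk : 0 < k) (hl : 0 < l)
    {ν : Measure ℝ} {ρ : (Fin k → Fin r) → Measure (ℕ → ℝ)}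
    {ρ' : (Fin l → Fin r) → Measure (ℕ → ℝ)} [IsFiniteMeasure ν] [∀ u, IsFiniteMeasure (ρ u)]
    [∀ v, IsFiniteMeasure (ρ' v)] (h1 : ∑' u, ρ u univ = 1) (h1' : ∑' v, ρ' v univ = 1) {W : ℝ}
    (hW : ∀ u v, ρ u ≠ 0 → ρ' v ≠ 0 → bridgeSum (fun p => a (Fin.append u v p)) k = W)
    {η t : ℝ} (ht : 0 ≤ t) :
    ∑' u, ∑' v, ∫⁻ b, ENNReal.ofReal (Real.exp (t *
        latticeDev (fun p => a (Fin.append u v p)) η b))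
        ∂((ν.prod ((ρ u).prod (ρ' v))).map (concatBridge k l)) ≤
      (∫⁻ z, ENNReal.ofReal (Real.exp (t * |W - η * (√(k * l / (k + l : ℕ)) * z)|)) ∂ν) *
        ((∑' u, ∫⁻ b, ENNReal.ofReal (Real.exp (t * latticeDev (fun p => a (u p)) η b)) ∂(ρ u)) +
          ∑' v, ∫⁻ b, ENNReal.ofReal (Real.exp (t * latticeDev (fun p => a (v p)) η b))
            ∂(ρ' v)) := by
  set I := ∫⁻ z, ENNReal.ofReal (Real.exp (t * |W - η * (√(k * l / (k + l : ℕ)) * z)|)) ∂ν with hI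
  have hm := fun (N : ℕ) (x : Fin N → ℝ) => measurable_latticeDev x η
  have hstep : ∀ u v, ∫⁻ b, ENNReal.ofReal (Real.exp (t *
        latticeDev (fun p => a (Fin.append u v p)) η b))
        ∂((ν.prod ((ρ u).prod (ρ' v))).map (concatBridge k l)) ≤
      I * ((∫⁻ b, ENNReal.ofReal (Real.exp (t * latticeDev (fun p => a (u p)) η b)) ∂(ρ u)) *
          ρ' v univ +
        ρ u univ * ∫⁻ b, ENNReal.ofReal (Real.exp (t * latticeDev (fun p => a (v p)) η b))
          ∂(ρ' v)) := by
    intro u v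
    by_cases h0 : ρ u = 0
    · simp [h0]
    by_cases h0' : ρ' v = 0
    · simp [h0']
    have hWuv := hW u v h0 h0'
    set f : ℝ → ℝ≥0∞ := fun z => ENNReal.ofReal (Real.exp (t *
      |W - η * (√(k * l / (k + l : ℕ)) * z)|)) with hf
    set g : (ℕ → ℝ) → ℝ≥0∞ := fun b =>
      ENNReal.ofReal (Real.exp (t * latticeDev (fun p => a (u p)) η b)) with hg
    set g' : (ℕ → ℝ) → ℝ≥0∞ := fun b =>
      ENNReal.ofReal (Real.exp (t * latticeDev (fun p => a (v p)) η b)) with hg'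
    have hfm : Measurable f := by
      simp only [hf]
      fun_prop
    have hgm : Measurable g := ((hm k _).const_mul t).exp.ennreal_ofReal
    have hgm' : Measurable g' := ((hm l _).const_mul t).exp.ennreal_ofReal
    rw [lintegral_map ((hm _ _).const_mul t).exp.ennreal_ofReal (by fun_prop)]
    calc _ ≤ ∫⁻ p, (f p.1 * (g p.2.1 * 1) + f p.1 * (1 * g' p.2.2))
          ∂(ν.prod ((ρ u).prod (ρ' v))) := by
          refine lintegral_mono fun p => ?_
          rw [mul_one, one_mul, ← mul_add]
          simp only [hf, hg, hg']
          rw [← ENNReal.ofReal_add (Real.exp_pos _).le (Real.exp_pos _).le,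
            ← ENNReal.ofReal_mul (Real.exp_pos _).le]
          refine ENNReal.ofReal_le_ofReal ?_
          have h2 := latticeDev_append_le hk hl (fun p => a (u p)) (fun p => a (v p)) η
            p.1 p.2.1 p.2.2
          rw [← comp_append, hWuv] at h2
          refine (Real.exp_le_exp.2 (mul_le_mul_of_nonneg_left h2 ht)).trans ?_
          rw [mul_add, add_comm, Real.exp_add]
          refine mul_le_mul_of_nonneg_left ?_ (Real.exp_pos _).le
          have e1 := Real.exp_pos (t * latticeDev (fun p => a (u p)) η p.2.1)
          have e2 := Real.exp_pos (t * latticeDev (fun p => a (v p)) η p.2.2)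
          rcases max_cases (latticeDev (fun p => a (u p)) η p.2.1)
            (latticeDev (fun p => a (v p)) η p.2.2) with ⟨h3, _⟩ | ⟨h3, _⟩ <;> rw [h3] <;> linarith
      _ = _ := by
          rw [lintegral_add_left (by fun_prop), lintegral_prod_mul_mul hfm hgm measurable_const,
            lintegral_prod_mul_mul hfm measurable_const hgm', lintegral_const, lintegral_const,
            one_mul, one_mul, ← mul_add]
  refine (ENNReal.tsum_le_tsum fun u => ENNReal.tsum_le_tsum fun v => hstep u v).trans ?_
  simp_rw [ENNReal.tsum_mul_left]
  refine mul_le_mul_right ?_ _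
  simp_rw [ENNReal.tsum_add, ENNReal.tsum_mul_left, ENNReal.tsum_mul_right]
  rw [h1, h1', mul_one, one_mul]

/-- The law of a uniform arrangement of a multiset of `N` values of size `m`, decomposed along a
lattice bridge `γ`: the measure `ρ s` is the law of the bridge on the event that the arrangement
is `s`. -/
structure IsArrangementCoupling {N : ℕ} (m : Fin r → ℕ) (γ : Measure (ℕ → ℝ))
    (ρ : (Fin N → Fin r) → Measure (ℕ → ℝ)) : Prop where
  sum_eq : Measure.sum ρ = γ
  mass_eq : ∀ s, ρ s univ = ENNReal.ofReal (arrangementProb m s)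

lemma IsArrangementCoupling.count_eq {N : ℕ} {m : Fin r → ℕ} {γ : Measure (ℕ → ℝ)}
    {ρ : (Fin N → Fin r) → Measure (ℕ → ℝ)} (h : IsArrangementCoupling m γ ρ) {s : Fin N → Fin r}
    (hs : ρ s ≠ 0) : count s = m := by
  by_contra h1
  refine hs (Measure.measure_univ_eq_zero.1 ?_)
  rw [h.mass_eq, arrangementProb, if_neg h1, ENNReal.ofReal_zero]

/-- Concatenation of couplings of the two blocks along a coupling `ν` of the composition of the
first block with the value of the bridge at `k`. -/
lemma IsArrangementCoupling.concat {k l : ℕ} {m : Fin r → ℕ} (hm : ∑ i, m i = k + l)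
    {ν : (Fin r → ℕ) → Measure ℝ} (hν : Measure.sum ν = stdNormal)
    (hνm : ∀ j, ν j univ = ENNReal.ofReal (multiHypergeom m k j))
    {γ γ' : Measure (ℕ → ℝ)} [IsProbabilityMeasure γ] [IsProbabilityMeasure γ']
    {ρ : (Fin r → ℕ) → (Fin k → Fin r) → Measure (ℕ → ℝ)}
    {ρ' : (Fin r → ℕ) → (Fin l → Fin r) → Measure (ℕ → ℝ)}
    (hρ : ∀ j, Measure.sum (ρ j) = γ) (hρ' : ∀ j, Measure.sum (ρ' j) = γ')
    (h : ∀ j, ∑ i, j i = k → j ≤ m → IsArrangementCoupling j γ (ρ j))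
    (h' : ∀ j, ∑ i, j i = k → j ≤ m → IsArrangementCoupling (m - j) γ' (ρ' j)) :
    IsArrangementCoupling m ((stdNormal.prod (γ.prod γ')).map (concatBridge k l))
      (fun s => Measure.sum fun j => ((ν j).prod ((ρ j fun p => s (Fin.castAdd l p)).prod
        (ρ' j fun p => s (Fin.natAdd k p)))).map (concatBridge k l)) := by
  have hf : ∀ j u, IsFiniteMeasure (ρ j u) := fun j => isFiniteMeasure_of_sum_eq (hρ j)
  have hf' : ∀ j u, IsFiniteMeasure (ρ' j u) := fun j => isFiniteMeasure_of_sum_eq (hρ' j)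
  have hfν : ∀ j, IsFiniteMeasure (ν j) := fun j => isFiniteMeasure_of_sum_eq hν j
  constructor
  · rw [Measure.sum_comm]
    have h1 : ∀ j, Measure.sum (fun s : Fin (k + l) → Fin r =>
        ((ν j).prod ((ρ j fun p => s (Fin.castAdd l p)).prod
        (ρ' j fun p => s (Fin.natAdd k p)))).map (concatBridge k l)) =
        ((ν j).prod (γ.prod γ')).map (concatBridge k l) := fun j => by
      have h2 : Measure.sum (fun s : Fin (k + l) → Fin r =>
          (ρ j fun p => s (Fin.castAdd l p)).prod (ρ' j fun p => s (Fin.natAdd k p))) =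
          γ.prod γ' := by
        rw [← hρ j, ← hρ' j, Measure.prod_sum]
        ext A hA
        rw [Measure.sum_apply _ hA, Measure.sum_apply _ hA, tsum_append, ← ENNReal.tsum_prod]
        simp
      rw [← Measure.map_sum (by fun_prop), ← Measure.prod_sum_right, h2]
    simp_rw [h1]
    rw [← Measure.map_sum (by fun_prop), ← Measure.prod_sum_left, hν]
  · intro s
    rw [Measure.sum_apply _ MeasurableSet.univ]
    have hmass : ∀ j, (((ν j).prod ((ρ j fun p => s (Fin.castAdd l p)).prod
        (ρ' j fun p => s (Fin.natAdd k p)))).map (concatBridge k l)) univ =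
        ν j univ * ((ρ j fun p => s (Fin.castAdd l p)) univ *
          (ρ' j fun p => s (Fin.natAdd k p)) univ) := fun j => by
      rw [Measure.map_apply (by fun_prop) MeasurableSet.univ, preimage_univ, ← univ_prod_univ,
        Measure.prod_prod, ← univ_prod_univ, Measure.prod_prod]
    simp_rw [hmass]
    set u : Fin k → Fin r := fun p => s (Fin.castAdd l p) with hu
    set v : Fin l → Fin r := fun p => s (Fin.natAdd k p) with hv
    have hs : s = Fin.append u v := (Fin.append_castAdd_natAdd (f := s)).symm
    have hnu : ∀ j, ¬ (∑ i, j i = k ∧ j ≤ m) → ν j univ = 0 := fun j hj => by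
      rw [hνm, multiHypergeom_eq_zero hj, ENNReal.ofReal_zero]
    rw [tsum_eq_single (count u) fun j hj => ?_, hs, ← multiHypergeom_mul_arrangementProb hm]
    · rw [hνm]
      by_cases hc : ∑ i, count u i = k ∧ count u ≤ m
      · rw [(h _ hc.1 hc.2).mass_eq, (h' _ hc.1 hc.2).mass_eq,
          ENNReal.ofReal_mul (multiHypergeom_nonneg _ _ _),
          ENNReal.ofReal_mul (arrangementProb_nonneg _ _)]
      · rw [multiHypergeom_eq_zero hc]
        simp
    · by_cases hc : ∑ i, j i = k ∧ j ≤ m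
      · rw [(h _ hc.1 hc.2).mass_eq, arrangementProb, if_neg (Ne.symm hj)]
        simp
      · rw [hnu j hc, zero_mul]

lemma exp_sum_four_le (x y z w : ℝ) : Real.exp (x + y + z + w) ≤
    Real.exp (4 * x) + Real.exp (4 * y) + (Real.exp (4 * z) + Real.exp (4 * w)) := by
  have h2 : ∀ p q : ℝ, Real.exp (p + q) ≤ (Real.exp (2 * p) + Real.exp (2 * q)) / 2 := fun p q => by
    have e1 : Real.exp (p + q) = Real.exp p * Real.exp q := Real.exp_add p q
    have e2 : ∀ w : ℝ, Real.exp (2 * w) = Real.exp w ^ 2 := fun w => by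
      rw [sq, ← Real.exp_add]
      ring_nf
    rw [e1, e2, e2]
    nlinarith [sq_nonneg (Real.exp p - Real.exp q)]
  have e := h2 (x + y) (z + w)
  have e1 := h2 (2 * x) (2 * y)
  have e2 := h2 (2 * z) (2 * w)
  have e3 : ∀ w : ℝ, 2 * (2 * w) = 4 * w := fun w => by ring
  rw [mul_add, mul_add, ← add_assoc] at e
  rw [e3, e3] at e1 e2
  have := Real.exp_pos (4 * x)
  have := Real.exp_pos (4 * y)
  have := Real.exp_pos (4 * z)
  have := Real.exp_pos (4 * w)
  linarith

/-- A sequence of length one is determined by its composition. -/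
lemma isArrangementCoupling_one {m : Fin r → ℕ} (hm : ∑ i, m i = 1) :
    ∃ ρ : (Fin 1 → Fin r) → Measure (ℕ → ℝ), IsArrangementCoupling m (Measure.dirac 0) ρ := by
  obtain ⟨i, hi⟩ : ∃ i, m i ≠ 0 := by
    by_contra! h
    simp [h] at hm
  have hmi : ∀ i', m i' = if i' = i then 1 else 0 := by
    have h1 := Finset.sum_erase_add Finset.univ m (Finset.mem_univ i)
    intro i'
    split_ifs with h
    · subst h
      have := Finset.single_le_sum (f := m) (fun _ _ => Nat.zero_le _) (Finset.mem_univ i')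
      omega
    · have := Finset.single_le_sum (f := m) (fun _ _ => Nat.zero_le _)
        (Finset.mem_erase.2 ⟨h, Finset.mem_univ i'⟩)
      omega
  classical
  refine ⟨fun s => if s = fun _ => i then Measure.dirac 0 else 0, Measure.sum_ite_eq _ _,
    fun s => ?_⟩
  have hcs : count s = m ↔ s = fun _ => i := by
    constructor
    · intro h
      have h1 : count s (s 0) = 1 := by
        unfold count
        rw [Finset.card_filter, Fin.sum_univ_one, if_pos rfl]
      rw [h, hmi] at h1
      funext p
      rw [Subsingleton.elim p 0]
      by_contra h2
      rw [if_neg h2] at h1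
      exact zero_ne_one h1
    · rintro rfl
      funext i'
      rw [hmi]
      unfold count
      rw [Finset.card_filter]
      simp [eq_comm]
  by_cases h : s = fun _ => i
  · have h1 : ∏ i', ((m i').factorial : ℝ) = 1 := Finset.prod_eq_one fun i' _ => by
      rw [hmi]
      split_ifs <;> simp
    simp only [if_pos h]
    rw [arrangementProb, if_pos (hcs.2 h), h1]
    simp
  · simp only [if_neg h]
    rw [arrangementProb, if_neg (fun h1 => h (hcs.1 h1))]
    simp

/-- One dyadic step: the exponential moments of the error at the splitting time and of the energies
of the two blocks are absorbed by the energy of the whole sequence. -/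
lemma tsum_split_le {a : Fin r → ℝ} {m : Fin r → ℕ} {k l : ℕ} {η ν A t K θ c₂ : ℝ} {K₁ K₂ : ℝ≥0∞}
    {μ : (Fin r → ℕ) → Measure ℝ}
    (hν : 0 < ν) (hη : ν ≤ η) (hA : ∀ i, |a i| ≤ A) (hm : ∑ i, m i = k + l)
    (hk : 0 < k) (hl : 0 < l) (hkl : k ≤ 2 * l) (hlk : l ≤ 2 * k)
    (hμ : Measure.sum μ = stdNormal)
    (hμm : ∀ j, μ j univ = ENNReal.ofReal (multiHypergeom m k j))
    (hθ : ∀ t : ℝ, 0 ≤ t → t ≤ θ → ∑' j, ∫⁻ z, ENNReal.ofReal (Real.exp (t * |drawDev a m k j -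
      √(k * ((∑ i, m i : ℕ) - k) / (∑ i, m i : ℕ)) * √(popVar a m) * z|)) ∂(μ j) ≤ K₁)
    (hc₂ : ∀ f : Fin r → ℝ, (f = a ∨ f = fun i => a i ^ 2 - η ^ 2) → ∀ t : ℝ, 0 ≤ t → t ≤ c₂ →
      ∑' j, ENNReal.ofReal (multiHypergeom m k j) *
        ENNReal.ofReal (Real.exp (t * drawDev f m k j ^ 2 / (∑ i, m i : ℕ))) ≤ K₂)
    (hK : 10 * (2 / ν ^ 2 * (1 + A ^ 2)) ≤ K) (ht : 0 ≤ t) (htθ : 4 * t ≤ θ)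
    (htc : 72 * K * t ^ 2 ≤ c₂) {G G' : ℝ} (hG : 0 ≤ G) (hG' : 0 ≤ G') {B : (Fin r → ℕ) → ℝ≥0∞}
    (hB : ∀ j, ∑ i, j i = k → j ≤ m → B j ≤ ENNReal.ofReal (G * Real.exp (K * t ^ 2 * energy a j η))
      + ENNReal.ofReal (G' * Real.exp (K * t ^ 2 * energy a (m - j) η))) :
    ∑' j, (∫⁻ z, ENNReal.ofReal (Real.exp (t * |drawDev a m k j -
        η * (√(k * l / (k + l : ℕ)) * z)|)) ∂(μ j)) * B j ≤
      ENNReal.ofReal ((G + G') * Real.exp (K * t ^ 2 * energy a m η)) *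
        (K₁ + 2 + (K₂ + K₂)) := by
  have hK0 : 0 ≤ K := le_trans (by positivity) hK
  have hNr : ((∑ i, m i : ℕ) : ℝ) = k + l := by rw [hm, Nat.cast_add]
  have hk0 : (0 : ℝ) < k := Nat.cast_pos.2 hk
  have hl0 : (0 : ℝ) < l := Nat.cast_pos.2 hl
  have hσ := Real.sqrt_nonneg (popVar a m)
  set V := energy a m η with hV
  have hV0 : 0 ≤ V := energy_nonneg a m η
  set c := √((k : ℝ) * l / (k + l : ℕ)) with hc
  have hc0 : 0 ≤ c := Real.sqrt_nonneg _
  have hc2 : c ^ 2 ≤ (k + l) / 4 := by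
    rw [hc, Real.sq_sqrt (by positivity), Nat.cast_add, div_le_div_iff₀ (by positivity) (by norm_num)]
    nlinarith [sq_nonneg ((k : ℝ) - l)]
  have hce : √(k * ((∑ i, m i : ℕ) - k : ℝ) / (∑ i, m i : ℕ)) = c := by
    rw [hNr, hc, add_sub_cancel_left, Nat.cast_add]
  rw [hce] at hθ
  set σ := √(popVar a m) with hσdef
  set f₂ : Fin r → ℝ := fun i => a i ^ 2 - η ^ 2 with hf₂
  set q₁ : (Fin r → ℕ) → ℝ := fun j => drawDev a m k j ^ 2 / ((∑ i, m i : ℕ) : ℝ) with hq₁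
  set q₂ : (Fin r → ℕ) → ℝ := fun j => drawDev f₂ m k j ^ 2 / ((∑ i, m i : ℕ) : ℝ) with hq₂
  set E := Real.exp (4 / 5 * (K * t ^ 2 * V)) with hE
  -- Four errors are separated by `exp_sum_four_le`: that of the coupling at the standard deviation
  -- `σ`, the difference between `σ` and `η`, and the two fluctuations of the energy. The second one
  -- is paid for by the part `1 / 5` of the energy that `E` leaves over.
  have hstep : ∀ j, (∫⁻ z, ENNReal.ofReal (Real.exp (t * |drawDev a m k j -
        η * (c * z)|)) ∂(μ j)) * B j ≤
      ENNReal.ofReal ((G + G') * E) *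
        ((∫⁻ z, ENNReal.ofReal (Real.exp ((4 * t) * |drawDev a m k j - c * σ * z|)) ∂(μ j)) +
        (∫⁻ z, ENNReal.ofReal (Real.exp ((4 * t * c * |σ - η|) * |z|)) ∂(μ j)) +
        (ENNReal.ofReal (multiHypergeom m k j) *
          ENNReal.ofReal (Real.exp (72 * K * t ^ 2 * drawDev a m k j ^ 2 / (∑ i, m i : ℕ))) +
        ENNReal.ofReal (multiHypergeom m k j) *
          ENNReal.ofReal (Real.exp (72 * K * t ^ 2 * drawDev f₂ m k j ^ 2 / (∑ i, m i : ℕ))))) := by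
    intro j
    by_cases hj : ∑ i, j i = k ∧ j ≤ m
    swap
    · have : μ j = 0 := Measure.measure_univ_eq_zero.1 (by
        rw [hμm, multiHypergeom_eq_zero hj, ENNReal.ofReal_zero])
      rw [this, lintegral_zero_measure, zero_mul]
      exact zero_le
    have hmj : ∑ i, (m - j) i = l := by
      have : ∑ i, (m - j) i + ∑ i, j i = ∑ i, m i := by
        rw [← Finset.sum_add_distrib]
        exact Finset.sum_congr rfl fun i _ => Nat.sub_add_cancel (hj.2 i)
      omega
    have hNN : ((∑ i, m i : ℕ) : ℝ) = ((k + l : ℕ) : ℝ) := by rw [hm]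
    have e1 : energy a j η ≤ 4 / 5 * V + 18 * q₁ j + 18 * q₂ j := by
      have h1 := sum_mul_eq_drawDev a m j k
      have h2 := sum_mul_eq_drawDev f₂ m j k
      rw [hNN] at h1 h2
      have := energy_le_of_eq hm hj.1 hk (by omega) (by omega) h1 h2
      simpa only [hq₁, hq₂, hNN] using this
    have e2 : energy a (m - j) η ≤ 4 / 5 * V + 18 * q₁ j + 18 * q₂ j := by
      have h1 := sum_sub_mul_eq_drawDev a hj.2 hl hm
      have h2 := sum_sub_mul_eq_drawDev f₂ hj.2 hl hm
      rw [hNN, sub_eq_add_neg] at h1 h2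
      have := energy_le_of_eq hm hmj hl (by omega) (by omega) h1 h2
      simpa only [hq₁, hq₂, hNN, neg_sq] using this
    have hKt : 0 ≤ K * t ^ 2 := by positivity
    have hBj : B j ≤ ENNReal.ofReal ((G + G') * E *
        Real.exp (18 * K * t ^ 2 * q₁ j + 18 * K * t ^ 2 * q₂ j)) := by
      refine (hB j hj.1 hj.2).trans ?_
      rw [← ENNReal.ofReal_add (by positivity) (by positivity)]
      refine ENNReal.ofReal_le_ofReal ?_
      rw [mul_assoc (G + G') E, hE, ← Real.exp_add, add_mul]
      refine add_le_add (mul_le_mul_of_nonneg_left (Real.exp_le_exp.2 ?_) hG)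
        (mul_le_mul_of_nonneg_left (Real.exp_le_exp.2 ?_) hG')
      · nlinarith [mul_le_mul_of_nonneg_left e1 hKt]
      · nlinarith [mul_le_mul_of_nonneg_left e2 hKt]
    refine (mul_le_mul_right hBj _).trans ?_
    rw [mul_comm, ENNReal.ofReal_mul (by positivity), mul_assoc]
    refine mul_le_mul_right ?_ _
    rw [← lintegral_const_mul _ (by fun_prop), ← hμm, mul_comm (μ j univ), mul_comm (μ j univ),
      ← lintegral_const, ← lintegral_const, ← lintegral_add_left (by fun_prop),
      ← lintegral_add_left (by fun_prop), ← lintegral_add_left (by fun_prop)]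
    refine lintegral_mono fun z => ?_
    rw [← ENNReal.ofReal_mul (Real.exp_pos _).le,
      ← ENNReal.ofReal_add (Real.exp_pos _).le (Real.exp_pos _).le,
      ← ENNReal.ofReal_add (Real.exp_pos _).le (Real.exp_pos _).le,
      ← ENNReal.ofReal_add (by positivity) (by positivity)]
    refine ENNReal.ofReal_le_ofReal ?_
    rw [← Real.exp_add]
    have e3 : |drawDev a m k j - η * (c * z)| ≤ |drawDev a m k j - c * σ * z| +
        c * |σ - η| * |z| := by
      have : drawDev a m k j - η * (c * z) = (drawDev a m k j - c * σ * z) + c * (σ - η) * z := by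
        ring
      rw [this]
      refine (abs_add_le _ _).trans (le_of_eq ?_)
      rw [abs_mul, abs_mul, abs_of_nonneg hc0]
    have e4 := exp_sum_four_le (t * |drawDev a m k j - c * σ * z|) (t * (c * |σ - η| * |z|))
      (18 * K * t ^ 2 * q₁ j) (18 * K * t ^ 2 * q₂ j)
    refine le_trans (Real.exp_le_exp.2 ?_) (e4.trans (le_of_eq ?_))
    · nlinarith [mul_le_mul_of_nonneg_left e3 ht]
    · simp only [hq₁, hq₂]
      congr 1
      · congr 2 <;> ring
      · congr 2 <;> ring
  refine (ENNReal.tsum_le_tsum hstep).trans ?_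
  rw [ENNReal.tsum_mul_left, ENNReal.tsum_add, ENNReal.tsum_add, ENNReal.tsum_add,
    ← lintegral_sum_measure _ μ, hμ]
  set F := Real.exp (1 / 5 * (K * t ^ 2 * V)) with hF
  have hF1 : (1 : ℝ≥0∞) ≤ ENNReal.ofReal F := by
    rw [← ENNReal.ofReal_one]
    exact ENNReal.ofReal_le_ofReal (Real.one_le_exp (by positivity))
  have hgauss : ∫⁻ z, ENNReal.ofReal (Real.exp ((4 * t * c * |σ - η|) * |z|)) ∂stdNormal ≤
      ENNReal.ofReal F * 2 := by
    refine (lintegral_exp_mul_abs_stdNormal_le _).trans ?_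
    rw [mul_comm 2, ENNReal.ofReal_mul (Real.exp_pos _).le, ENNReal.ofReal_ofNat]
    refine mul_le_mul_left (ENNReal.ofReal_le_ofReal (Real.exp_le_exp.2 ?_)) 2
    have h1 := mul_sq_sqrt_popVar_sub_le hν hη hA (m := m) (by omega)
    rw [hNr, ← hσdef, ← hV] at h1
    have h2 : c ^ 2 * (σ - η) ^ 2 ≤ (k + l) / 4 * (σ - η) ^ 2 :=
      mul_le_mul_of_nonneg_right hc2 (sq_nonneg _)
    have h3 : 10 * (2 / ν ^ 2 * (1 + A ^ 2)) * V ≤ K * V := mul_le_mul_of_nonneg_right hK hV0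
    have h4 : c ^ 2 * (σ - η) ^ 2 ≤ K * V / 40 := by linarith
    have h5 := mul_le_mul_of_nonneg_left h4 (sq_nonneg t)
    rw [mul_pow, mul_pow, mul_pow, sq_abs]
    linarith
  have hone : ∀ x : ℝ≥0∞, x ≤ ENNReal.ofReal F * x := fun x => le_mul_of_one_le_left zero_le hF1
  have hKt : 0 ≤ 72 * K * t ^ 2 := by positivity
  calc _ ≤ ENNReal.ofReal ((G + G') * E) *
        (ENNReal.ofReal F * K₁ + ENNReal.ofReal F * 2 +
          (ENNReal.ofReal F * K₂ + ENNReal.ofReal F * K₂)) := by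
        refine mul_le_mul_right (add_le_add (add_le_add ?_ hgauss) (add_le_add ?_ ?_)) _
        · exact (hθ _ (by positivity) htθ).trans (hone _)
        · exact (hc₂ a (Or.inl rfl) _ hKt htc).trans (hone _)
        · exact (hc₂ f₂ (Or.inr rfl) _ hKt htc).trans (hone _)
    _ = _ := by
        rw [← mul_add, ← mul_add, ← mul_add, ← mul_assoc, ← ENNReal.ofReal_mul (by positivity),
          mul_assoc _ E F, hE, hF, ← Real.exp_add]
        congr 4
        ring

/-- Exchangeable sequences with a prescribed composition are coupled with one and the same lattice
bridge, at every scale `η ≥ ν`. -/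
theorem exists_lattice_coupling (a : Fin r → ℝ) {ν : ℝ} (hν : 0 < ν) :
    ∃ K lam₀ C : ℝ, 0 < K ∧ 0 < lam₀ ∧ 0 < C ∧ ∀ N : ℕ, 1 ≤ N → ∃ γ : Measure (ℕ → ℝ),
      IsLatticeBridge N γ ∧ ∀ η : ℝ, ν ≤ η → ∀ m : Fin r → ℕ, ∑ i, m i = N →
      ∃ ρ : (Fin N → Fin r) → Measure (ℕ → ℝ), IsArrangementCoupling m γ ρ ∧
        ∀ t : ℝ, 0 ≤ t → t ≤ lam₀ →
          ∑' s, ∫⁻ b, ENNReal.ofReal (Real.exp (t * latticeDev (fun p => a (s p)) η b)) ∂(ρ s) ≤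
            ENNReal.ofReal ((N : ℝ) ^ C * Real.exp (K * t ^ 2 * energy a m η)) := by
  set A := ∑ i, |a i| with hA
  have hAi : ∀ i, |a i| ≤ A := fun i =>
    Finset.single_le_sum (f := fun i => |a i|) (fun _ _ => abs_nonneg _) (Finset.mem_univ i)
  have hA0 : 0 ≤ A := Finset.sum_nonneg fun _ _ => abs_nonneg _
  set M := 2 * A + 2 * A ^ 2 with hM
  have hMa : ∀ i i', |a i - a i'| ≤ M := fun i i' =>
    (abs_sub _ _).trans (by nlinarith [hAi i, hAi i'])
  have hMa2 : ∀ η i i', |(a i ^ 2 - η ^ 2) - (a i' ^ 2 - η ^ 2)| ≤ M := fun η i i' => by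
    have h : ∀ i, a i ^ 2 ≤ A ^ 2 := fun i => by
      rw [← sq_abs]
      exact pow_le_pow_left₀ (abs_nonneg _) (hAi i) 2
    rw [sub_sub_sub_cancel_right, abs_le]
    constructor <;> nlinarith [h i, h i', sq_nonneg (a i), sq_nonneg (a i')]
  obtain ⟨θ, hθ, K₁, hK₁, h₁⟩ := exists_multiHypergeom_coupling r M (by positivity)
  obtain ⟨c₂, hc₂, K₂, hK₂, h₂⟩ := tsum_multiHypergeom_exp_sq_le r M
  set K := 10 * (2 / ν ^ 2 * (1 + A ^ 2)) with hK
  have hK0 : 0 < K := by positivity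
  set D : ℝ≥0∞ := K₁ + 2 + (K₂ + K₂) with hD
  have hDtop : D ≠ ⊤ := by simp [hD, hK₁, hK₂]
  have hD2 : 2 ≤ D.toReal := by
    have : (2 : ℝ≥0∞) ≤ D := le_add_self.trans le_self_add
    simpa using ENNReal.toReal_mono hDtop this
  have hlog : 0 < Real.log (3 / 2) := Real.log_pos (by norm_num)
  -- A step multiplies the sum of the bounds of the two blocks by `D`. As the blocks have lengths at
  -- most `2 N / 3`, the power `N ^ C` absorbs this factor if `(3 / 2) ^ C = 2 D`.
  set C := Real.log (2 * D.toReal) / Real.log (3 / 2) with hC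
  have hC0 : 0 < C := div_pos (Real.log_pos (by linarith)) hlog
  have hCpow : ((3 : ℝ) / 2) ^ C = 2 * D.toReal := by
    rw [Real.rpow_def_of_pos (by norm_num), hC, mul_div_cancel₀ _ hlog.ne',
      Real.exp_log (by linarith)]
  refine ⟨K, min (θ / 4) (min 1 (c₂ / (72 * K))), C, hK0, by positivity, hC0, fun N => ?_⟩
  induction N using Nat.strong_induction_on with
  | _ N ih =>
  intro hN
  rcases Nat.lt_or_ge 1 N with hN1 | hN1
  swap
  · obtain rfl : N = 1 := le_antisymm hN1 hN
    refine ⟨Measure.dirac 0, isLatticeBridge_one, fun η hη m hm => ?_⟩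
    obtain ⟨ρ, hρ⟩ := isArrangementCoupling_one hm
    refine ⟨ρ, hρ, fun t ht _ => ?_⟩
    have h0 : ∀ x : Fin 1 → ℝ, latticeDev x η 0 = 0 := fun x => by
      refine le_antisymm (latticeDev_le fun i hi => ?_)
        ((abs_nonneg _).trans (le_latticeDev x η 0 (Nat.zero_le 1)))
      interval_cases i <;> simp [bridgeSum, partialSum]
    have hle : ∀ s : Fin 1 → Fin r, ∫⁻ b, ENNReal.ofReal (Real.exp (t *
        latticeDev (fun p => a (s p)) η b)) ∂(ρ s) ≤ ρ s univ := fun s => by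
      have h1 : ρ s ≤ Measure.dirac 0 := hρ.sum_eq ▸ Measure.le_sum ρ s
      rw [← lintegral_one]
      refine le_of_eq (lintegral_congr_ae ?_)
      have h2 : ∀ᵐ b ∂(Measure.dirac (0 : ℕ → ℝ)), ENNReal.ofReal (Real.exp (t *
          latticeDev (fun p => a (s p)) η b)) = 1 := by
        rw [ae_dirac_eq, Filter.eventually_pure, h0, mul_zero, Real.exp_zero, ENNReal.ofReal_one]
      exact h1.absolutelyContinuous.ae_le h2
    refine (ENNReal.tsum_le_tsum hle).trans ?_
    rw [tsum_measure_univ_eq_one hρ.sum_eq, ← ENNReal.ofReal_one]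
    refine ENNReal.ofReal_le_ofReal ?_
    rw [Nat.cast_one, Real.one_rpow, one_mul]
    exact Real.one_le_exp (mul_nonneg (by positivity) (energy_nonneg _ _ _))
  · obtain ⟨k, l, hNkl, hk, hl, hkl, hlk⟩ : ∃ k l : ℕ, N = k + l ∧ 0 < k ∧ 0 < l ∧ k ≤ 2 * l ∧
        l ≤ 2 * k := ⟨N / 2, N - N / 2, by omega, by omega, by omega, by omega, by omega⟩
    subst hNkl
    obtain ⟨γ, hγ, ihk⟩ := ih k (by omega) hk
    obtain ⟨γ', hγ', ihl⟩ := ih l (by omega) hl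
    have := HasGaussianKernel.isProbabilityMeasure hγ
    have := HasGaussianKernel.isProbabilityMeasure hγ'
    refine ⟨_, hγ.concat hk hl hγ', fun η hη m hm => ?_⟩
    obtain ⟨μ, hμ, hμm, hμt⟩ := h₁ a hMa m k (by omega)
    obtain ⟨i₀, -⟩ : ∃ i, m i ≠ 0 := by
      by_contra! h
      simp only [h, Finset.sum_const_zero] at hm
      omega
    classical
    -- couplings of the blocks; for compositions of the wrong size `ρ` is a default value
    have hex : ∀ j : Fin r → ℕ, ∃ ρ : (Fin k → Fin r) → Measure (ℕ → ℝ),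
        Measure.sum ρ = γ ∧ (∑ i, j i = k → IsArrangementCoupling j γ ρ ∧
          ∀ t : ℝ, 0 ≤ t → t ≤ min (θ / 4) (min 1 (c₂ / (72 * K))) →
            ∑' s, ∫⁻ b, ENNReal.ofReal (Real.exp (t * latticeDev (fun p => a (s p)) η b)) ∂(ρ s) ≤
              ENNReal.ofReal ((k : ℝ) ^ C * Real.exp (K * t ^ 2 * energy a j η))) := by
      intro j
      by_cases hj : ∑ i, j i = k
      · obtain ⟨ρ, h1, h2⟩ := ihk η hη j hj
        exact ⟨ρ, h1.sum_eq, fun _ => ⟨h1, h2⟩⟩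
      · exact ⟨fun s => if s = fun _ => i₀ then γ else 0, Measure.sum_ite_eq _ _,
          fun h => absurd h hj⟩
    have hex' : ∀ j : Fin r → ℕ, ∃ ρ : (Fin l → Fin r) → Measure (ℕ → ℝ),
        Measure.sum ρ = γ' ∧ (∑ i, j i = l → IsArrangementCoupling j γ' ρ ∧
          ∀ t : ℝ, 0 ≤ t → t ≤ min (θ / 4) (min 1 (c₂ / (72 * K))) →
            ∑' s, ∫⁻ b, ENNReal.ofReal (Real.exp (t * latticeDev (fun p => a (s p)) η b)) ∂(ρ s) ≤
              ENNReal.ofReal ((l : ℝ) ^ C * Real.exp (K * t ^ 2 * energy a j η))) := by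
      intro j
      by_cases hj : ∑ i, j i = l
      · obtain ⟨ρ, h1, h2⟩ := ihl η hη j hj
        exact ⟨ρ, h1.sum_eq, fun _ => ⟨h1, h2⟩⟩
      · exact ⟨fun s => if s = fun _ => i₀ then γ' else 0, Measure.sum_ite_eq _ _,
          fun h => absurd h hj⟩
    choose ρ hρs hρ using hex
    choose ρ' hρ's hρ' using hex'
    have hsub : ∀ j : Fin r → ℕ, ∑ i, j i = k → j ≤ m → ∑ i, (m - j) i = l := by
      intro j hj hjm
      have : ∑ i, (m - j) i + ∑ i, j i = ∑ i, m i := by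
        rw [← Finset.sum_add_distrib]
        exact Finset.sum_congr rfl fun i _ => Nat.sub_add_cancel (hjm i)
      omega
    refine ⟨_, IsArrangementCoupling.concat hm hμ hμm hρs (fun j => hρ's (m - j))
      (fun j hj _ => (hρ j hj).1) (fun j hj hjm => (hρ' _ (hsub j hj hjm)).1), fun t ht ht0 => ?_⟩
    have hfin : ∀ j u, IsFiniteMeasure (ρ j u) := fun j => isFiniteMeasure_of_sum_eq (hρs j)
    have hfin' : ∀ j u, IsFiniteMeasure (ρ' j u) := fun j => isFiniteMeasure_of_sum_eq (hρ's j)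
    have hfinμ : ∀ j, IsFiniteMeasure (μ j) := fun j => isFiniteMeasure_of_sum_eq hμ j
    simp_rw [lintegral_sum_measure]
    rw [ENNReal.tsum_comm]
    simp_rw [tsum_append]
    simp only [Fin.append_left, Fin.append_right]
    have htK : 72 * K * t ^ 2 ≤ c₂ := by
      have h3 : t ≤ 1 := ht0.trans ((min_le_right _ _).trans (min_le_left _ _))
      have h4 : t ≤ c₂ / (72 * K) := ht0.trans ((min_le_right _ _).trans (min_le_right _ _))
      rw [le_div_iff₀ (by positivity)] at h4
      nlinarith
    have hnode : ∀ j, ∑' u, ∑' v, ∫⁻ b, ENNReal.ofReal (Real.exp (t *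
        latticeDev (fun p => a (Fin.append u v p)) η b))
        ∂(((μ j).prod ((ρ j u).prod (ρ' (m - j) v))).map (concatBridge k l)) ≤
        (∫⁻ z, ENNReal.ofReal (Real.exp (t * |drawDev a m k j -
          η * (√(k * l / (k + l : ℕ)) * z)|)) ∂(μ j)) *
        ((∑' u, ∫⁻ b, ENNReal.ofReal (Real.exp (t * latticeDev (fun p => a (u p)) η b)) ∂(ρ j u)) +
          ∑' v, ∫⁻ b, ENNReal.ofReal (Real.exp (t * latticeDev (fun p => a (v p)) η b))
            ∂(ρ' (m - j) v)) := by
      intro j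
      by_cases hj : ∑ i, j i = k ∧ j ≤ m
      swap
      · have : μ j = 0 := Measure.measure_univ_eq_zero.1 (by
          rw [hμm, multiHypergeom_eq_zero hj, ENNReal.ofReal_zero])
        simp [this]
      refine tsum_lintegral_concat_le hk hl (tsum_measure_univ_eq_one (hρs j))
        (tsum_measure_univ_eq_one (hρ's _)) (fun u v hu hv => ?_) ht
      have hcu := (hρ j hj.1).1.count_eq hu
      have hcv := (hρ' _ (hsub j hj.1 hj.2)).1.count_eq hv
      rw [bridgeSum_append_eq_drawDev (m := m), hcu]
      rw [count_append, hcu, hcv, add_tsub_cancel_of_le hj.2]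
    refine (ENNReal.tsum_le_tsum hnode).trans ((tsum_split_le (K := K) (K₂ := K₂) hν hη hAi hm hk
      hl hkl hlk hμ hμm
      hμt ?_ le_rfl ht (by linarith [ht0.trans (min_le_left _ _)]) htK
      (Real.rpow_nonneg k.cast_nonneg C) (Real.rpow_nonneg l.cast_nonneg C)
      fun j hj hjm => add_le_add ((hρ j hj).2 t ht ht0)
        ((hρ' _ (hsub j hj hjm)).2 t ht ht0)).trans ?_)
    · rintro f (rfl | rfl) t ht htc
      · exact h₂ _ hMa m k (by omega) t ht htc
      · exact h₂ _ (hMa2 η) m k (by omega) t ht htc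
    · rw [← hD, ← ENNReal.ofReal_toReal hDtop, ← ENNReal.ofReal_mul (by positivity)]
      refine ENNReal.ofReal_le_ofReal ?_
      have hpow : ∀ i : ℕ, 3 * i ≤ 2 * (k + l) →
          2 * D.toReal * (i : ℝ) ^ C ≤ ((k + l : ℕ) : ℝ) ^ C := fun i hi => by
        rw [← hCpow, ← Real.mul_rpow (by norm_num) i.cast_nonneg]
        refine Real.rpow_le_rpow (by positivity) ?_ hC0.le
        have : (3 : ℝ) * i ≤ 2 * (k + l : ℕ) := by exact_mod_cast hi
        linarith
      have h3 := hpow k (by omega)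
      have h4 := hpow l (by omega)
      have h5 := Real.exp_pos (K * t ^ 2 * energy a m η)
      calc _ = ((2 * D.toReal * (k : ℝ) ^ C + 2 * D.toReal * (l : ℝ) ^ C) / 2) *
            Real.exp (K * t ^ 2 * energy a m η) := by ring
        _ ≤ _ := mul_le_mul_of_nonneg_right (by linarith) h5.le

end

/-! ### Limits of Gaussian processes -/

/-- The family of centred normal laws is closed under almost sure convergence of variables. -/
lemma map_eq_gaussianReal_of_tendsto {Ω : Type*} [MeasurableSpace Ω] {P : Measure Ω}
    [IsProbabilityMeasure P] {Z : ℕ → Ω → ℝ} {Y : Ω → ℝ} {v : ℕ → NNReal} {v' : NNReal}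
    (hZ : ∀ n, AEMeasurable (Z n) P) (hlaw : ∀ n, P.map (Z n) = gaussianReal 0 (v n))
    (hlim : ∀ᵐ ω ∂P, Tendsto (fun n => Z n ω) atTop (𝓝 (Y ω))) (hv : Tendsto v atTop (𝓝 v')) :
    P.map Y = gaussianReal 0 v' := by
  have hY : AEMeasurable Y P := aemeasurable_of_tendsto_metrizable_ae atTop hZ hlim
  have := Measure.isProbabilityMeasure_map (μ := P) hY
  refine Measure.ext_of_charFun (funext fun t => ?_)
  have h1 : ∀ W : Ω → ℝ, AEMeasurable W P →
      charFun (P.map W) t = ∫ ω, Complex.exp (t * W ω * Complex.I) ∂P := fun W hW => by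
    rw [charFun_apply_real, integral_map hW (by fun_prop)]
  rw [h1 Y hY]
  refine tendsto_nhds_unique (tendsto_integral_of_dominated_convergence
    (F := fun n ω => Complex.exp (t * Z n ω * Complex.I)) (fun _ => 1) (fun n => ?_)
    (integrable_const 1) (fun n => ae_of_all _ fun ω => ?_) ?_) ?_
  · have := hZ n
    fun_prop
  · rw [← Complex.ofReal_mul, Complex.norm_exp_ofReal_mul_I]
  · filter_upwards [hlim] with ω hω
    have h2 : Continuous fun x : ℝ => Complex.exp (t * x * Complex.I) := by fun_prop
    exact (h2.tendsto _).comp hω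
  · have h2 : ∀ n, ∫ ω, Complex.exp (t * Z n ω * Complex.I) ∂P =
        Complex.exp (t * (0 : ℝ) * Complex.I - ((v n : ℝ) : ℂ) * t ^ 2 / 2) := fun n => by
      rw [← h1 _ (hZ n), hlaw, charFun_gaussianReal]
    simp_rw [h2, charFun_gaussianReal]
    have h3 : Continuous fun x : ℝ => Complex.exp (t * (0 : ℝ) * Complex.I - (x : ℂ) * t ^ 2 / 2) := by
      fun_prop
    exact (h3.tendsto _).comp ((NNReal.continuous_coe.tendsto _).comp hv)

namespace HasGaussianKernel

variable {T Ω : Type*} [MeasurableSpace Ω] {R : T → T → ℝ} {P : Measure Ω}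

lemma map_eq {X : T → Ω → ℝ} (h : HasGaussianKernel X R P) (t : T) :
    P.map (X t) = gaussianReal 0 (R t t).toNNReal := by
  rw [(h.isGaussian.hasGaussianLaw_eval t).map_eq_gaussianReal, h.mean_eq_zero,
    ← covariance_self (h.isGaussian.aemeasurable t), h.covariance_eq]

lemma map_sum_eq_of_tendsto {X : ℕ → T → Ω → ℝ} {R : ℕ → T → T → ℝ} {Y : T → Ω → ℝ}
    {S : T → T → ℝ} (h : ∀ n, HasGaussianKernel (X n) (R n) P)
    (hlim : ∀ t, ∀ᵐ ω ∂P, Tendsto (fun n => X n t ω) atTop (𝓝 (Y t ω)))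
    (hR : ∀ s t, Tendsto (fun n => R n s t) atTop (𝓝 (S s t))) {ι : Type*} [Fintype ι] (w : ι → ℝ)
    (f : ι → T) : P.map (fun ω => ∑ i, w i * Y (f i) ω) =
      gaussianReal 0 (∑ i, ∑ j, w i * w j * S (f i) (f j)).toNNReal := by
  have := (h 0).isProbabilityMeasure
  have h1 := fun n => (h n).linear (S := Unit) (fun _ => w) (fun _ => f)
  refine map_eq_gaussianReal_of_tendsto (Z := fun n ω => ∑ i, w i * X n (f i) ω)
    (fun n => (h1 n).isGaussian.aemeasurable ()) (fun n => (h1 n).map_eq ()) ?_ ?_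
  · filter_upwards [ae_all_iff.2 fun i => hlim (f i)] with ω hω
    exact tendsto_finsetSum _ fun i _ => (hω i).const_mul _
  · refine (continuous_real_toNNReal.tendsto _).comp ?_
    exact tendsto_finsetSum _ fun i _ => tendsto_finsetSum _ fun j _ => (hR _ _).const_mul _

/-- Almost sure limits of centred Gaussian processes with convergent kernels are Gaussian. -/
lemma of_tendsto {X : ℕ → T → Ω → ℝ} {R : ℕ → T → T → ℝ} {Y : T → Ω → ℝ} {S : T → T → ℝ}
    (h : ∀ n, HasGaussianKernel (X n) (R n) P)
    (hlim : ∀ t, ∀ᵐ ω ∂P, Tendsto (fun n => X n t ω) atTop (𝓝 (Y t ω)))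
    (hR : ∀ s t, Tendsto (fun n => R n s t) atTop (𝓝 (S s t))) : HasGaussianKernel Y S P := by
  have := (h 0).isProbabilityMeasure
  have hXm : ∀ n t, AEMeasurable (X n t) P := fun n t => (h n).isGaussian.aemeasurable t
  have hYm : ∀ t, AEMeasurable (Y t) P := fun t =>
    aemeasurable_of_tendsto_metrizable_ae atTop (fun n => hXm n t) (hlim t)
  have hvar : ∀ s t (u w : ℝ), P.map (fun ω => u * Y s ω + w * Y t ω) = gaussianReal 0
      (u * u * S s s + u * w * S s t + (w * u * S t s + w * w * S t t)).toNNReal := fun s t u w => by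
    have h1 := map_sum_eq_of_tendsto h hlim hR (fun b : Bool => if b then u else w)
      (fun b => if b then s else t)
    simpa only [Fintype.sum_bool, if_true, Bool.false_eq_true, if_false] using h1
  have hS : ∀ s t, S s t = S t s := fun s t =>
    tendsto_nhds_unique (hR s t) (by
      simpa only [← (h _).covariance_eq s t, ← (h _).covariance_eq t s, covariance_comm] using hR t s)
  have hS2 : ∀ s t (u w : ℝ),
      0 ≤ u * u * S s s + u * w * S s t + (w * u * S t s + w * w * S t t) := fun s t u w => by
    have hn : ∀ n, 0 ≤ u * u * R n s s + u * w * R n s t + (w * u * R n t s + w * w * R n t t) :=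
      fun n => by
        have h1 := (h n).linear (S := Unit) (fun _ b => if b then u else w)
          (fun _ (b : Bool) => if b then s else t)
        have h2 := h1.covariance_eq () ()
        rw [covariance_self (h1.isGaussian.aemeasurable ())] at h2
        simp only [Fintype.sum_bool, if_true, Bool.false_eq_true, if_false] at h2
        rw [← h2]
        exact variance_nonneg _ _
    exact ge_of_tendsto' ((((hR s s).const_mul _).add ((hR s t).const_mul _)).add
      (((hR t s).const_mul _).add ((hR t t).const_mul _))) hn
  have hg : ∀ t, P.map (Y t) = gaussianReal 0 (S t t).toNNReal := fun t => by
    simpa using hvar t t 1 0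
  have hgl : ∀ t, HasGaussianLaw (Y t) P := fun t => ⟨by rw [hg t]; infer_instance⟩
  have hmean : ∀ t, P[Y t] = 0 := fun t => by
    rw [← integral_map (f := fun x : ℝ => x) (hYm t) (by fun_prop), hg t]
    exact integral_id_gaussianReal
  refine ⟨⟨fun I => ⟨isGaussian_of_map_eq_gaussianReal fun L => ?_⟩⟩, hmean, fun s t => ?_⟩
  · classical
    have hm : AEMeasurable (fun ω => I.restrict (Y · ω)) P := aemeasurable_pi_lambda _ fun i => hYm i
    refine ⟨0, _, (AEMeasurable.map_map_of_aemeasurable (by fun_prop) hm).trans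
      (Eq.trans ?_ (map_sum_eq_of_tendsto h hlim hR
        (fun i : I => L fun j => if i = j then 1 else 0) fun i => i))⟩
    congr 1
    funext ω
    rw [Function.comp_apply, ← ContinuousLinearMap.coe_coe, LinearMap.pi_apply_eq_sum_univ]
    exact Finset.sum_congr rfl fun i _ => mul_comm _ _
  · have h2 : ∀ t, MemLp (Y t) 2 P := fun t => (hgl t).memLp_two
    have hV : ∀ (Z : Ω → ℝ) (v : ℝ), 0 ≤ v → AEMeasurable Z P →
        P.map Z = gaussianReal 0 v.toNNReal → Var[Z; P] = v := by
      intro Z v hv hZ hl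
      have h3 := variance_map (X := fun x : ℝ => x) (μ := P) (Y := Z) (by fun_prop) hZ
      rw [hl, variance_fun_id_gaussianReal, Real.coe_toNNReal _ hv] at h3
      exact h3.symm
    have e1 := hV _ _ (hS2 s t 1 1) (by fun_prop) (hvar s t 1 1)
    have e2 := hV _ _ (hS2 s t 1 0) (by fun_prop) (hvar s t 1 0)
    have e3 := hV _ _ (hS2 s t 0 1) (by fun_prop) (hvar s t 0 1)
    simp only [one_mul, zero_mul, add_zero, zero_add, mul_zero, mul_one] at e1 e2 e3
    have e4 := variance_fun_add (h2 s) (h2 t)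
    rw [e1, e2, e3, hS t s] at e4
    linarith

end HasGaussianKernel

/-! ### Lévy's construction of the Brownian bridge -/

/-- The tent function on `[0, 1]`. -/
noncomputable def tent (x : ℝ) : ℝ := max 0 (min x (1 - x))

@[fun_prop]
lemma continuous_tent : Continuous tent := by
  unfold tent
  fun_prop

lemma tent_nonneg (x : ℝ) : 0 ≤ tent x := le_max_left _ _

lemma tent_le_one (x : ℝ) : tent x ≤ 1 := by
  refine max_le zero_le_one ?_
  rcases le_total x 1 with h | h
  · exact (min_le_left _ _).trans h
  · exact (min_le_right _ _).trans (by linarith)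

lemma tent_eq_zero {x : ℝ} (h : x ≤ 0 ∨ 1 ≤ x) : tent x = 0 := by
  refine max_eq_left ?_
  rcases h with h | h
  · exact (min_le_left _ _).trans h
  · exact (min_le_right _ _).trans (by linarith)

/-- A function supported on the unit interval has at most one nonzero integer translate at each
point. -/
lemma sum_translates_le {f : ℝ → ℝ} {x c : ℝ} (hc : 0 ≤ c) (hf : ∀ y, f y ≤ c)
    (hf0 : ∀ y, y ≤ 0 ∨ 1 ≤ y → f y = 0) (n : ℕ) : ∑ k ∈ Finset.range n, f (x - k) ≤ c := by
  calc _ ≤ ∑ k ∈ Finset.range n, if k = ⌊x⌋₊ then c else 0 := by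
        refine Finset.sum_le_sum fun k _ => ?_
        split_ifs with h
        · exact hf _
        · refine (hf0 _ ?_).le
          by_contra! h1
          have hk : (0 : ℝ) ≤ k := Nat.cast_nonneg k
          exact h ((Nat.floor_eq_iff (by linarith)).2 ⟨by linarith, by linarith⟩).symm
    _ ≤ c := by
        rw [Finset.sum_ite_eq']
        split_ifs <;> simp [hc]

/-- The covariance function of the Brownian bridge, extended by zero outside of the unit square. -/
noncomputable def bridgeKernel (x y : ℝ) : ℝ :=
  min (max 0 (min 1 x)) (max 0 (min 1 y)) - max 0 (min 1 x) * max 0 (min 1 y)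

lemma bridgeKernel_comm (x y : ℝ) : bridgeKernel x y = bridgeKernel y x := by
  unfold bridgeKernel
  rw [min_comm, mul_comm]

/-- Splitting a Brownian bridge at time `1 / 2`, on the level of covariances. -/
lemma bridgeKernel_eq (x y : ℝ) : bridgeKernel x y = tent x * tent y +
    (bridgeKernel (2 * x) (2 * y) + bridgeKernel (2 * x - 1) (2 * y - 1)) / 2 := by
  wlog hxy : x ≤ y
  · rw [bridgeKernel_comm x, bridgeKernel_comm (2 * x), bridgeKernel_comm (2 * x - 1),
      this y x (le_of_not_ge hxy), mul_comm (tent y)]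
  have hb : ∀ x y, x ≤ y → bridgeKernel x y = max 0 (min 1 x) * (1 - max 0 (min 1 y)) :=
    fun x y h => by
      rw [bridgeKernel, min_eq_left (max_le_max le_rfl (min_le_min le_rfl h))]
      ring
  have hreg : ∀ z : ℝ,
      (z ≤ 0 ∧ max 0 (min 1 z) = 0 ∧ tent z = 0 ∧ max 0 (min 1 (2 * z)) = 0 ∧
        max 0 (min 1 (2 * z - 1)) = 0) ∨
      (0 < z ∧ z ≤ 1 / 2 ∧ max 0 (min 1 z) = z ∧ tent z = z ∧ max 0 (min 1 (2 * z)) = 2 * z ∧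
        max 0 (min 1 (2 * z - 1)) = 0) ∨
      (1 / 2 < z ∧ z ≤ 1 ∧ max 0 (min 1 z) = z ∧ tent z = 1 - z ∧ max 0 (min 1 (2 * z)) = 1 ∧
        max 0 (min 1 (2 * z - 1)) = 2 * z - 1) ∨
      (1 < z ∧ max 0 (min 1 z) = 1 ∧ tent z = 0 ∧ max 0 (min 1 (2 * z)) = 1 ∧
        max 0 (min 1 (2 * z - 1)) = 1) := by
    intro z
    have hlo : ∀ w : ℝ, w ≤ 0 → max 0 (min 1 w) = 0 := fun w h =>
      max_eq_left ((min_le_right _ _).trans h)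
    have hmid : ∀ w : ℝ, 0 ≤ w → w ≤ 1 → max 0 (min 1 w) = w := fun w h h' => by
      rw [min_eq_right h', max_eq_right h]
    have hhi : ∀ w : ℝ, 1 ≤ w → max 0 (min 1 w) = 1 := fun w h => by
      rw [min_eq_left h, max_eq_right zero_le_one]
    rcases le_or_gt z 0 with h0 | h0
    · exact Or.inl ⟨h0, hlo _ h0, tent_eq_zero (Or.inl h0), hlo _ (by linarith), hlo _ (by linarith)⟩
    rcases le_or_gt z (1 / 2) with h1 | h1
    · refine Or.inr (Or.inl ⟨h0, h1, hmid _ h0.le (by linarith), ?_, hmid _ (by linarith)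
        (by linarith), hlo _ (by linarith)⟩)
      rw [tent, min_eq_left (by linarith), max_eq_right h0.le]
    rcases le_or_gt z 1 with h2 | h2
    · refine Or.inr (Or.inr (Or.inl ⟨h1, h2, hmid _ h0.le h2, ?_, hhi _ (by linarith),
        hmid _ (by linarith) (by linarith)⟩))
      rw [tent, min_eq_right (by linarith), max_eq_right (by linarith)]
    · exact Or.inr (Or.inr (Or.inr ⟨h2, hhi _ h2.le, tent_eq_zero (Or.inr h2.le),
        hhi _ (by linarith), hhi _ (by linarith)⟩))
  rw [hb x y hxy, hb _ _ (by linarith), hb _ _ (by linarith)]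
  rcases hreg x with ⟨h1, e1, e2, e3, e4⟩ | ⟨h1, h1', e1, e2, e3, e4⟩ | ⟨h1, h1', e1, e2, e3, e4⟩ |
      ⟨h1, e1, e2, e3, e4⟩ <;>
    rcases hreg y with ⟨h2, f1, f2, f3, f4⟩ | ⟨h2, h2', f1, f2, f3, f4⟩ |
        ⟨h2, h2', f1, f2, f3, f4⟩ | ⟨h2, f1, f2, f3, f4⟩ <;>
    rw [e1, e2, e3, e4, f1, f2, f3, f4] <;> ring1

lemma sum_range_two_mul (f : ℕ → ℝ) (n : ℕ) :
    ∑ k ∈ Finset.range (2 * n), f k = ∑ k ∈ Finset.range n, (f (2 * k) + f (2 * k + 1)) := by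
  induction n with
  | zero => simp
  | succ n ih =>
    rw [Finset.sum_range_succ, ← ih, Nat.mul_succ, Finset.sum_range_succ, Finset.sum_range_succ,
      add_assoc]

/-- The covariance of the level `j` term in Lévy's construction. -/
noncomputable def levelKernel (j : ℕ) (x y : ℝ) : ℝ :=
  (1 / 2) ^ j * ∑ k ∈ Finset.range (2 ^ j), tent (2 ^ j * x - k) * tent (2 ^ j * y - k)

lemma bridgeKernel_eq_sum (n : ℕ) (x y : ℝ) : bridgeKernel x y =
    ∑ j ∈ Finset.range n, levelKernel j x y +
      (1 / 2) ^ n * ∑ k ∈ Finset.range (2 ^ n), bridgeKernel (2 ^ n * x - k) (2 ^ n * y - k) := by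
  induction n with
  | zero => simp
  | succ n ih =>
    rw [ih, Finset.sum_range_succ, add_assoc, levelKernel, pow_succ' 2 n, sum_range_two_mul,
      pow_succ (1 / 2 : ℝ) n, mul_assoc ((1 / 2 : ℝ) ^ n), ← mul_add]
    congr 2
    rw [Finset.mul_sum, ← Finset.sum_add_distrib]
    refine Finset.sum_congr rfl fun k _ => ?_
    rw [bridgeKernel_eq]
    push_cast
    ring_nf

lemma tendsto_sum_levelKernel (x y : ℝ) :
    Tendsto (fun n => ∑ j ∈ Finset.range n, levelKernel j x y) atTop (𝓝 (bridgeKernel x y)) := by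
  have hc : ∀ z : ℝ, 0 ≤ max 0 (min 1 z) ∧ max 0 (min 1 z) ≤ 1 := fun z =>
    ⟨le_max_left _ _, max_le zero_le_one (min_le_left _ _)⟩
  have hb0 : ∀ x y, 0 ≤ bridgeKernel x y := fun x y => by
    obtain ⟨h1, h2⟩ := hc x
    obtain ⟨h3, h4⟩ := hc y
    unfold bridgeKernel
    rcases min_cases (max 0 (min 1 x)) (max 0 (min 1 y)) with ⟨h, _⟩ | ⟨h, _⟩ <;> rw [h] <;>
      nlinarith
  have hb1 : ∀ x y, bridgeKernel x y ≤ 1 := fun x y => by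
    obtain ⟨h1, h2⟩ := hc x
    obtain ⟨h3, h4⟩ := hc y
    unfold bridgeKernel
    nlinarith [min_le_left (max 0 (min 1 x)) (max 0 (min 1 y)), mul_nonneg h1 h3]
  have hb2 : ∀ x y, x ≤ 0 ∨ 1 ≤ x → bridgeKernel x y = 0 := fun x y h => by
    obtain ⟨h3, h4⟩ := hc y
    unfold bridgeKernel
    rcases h with h | h
    · rw [max_eq_left ((min_le_right 1 x).trans h), min_eq_left h3]
      ring
    · rw [min_eq_left h, max_eq_right zero_le_one, min_eq_right h4]
      ring
  have hrem : Tendsto (fun n => bridgeKernel x y - (1 / 2 : ℝ) ^ n * ∑ k ∈ Finset.range (2 ^ n),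
      bridgeKernel (2 ^ n * x - k) (2 ^ n * y - k)) atTop (𝓝 (bridgeKernel x y - 0)) := by
    refine tendsto_const_nhds.sub (squeeze_zero (fun n => ?_) (fun n => ?_)
      (tendsto_pow_atTop_nhds_zero_of_lt_one (r := (1 / 2 : ℝ)) (by norm_num) (by norm_num)))
    · exact mul_nonneg (by positivity) (Finset.sum_nonneg fun k _ => hb0 _ _)
    · refine mul_le_of_le_one_right (by positivity) ?_
      have h := sum_translates_le (f := fun z => bridgeKernel z (z + (2 ^ n * y - 2 ^ n * x)))
        (x := 2 ^ n * x) zero_le_one (fun z => hb1 _ _) (fun z hz => hb2 _ _ hz) (2 ^ n)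
      refine le_trans (le_of_eq (Finset.sum_congr rfl fun k _ => ?_)) h
      congr 1
      ring
  rw [sub_zero] at hrem
  refine hrem.congr fun n => ?_
  rw [bridgeKernel_eq_sum n x y]
  ring

/-- The standard Gaussian product measure that drives Lévy's construction. -/
noncomputable abbrev gaussianNoise : Measure (ℕ × ℕ → ℝ) :=
  Measure.infinitePi fun _ => stdNormal

lemma hasGaussianKernel_gaussianNoise :
    HasGaussianKernel (fun (p : ℕ × ℕ) (ω : ℕ × ℕ → ℝ) => ω p) (fun p q => if p = q then 1 else 0)
      gaussianNoise := by
  have hind : iIndepFun (fun (p : ℕ × ℕ) (ω : ℕ × ℕ → ℝ) => ω p) gaussianNoise :=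
    iIndepFun_infinitePi (P := fun _ : ℕ × ℕ => stdNormal) (X := fun _ z => z) fun _ => measurable_id
  have hlaw : ∀ p : ℕ × ℕ, gaussianNoise.map (fun ω => ω p) = stdNormal := fun p =>
    Measure.infinitePi_map_eval (fun _ : ℕ × ℕ => stdNormal) p
  have hg : ∀ p : ℕ × ℕ, HasGaussianLaw (fun ω : ℕ × ℕ → ℝ => ω p) gaussianNoise := fun p =>
    ⟨by rw [hlaw]; infer_instance⟩
  refine ⟨⟨fun I => ?_⟩, fun p => ?_, fun p q => ?_⟩
  · exact iIndepFun.hasGaussianLaw (X := fun (i : I) (ω : ℕ × ℕ → ℝ) => ω i) (fun i => hg i)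
      (hind.precomp Subtype.val_injective)
  · have h := integral_map (μ := gaussianNoise) (φ := fun ω : ℕ × ℕ → ℝ => ω p)
      (f := fun x : ℝ => x) (measurable_pi_apply p).aemeasurable (by fun_prop)
    rw [hlaw] at h
    exact h.symm.trans integral_id_gaussianReal
  · split_ifs with h
    · subst h
      rw [covariance_self (measurable_pi_apply p).aemeasurable]
      have h3 := variance_map (X := fun x : ℝ => x) (μ := gaussianNoise)
        (Y := fun ω : ℕ × ℕ → ℝ => ω p) (by fun_prop) (measurable_pi_apply p).aemeasurable
      rw [hlaw, variance_fun_id_gaussianReal] at h3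
      exact h3.symm
    · exact (hind.indepFun h).covariance_eq_zero (hg p).memLp_two (hg q).memLp_two

/-- The level `j` term in Lévy's construction: the midpoint displacements of the `2 ^ j` dyadic
intervals of length `2 ^ (-j)`. -/
noncomputable def levyLevel (j : ℕ) (t : ℝ) (ω : ℕ × ℕ → ℝ) : ℝ :=
  ∑ k ∈ Finset.range (2 ^ j), √((1 / 2) ^ j) * tent (2 ^ j * t - k) * ω (j, k)

lemma continuous_levyLevel (j : ℕ) (ω : ℕ × ℕ → ℝ) : Continuous fun t => levyLevel j t ω := by
  unfold levyLevel
  fun_prop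

lemma hasGaussianKernel_sum_levyLevel (n : ℕ) :
    HasGaussianKernel (fun (t : ℝ) ω => ∑ j ∈ Finset.range n, levyLevel j t ω)
      (fun s t => ∑ j ∈ Finset.range n, levelKernel j s t) gaussianNoise := by
  have h := hasGaussianKernel_gaussianNoise.linear (S := ℝ)
    (ι := (Finset.range n).sigma fun j => Finset.range (2 ^ j))
    (fun t i => √((1 / 2) ^ i.1.1) * tent (2 ^ i.1.1 * t - i.1.2)) (fun t i => (i.1.1, i.1.2))
  convert h.congr_kernel ?_ using 1
  · funext t ω
    rw [Finset.sum_coe_sort ((Finset.range n).sigma fun j => Finset.range (2 ^ j))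
      (fun i => √((1 / 2) ^ i.1) * tent (2 ^ i.1 * t - i.2) * ω (i.1, i.2)), Finset.sum_sigma]
    rfl
  · intro s t
    have e : ∀ i j : ((Finset.range n).sigma fun j => Finset.range (2 ^ j)),
        ((i.1.1, i.1.2) : ℕ × ℕ) = (j.1.1, j.1.2) ↔ i = j := by
      rintro ⟨⟨i, k⟩, hi⟩ ⟨⟨j, l⟩, hj⟩
      simp
    simp only [e, mul_ite, mul_one, mul_zero, Finset.sum_ite_eq, Finset.mem_univ, if_true]
    rw [Finset.sum_coe_sort ((Finset.range n).sigma fun j => Finset.range (2 ^ j))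
      (fun i => √((1 / 2) ^ i.1) * tent (2 ^ i.1 * s - i.2) *
        (√((1 / 2) ^ i.1) * tent (2 ^ i.1 * t - i.2))), Finset.sum_sigma]
    refine Finset.sum_congr rfl fun j _ => ?_
    rw [levelKernel, Finset.mul_sum]
    refine Finset.sum_congr rfl fun k _ => ?_
    have := Real.mul_self_sqrt (show (0 : ℝ) ≤ (1 / 2) ^ j by positivity)
    linear_combination (tent (2 ^ j * s - k) * tent (2 ^ j * t - k)) * this

/-- Almost surely, the levels of Lévy's construction decay geometrically, uniformly in time. The
fourth moments of all the displacements, with weights `(2 / 5) ^ j` at level `j`, have a finite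
sum. -/
lemma ae_levyLevel_le :
    ∀ᵐ ω ∂gaussianNoise, ∃ c : ℝ, ∀ j t, |levyLevel j t ω| ≤ c * (9 / 10) ^ j := by
  set c4 := ∫⁻ z, ENNReal.ofReal (z ^ 4) ∂stdNormal with hc4
  have hc4top : c4 ≠ ⊤ := by
    have h := (memLp_id_gaussianReal (μ := 0) (v := 1) 4).integrable_norm_pow (p := 4) (by norm_num)
    have h1 : ∀ z : ℝ, ENNReal.ofReal (z ^ 4) = ENNReal.ofReal (‖id z‖ ^ 4) := fun z => by
      rw [id, Real.norm_eq_abs, Even.pow_abs (by decide)]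
    rw [hc4]
    rw [lintegral_congr h1]
    exact h.lintegral_lt_top.ne
  have hmeas : ∀ j : ℕ, Measurable fun ω : ℕ × ℕ → ℝ => ENNReal.ofReal ((2 / 5) ^ j) *
      ∑ k ∈ Finset.range (2 ^ j), ENNReal.ofReal (ω (j, k) ^ 4) := fun j =>
    Measurable.const_mul (Finset.measurable_fun_sum _ fun k _ => by fun_prop) _
  have hint : ∫⁻ ω, ∑' j : ℕ, ENNReal.ofReal ((2 / 5) ^ j) *
      ∑ k ∈ Finset.range (2 ^ j), ENNReal.ofReal (ω (j, k) ^ 4) ∂gaussianNoise ≠ ⊤ := by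
    have h4 : ∀ p : ℕ × ℕ, ∫⁻ ω, ENNReal.ofReal (ω p ^ 4) ∂gaussianNoise = c4 := fun p => by
      rw [hc4, ← Measure.infinitePi_map_eval (fun _ : ℕ × ℕ => stdNormal) p,
        lintegral_map (by fun_prop) (by fun_prop)]
    rw [lintegral_tsum fun j => (hmeas j).aemeasurable]
    have h5 : ∀ j : ℕ, ∫⁻ ω, ENNReal.ofReal ((2 / 5) ^ j) *
        ∑ k ∈ Finset.range (2 ^ j), ENNReal.ofReal (ω (j, k) ^ 4) ∂gaussianNoise =
        ENNReal.ofReal ((4 / 5) ^ j) * c4 := fun j => by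
      rw [lintegral_const_mul _ (Finset.measurable_fun_sum _ fun k _ => by fun_prop),
        lintegral_finsetSum _ fun k _ => by fun_prop]
      simp_rw [h4]
      rw [Finset.sum_const, Finset.card_range, nsmul_eq_mul, ← mul_assoc]
      congr 1
      rw [← ENNReal.ofReal_natCast, ← ENNReal.ofReal_mul (by positivity)]
      congr 1
      push_cast
      rw [← mul_pow]
      norm_num
    simp_rw [h5]
    rw [ENNReal.tsum_mul_right, ← ENNReal.ofReal_tsum_of_nonneg (fun j => by positivity)
      (summable_geometric_of_lt_one (by norm_num) (by norm_num))]
    exact ENNReal.mul_ne_top ENNReal.ofReal_ne_top hc4top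
  filter_upwards [ae_lt_top (Measurable.tsum hmeas) hint] with ω hω
  set s := (∑' j : ℕ, ENNReal.ofReal ((2 / 5) ^ j) *
      ∑ k ∈ Finset.range (2 ^ j), ENNReal.ofReal (ω (j, k) ^ 4)).toReal with hs
  have hs0 : 0 ≤ s := ENNReal.toReal_nonneg
  have hterm : ∀ j k, k < 2 ^ j → (2 / 5) ^ j * ω (j, k) ^ 4 ≤ s := fun j k hk => by
    have h1 : ENNReal.ofReal ((2 / 5) ^ j * ω (j, k) ^ 4) ≤ ENNReal.ofReal s := by
      rw [hs, ENNReal.ofReal_toReal hω.ne, ENNReal.ofReal_mul (by positivity)]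
      refine le_trans ?_ (ENNReal.le_tsum j)
      exact mul_le_mul_right (Finset.single_le_sum
        (f := fun k => ENNReal.ofReal (ω (j, k) ^ 4)) (fun _ _ => zero_le)
        (Finset.mem_range.2 hk)) _
    exact (ENNReal.ofReal_le_ofReal_iff hs0).1 h1
  have hcoef : ∀ j k, k < 2 ^ j → |√((1 / 2) ^ j) * ω (j, k)| ≤ (s + 1) * (9 / 10) ^ j := by
    intro j k hk
    refine le_of_pow_le_pow_left₀ (n := 4) (by norm_num) (by positivity) ?_
    have e1 : √((1 / 2 : ℝ) ^ j) ^ 4 = (1 / 4) ^ j := by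
      rw [show 4 = 2 * 2 from rfl, pow_mul, Real.sq_sqrt (by positivity), ← pow_mul, mul_comm,
        pow_mul]
      norm_num
    rw [Even.pow_abs (by decide), mul_pow, e1, mul_pow]
    have e2 : ((1 : ℝ) / 4) ^ j * ω (j, k) ^ 4 = (5 / 8) ^ j * ((2 / 5) ^ j * ω (j, k) ^ 4) := by
      rw [← mul_assoc, ← mul_pow]
      norm_num
    rw [e2, mul_comm]
    refine mul_le_mul ((hterm j k hk).trans ?_) ?_ (by positivity) (by positivity)
    · nlinarith [pow_nonneg hs0 2, pow_nonneg hs0 3, pow_nonneg hs0 4]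
    · rw [← pow_mul, mul_comm, pow_mul]
      exact pow_le_pow_left₀ (by norm_num) (by norm_num) j
  refine ⟨s + 1, fun j t => ?_⟩
  unfold levyLevel
  calc _ ≤ ∑ k ∈ Finset.range (2 ^ j), ((s + 1) * (9 / 10) ^ j) * tent (2 ^ j * t - k) := by
        refine (Finset.abs_sum_le_sum_abs _ _).trans (Finset.sum_le_sum fun k hk => ?_)
        rw [mul_right_comm, abs_mul, abs_of_nonneg (tent_nonneg _)]
        exact mul_le_mul_of_nonneg_right (hcoef j k (Finset.mem_range.1 hk)) (tent_nonneg _)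
    _ ≤ _ := by
        rw [← Finset.mul_sum]
        exact mul_le_of_le_one_right (by positivity)
          (sum_translates_le zero_le_one tent_le_one (fun _ => tent_eq_zero) _)

/-- **Existence of the Brownian bridge**, with almost surely continuous paths. -/
theorem exists_brownianBridge : ∃ B : ℝ → (ℕ × ℕ → ℝ) → ℝ,
    (∀ t, Measurable (B t)) ∧ HasGaussianKernel B bridgeKernel gaussianNoise ∧
      ∀ᵐ ω ∂gaussianNoise, Continuous fun t => B t ω := by
  have hsum : ∀ c : ℝ, Summable fun j : ℕ => c * (9 / 10 : ℝ) ^ j := fun c =>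
    (summable_geometric_of_lt_one (by norm_num) (by norm_num)).mul_left c
  refine ⟨fun t ω => ∑' j, levyLevel j t ω, fun t => Measurable.tsum fun j => ?_,
    HasGaussianKernel.of_tendsto
    hasGaussianKernel_sum_levyLevel (fun t => ?_) tendsto_sum_levelKernel, ?_⟩
  · unfold levyLevel
    fun_prop
  · filter_upwards [ae_levyLevel_le] with ω ⟨c, hc⟩
    exact (Summable.of_norm_bounded (hsum c) fun j => hc j t).hasSum.tendsto_sum_nat
  · filter_upwards [ae_levyLevel_le] with ω ⟨c, hc⟩
    exact continuous_tsum (fun j => continuous_levyLevel j ω) (hsum c) fun j t => hc j t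

/-! ### Brownian bridges with prescribed values on a lattice -/

/-- The piecewise linear function with value `1` at `0` and value `0` at all other integers. -/
noncomputable def hat (x : ℝ) : ℝ := max 0 (1 - |x|)

@[fun_prop]
lemma continuous_hat : Continuous hat := by
  unfold hat
  fun_prop

lemma hat_eq_zero {x : ℝ} (h : 1 ≤ |x|) : hat x = 0 := max_eq_left (by linarith)

/-- Piecewise linear interpolation of `f`. -/
lemma sum_hat_mul {n i : ℕ} (hi : i < n) {θ : ℝ} (h0 : 0 ≤ θ) (h1 : θ ≤ 1) (f : ℕ → ℝ) :
    ∑ k : Fin (n + 1), hat (i + θ - (k : ℕ)) * f k = (1 - θ) * f i + θ * f (i + 1) := by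
  rw [Fin.sum_univ_eq_sum_range (fun k => hat (i + θ - k) * f k) (n + 1),
    Finset.sum_eq_add_of_mem i (i + 1) (Finset.mem_range.2 (by omega))
      (Finset.mem_range.2 (by omega)) (by omega)]
  · have e1 : hat (i + θ - i) = 1 - θ := by
      rw [hat, add_sub_cancel_left, abs_of_nonneg h0, max_eq_right (by linarith)]
    have e2 : hat (i + θ - (i + 1 : ℕ)) = θ := by
      rw [hat]
      push_cast
      rw [add_sub_add_left_eq_sub, abs_of_nonpos (by linarith), max_eq_right (by linarith)]
      ring
    rw [e1, e2]
  · rintro k - ⟨hk1, hk2⟩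
    rw [hat_eq_zero, zero_mul]
    rcases Nat.lt_or_ge k i with h | h
    · have : (k : ℝ) + 1 ≤ i := by exact_mod_cast h
      exact le_abs.2 (Or.inl (by linarith))
    · have : (i : ℝ) + 2 ≤ k := by exact_mod_cast (by omega : i + 2 ≤ k)
      exact le_abs.2 (Or.inr (by linarith))

lemma sum_hat_natCast_mul {n i : ℕ} (hi : i ≤ n) (f : ℕ → ℝ) :
    ∑ k : Fin (n + 1), hat ((i : ℝ) - (k : ℕ)) * f k = f i := by
  rw [Fin.sum_univ_eq_sum_range (fun k => hat (i - k) * f k) (n + 1),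
    Finset.sum_eq_single_of_mem i (Finset.mem_range.2 (by omega))]
  · simp [hat]
  · intro k _ hk
    rw [hat_eq_zero, zero_mul]
    rcases Nat.lt_or_gt_of_ne hk with h | h
    · have : (k : ℝ) + 1 ≤ i := by exact_mod_cast h
      exact le_abs.2 (Or.inl (by linarith))
    · have : (i : ℝ) + 1 ≤ k := by exact_mod_cast h
      exact le_abs.2 (Or.inr (by linarith))

lemma bridgeKernel_of_mem {x y : ℝ} (hx : 0 ≤ x) (hx' : x ≤ 1) (hy : 0 ≤ y) (hy' : y ≤ 1) :
    bridgeKernel x y = min x y - x * y := by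
  rw [bridgeKernel, min_eq_right hx', min_eq_right hy', max_eq_right hx, max_eq_right hy]

/-- The Brownian bridge covariance with a lattice point is linear between lattice points. -/
lemma sum_hat_mul_bridgeKernel {n : ℕ} (hn : 0 < n) {j : ℕ} (hj : j ≤ n) {t : ℝ} (h0 : 0 ≤ t)
    (h1 : t ≤ 1) : ∑ k : Fin (n + 1), hat (n * t - (k : ℕ)) * bridgeKernel (j / n) ((k : ℕ) / n) =
      bridgeKernel (j / n) t := by
  have hn0 : (0 : ℝ) < n := Nat.cast_pos.2 hn
  obtain ⟨i, θ, hi, hθ0, hθ1, hθ⟩ : ∃ (i : ℕ) (θ : ℝ), i < n ∧ 0 ≤ θ ∧ θ ≤ 1 ∧ n * t = i + θ := by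
    rcases h1.lt_or_eq with h1 | h1
    · refine ⟨⌊n * t⌋₊, n * t - ⌊n * t⌋₊, ?_, ?_, ?_, by ring⟩
      · rw [Nat.floor_lt (by positivity)]
        exact mul_lt_of_lt_one_right hn0 h1
      · exact sub_nonneg.2 (Nat.floor_le (by positivity))
      · linarith [Nat.lt_floor_add_one (n * t)]
    · refine ⟨n - 1, 1, by omega, zero_le_one, le_rfl, ?_⟩
      rw [h1, Nat.cast_pred hn]
      ring
  have ht : t = (i + θ) / n := by
    rw [← hθ]
    field_simp
  have hdiv : ∀ k : ℕ, k ≤ n → (k : ℝ) / n ≤ 1 := fun k hk =>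
    (div_le_one hn0).2 (Nat.cast_le.2 hk)
  rw [hθ, sum_hat_mul hi hθ0 hθ1 fun k => bridgeKernel (j / n) (k / n),
    bridgeKernel_of_mem (by positivity) (hdiv j hj) (by positivity) (hdiv i hi.le),
    bridgeKernel_of_mem (by positivity) (hdiv j hj) (by positivity) (hdiv _ hi),
    bridgeKernel_of_mem (by positivity) (hdiv j hj) h0 h1]
  rcases Nat.lt_or_ge i j with h | h
  · have h' : (i : ℝ) + 1 ≤ j := by exact_mod_cast h
    rw [min_eq_right (by gcongr), min_eq_right (by gcongr; exact h),
      min_eq_right (by rw [ht]; gcongr; linarith), ht]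
    push_cast
    field_simp
    ring
  · have h' : (j : ℝ) ≤ i := by exact_mod_cast h
    rw [min_eq_left (by gcongr), min_eq_left (by gcongr; omega),
      min_eq_left (by rw [ht]; gcongr; linarith), ht]
    push_cast
    field_simp
    ring

/-- The process that is obtained from `B` by replacing its values at the points `k / n`, by those
of the lattice process `b`, scaled by `1 / √n`, and by interpolating the difference linearly. -/
noncomputable def bridgeInterp {Ω : Type*} (n : ℕ) (B : ℝ → Ω → ℝ) (t : unitInterval)
    (p : (ℕ → ℝ) × Ω) : ℝ :=
  B t p.2 + ∑ k : Fin (n + 1), hat (n * t - (k : ℕ)) * (p.1 k / √n - B ((k : ℕ) / n) p.2)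

lemma sqrt_mul_bridgeInterp {Ω : Type*} {n : ℕ} (hn : 0 < n) (B : ℝ → Ω → ℝ) (k : Fin (n + 1))
    (p : (ℕ → ℝ) × Ω) : √n * bridgeInterp n B (gridPoint k) p = p.1 k := by
  have hn0 : (0 : ℝ) < n := Nat.cast_pos.2 hn
  have e : (n : ℝ) * ((k : ℕ) / n) = (k : ℕ) := by field_simp
  have h := sum_hat_natCast_mul (Nat.lt_succ_iff.1 k.isLt) fun k => p.1 k / √n - B (k / n) p.2
  unfold bridgeInterp gridPoint
  simp only [e]
  rw [h]
  have : √(n : ℝ) ≠ 0 := (Real.sqrt_pos.2 hn0).ne'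
  field_simp
  ring

lemma maxDeviation_bridgeInterp {Ω : Type*} {n : ℕ} (hn : 0 < n) (B : ℝ → Ω → ℝ) (x : Fin n → ℝ)
    (η : ℝ) (p : (ℕ → ℝ) × Ω) :
    maxDeviation x η (fun t => bridgeInterp n B t p) = latticeDev x η p.1 := by
  unfold maxDeviation latticeDev
  congr 1
  funext k
  rw [mul_comm √(n : ℝ), mul_assoc, sqrt_mul_bridgeInterp hn]

lemma measurable_bridgeInterp {Ω : Type*} [MeasurableSpace Ω] (n : ℕ) {B : ℝ → Ω → ℝ}
    (hB : ∀ t, Measurable (B t)) (t : unitInterval) : Measurable (bridgeInterp n B t) := by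
  unfold bridgeInterp
  have : ∀ t, Measurable fun p : (ℕ → ℝ) × Ω => B t p.2 := fun t => (hB t).comp measurable_snd
  fun_prop

lemma continuous_bridgeInterp {Ω : Type*} (n : ℕ) {B : ℝ → Ω → ℝ} {p : (ℕ → ℝ) × Ω}
    (hB : Continuous fun t => B t p.2) : Continuous fun t => bridgeInterp n B t p := by
  unfold bridgeInterp
  have : Continuous fun t : unitInterval => B t p.2 := hB.comp continuous_subtype_val
  fun_prop

/-- A lattice bridge and an independent Brownian bridge yield a Brownian bridge that has the
lattice bridge, scaled by `1 / √n`, as its values at the points `k / n`. -/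
lemma IsLatticeBridge.hasGaussianKernel_bridgeInterp {Ω : Type*} [MeasurableSpace Ω] {n : ℕ}
    (hn : 0 < n) {γ : Measure (ℕ → ℝ)} (hγ : IsLatticeBridge n γ) {B : ℝ → Ω → ℝ} {Q : Measure Ω}
    (hB : HasGaussianKernel B bridgeKernel Q) :
    HasGaussianKernel (bridgeInterp n B) (fun s t => bridgeKernel s t) (γ.prod Q) := by
  have hn0 : (0 : ℝ) < n := Nat.cast_pos.2 hn
  have h := (HasGaussianKernel.prod hγ hB).linear (S := unitInterval)
    (ι := Unit ⊕ (Fin (n + 1) ⊕ Fin (n + 1)))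
    (fun t => Sum.elim (fun _ => 1) (Sum.elim (fun k => hat (n * t - (k : ℕ)) / √n)
      fun k => - hat (n * t - (k : ℕ))))
    (fun t => Sum.elim (fun _ => Sum.inr t)
      (Sum.elim (fun k => Sum.inl k) fun k => Sum.inr ((k : ℕ) / n)))
  convert h.congr_kernel ?_ using 1
  · funext t p
    simp only [bridgeInterp, Fintype.sum_sum_type, Sum.elim_inl, Sum.elim_inr, Finset.univ_unique,
      Finset.sum_singleton, one_mul, ← Finset.sum_add_distrib]
    congr 1
    refine Finset.sum_congr rfl fun k _ => ?_
    ring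
  · intro s t
    simp only [Fintype.sum_sum_type, Sum.elim_inl, Sum.elim_inr, Finset.univ_unique,
      Finset.sum_singleton, one_mul, mul_one, mul_zero, Finset.sum_const_zero, add_zero, zero_add]
    have hg : ∀ (t : unitInterval) (k : Fin (n + 1)),
        ∑ l : Fin (n + 1), hat (n * t - (l : ℕ)) * bridgeKernel ((k : ℕ) / n) ((l : ℕ) / n) =
          bridgeKernel ((k : ℕ) / n) t := fun t k =>
      sum_hat_mul_bridgeKernel hn (Nat.lt_succ_iff.1 k.isLt) t.2.1 t.2.2
    have hlat : ∀ k l : Fin (n + 1), (min ((k : ℕ) : ℝ) (l : ℕ) - (k : ℕ) * (l : ℕ) / n) / n =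
        bridgeKernel ((k : ℕ) / n) ((l : ℕ) / n) := fun k l => by
      have hdiv : ∀ k : Fin (n + 1), ((k : ℕ) : ℝ) / n ≤ 1 := fun k =>
        (div_le_one hn0).2 (Nat.cast_le.2 (Nat.lt_succ_iff.1 k.isLt))
      rw [bridgeKernel_of_mem (by positivity) (hdiv k) (by positivity) (hdiv l),
        min_div_div_right hn0.le]
      field_simp
    have hdouble : ∀ k : Fin (n + 1), ∑ l : Fin (n + 1), hat (n * s - (k : ℕ)) / √n *
        (hat (n * t - (l : ℕ)) / √n) * (min ((k : ℕ) : ℝ) (l : ℕ) - (k : ℕ) * (l : ℕ) / n) =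
          hat (n * s - (k : ℕ)) * bridgeKernel ((k : ℕ) / n) t := fun k => by
      rw [← hg t k, Finset.mul_sum]
      refine Finset.sum_congr rfl fun l _ => ?_
      rw [← hlat k l]
      have h2 := Real.mul_self_sqrt hn0.le
      have h3 : √(n : ℝ) ≠ 0 := (Real.sqrt_pos.2 hn0).ne'
      rw [div_mul_div_comm, h2]
      ring
    have hdouble' : ∀ k : Fin (n + 1), ∑ l : Fin (n + 1), - hat (n * s - (k : ℕ)) *
        - hat (n * t - (l : ℕ)) * bridgeKernel ((k : ℕ) / n) ((l : ℕ) / n) =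
          hat (n * s - (k : ℕ)) * bridgeKernel ((k : ℕ) / n) t := fun k => by
      rw [← hg t k, Finset.mul_sum]
      refine Finset.sum_congr rfl fun l _ => ?_
      ring
    have hcross : ∑ l : Fin (n + 1), hat (n * t - (l : ℕ)) * bridgeKernel s ((l : ℕ) / n) =
        ∑ k : Fin (n + 1), hat (n * s - (k : ℕ)) * bridgeKernel ((k : ℕ) / n) t := by
      simp_rw [← hg t, bridgeKernel_comm s, ← hg s, Finset.mul_sum]
      rw [Finset.sum_comm]
      refine Finset.sum_congr rfl fun k _ => Finset.sum_congr rfl fun l _ => ?_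
      rw [bridgeKernel_comm]
      ring
    simp_rw [Finset.sum_add_distrib, hdouble, hdouble']
    simp only [neg_mul, Finset.sum_neg_distrib, hcross]
    ring

lemma HasGaussianKernel.isBrownianBridge {Ω : Type*} [MeasurableSpace Ω]
    {B : unitInterval → Ω → ℝ} {Q : Measure Ω}
    (h : HasGaussianKernel B (fun s t => bridgeKernel s t) Q)
    (hB : ∀ᵐ ω ∂Q, Continuous fun t => B t ω) : IsBrownianBridge B Q where
  isGaussianProcess := h.isGaussian
  mean_eq_zero := h.mean_eq_zero
  covariance_eq s t := by
    rw [h.covariance_eq, bridgeKernel_of_mem s.2.1 s.2.2 t.2.1 t.2.2]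
  continuous_paths := hB

/-! ### Exchangeable laws as mixtures of uniform arrangements -/

section Mixture

variable {r n : ℕ}

/-- Sequences with the same composition are rearrangements of one another. -/
lemma exists_perm_of_count_eq {s s' : Fin n → Fin r} (h : count s = count s') :
    ∃ σ : Equiv.Perm (Fin n), ∀ p, s' (σ p) = s p := by
  have e : ∀ i, Nonempty ({p // s p = i} ≃ {p // s' p = i}) := fun i => by
    refine Fintype.card_eq.1 ?_
    rw [Fintype.card_subtype, Fintype.card_subtype]
    exact congrFun h i
  exact ⟨Equiv.ofFiberEquiv fun i => (e i).some, Equiv.ofFiberEquiv_map _⟩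

/-- The law of an exchangeable sequence is invariant under permutations. -/
lemma Exchangeable.map_apply_eq {Ω : Type*} [MeasurableSpace Ω] {ε : Fin n → Ω → ℝ}
    {P : Measure Ω} (h : Exchangeable ε P) (x : Fin n → ℝ) (σ : Equiv.Perm (Fin n)) :
    P.map (fun ω i => ε i ω) {fun i => x (σ i)} = P.map (fun ω i => ε i ω) {x} := by
  have h1 : P.map (fun ω i => ε (σ.symm i) ω) {x} = P.map (fun ω i => ε i ω) {x} := by
    rw [(h σ.symm).map_eq]
  have h2 := (h 1).aemeasurable_snd
  rw [← h1, Measure.map_apply_of_aemeasurable (h σ.symm).aemeasurable_fst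
    (measurableSet_singleton _), Measure.map_apply_of_aemeasurable h2 (measurableSet_singleton _)]
  congr 1
  ext ω
  simp only [mem_preimage, mem_singleton_iff, funext_iff]
  exact ⟨fun h i => by simpa using h (σ.symm i), fun h i => by simpa using h (σ i)⟩

/-- The law of a sequence of random variables with values in the range of `a` is discrete. -/
lemma map_eq_sum_dirac {Ω : Type*} [MeasurableSpace Ω] {ε : Fin n → Ω → ℝ} {P : Measure Ω}
    (hε : AEMeasurable (fun ω i => ε i ω) P) {a : Fin r → ℝ} (ha : Function.Injective a)
    (hmem : ∀ i, ∀ᵐ ω ∂P, ε i ω ∈ range a) :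
    P.map (fun ω i => ε i ω) = Measure.sum fun s : Fin n → Fin r =>
      P.map (fun ω i => ε i ω) {fun i => a (s i)} • Measure.dirac fun i => a (s i) := by
  set μ := P.map (fun ω i => ε i ω) with hμ
  have h1 : ∀ᵐ x ∂μ, x ∈ ⋃ s : Fin n → Fin r, {fun i => a (s i)} := by
    rw [hμ, ae_map_iff (p := fun x => x ∈ ⋃ s : Fin n → Fin r, {fun i => a (s i)}) hε
      (MeasurableSet.iUnion fun s => measurableSet_singleton _)]
    filter_upwards [ae_all_iff.2 hmem] with ω hω
    choose s hs using hω
    exact mem_iUnion.2 ⟨s, funext fun i => (hs i).symm⟩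
  conv_lhs => rw [← Measure.restrict_eq_self_of_ae_mem h1]
  rw [Measure.restrict_iUnion _ fun s => measurableSet_singleton _]
  · simp_rw [Measure.restrict_singleton]
  · intro s t hst
    refine disjoint_singleton.2 fun h => hst (funext fun i => ha (congrFun h i))

/-- The weights of the mixture of uniform arrangements. -/
lemma exists_mixture_weight {q : (Fin n → Fin r) → ℝ≥0∞}
    (hq : ∀ s s', count s = count s' → q s = q s') : ∃ w : (Fin r → ℕ) → ℝ≥0∞,
      ∀ s, q s = w (count s) * ENNReal.ofReal (arrangementProb (count s) s) := by
  classical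
  refine ⟨fun m => if h : ∃ s : Fin n → Fin r, count s = m then
    q h.choose / ENNReal.ofReal (arrangementProb m h.choose) else 0, fun s => ?_⟩
  have h : ∃ s' : Fin n → Fin r, count s' = count s := ⟨s, rfl⟩
  have h1 : arrangementProb (count s) h.choose = arrangementProb (count s) s := by
    rw [arrangementProb, arrangementProb, if_pos h.choose_spec, if_pos rfl]
  have h2 : 0 < arrangementProb (count s) s := by
    rw [arrangementProb, if_pos rfl]
    exact div_pos (Finset.prod_pos fun i _ => Nat.cast_pos.2 (Nat.factorial_pos _))
      (Nat.cast_pos.2 (Nat.factorial_pos _))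
  dsimp only
  rw [dif_pos h, h1, hq _ _ h.choose_spec,
    ENNReal.div_mul_cancel (ENNReal.ofReal_pos.2 h2).ne' ENNReal.ofReal_ne_top]

variable {γ : Measure (ℕ → ℝ)} {ρ : (Fin r → ℕ) → (Fin n → Fin r) → Measure (ℕ → ℝ)}
  {q : (Fin n → Fin r) → ℝ≥0∞} {w : (Fin r → ℕ) → ℝ≥0∞}

/-- Drawing a composition, and then a uniform arrangement with this composition. -/
lemma sum_mixture [IsProbabilityMeasure γ]
    (hρ : ∀ m, ∑ i, m i = n → IsArrangementCoupling m γ (ρ m))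
    (hw : ∀ s, q s = w (count s) * ENNReal.ofReal (arrangementProb (count s) s))
    (H : Measure (ℕ → ℝ) → (Fin n → Fin r) → ℝ≥0∞) (hH : ∀ s, H 0 s = 0) :
    ∑ s, w (count s) * H (ρ (count s) s) s = ∑ s', q s' * ∑ s, H (ρ (count s') s) s := by
  simp_rw [hw, Finset.mul_sum]
  rw [Finset.sum_comm]
  refine Finset.sum_congr rfl fun s _ => ?_
  have h1 : ∑ s' : Fin n → Fin r, ENNReal.ofReal (arrangementProb (count s) s') = 1 := by
    have h2 := hρ (count s) (sum_count s)
    have h3 : Measure.sum (ρ (count s)) univ = 1 := by rw [h2.sum_eq, measure_univ]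
    rw [Measure.sum_apply _ MeasurableSet.univ, tsum_fintype] at h3
    simpa only [h2.mass_eq] using h3
  rw [← one_mul (w (count s) * _), ← h1, Finset.sum_mul]
  refine Finset.sum_congr rfl fun s' _ => ?_
  by_cases h : count s' = count s
  · rw [h]
    ring
  · have h2 : ρ (count s') s = 0 := by
      by_contra h3
      exact h ((hρ (count s') (sum_count s')).count_eq h3).symm
    rw [h2, hH, arrangementProb, if_neg h]
    simp

/-- The joint law of the arrangement and the lattice bridge, when the composition is random. -/
noncomputable def mixtureCoupling (w : (Fin r → ℕ) → ℝ≥0∞)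
    (ρ : (Fin r → ℕ) → (Fin n → Fin r) → Measure (ℕ → ℝ)) :
    Measure ((Fin n → Fin r) × (ℕ → ℝ)) :=
  Measure.sum fun s => (w (count s) • ρ (count s) s).map fun b => (s, b)

lemma lintegral_mixtureCoupling {F : (Fin n → Fin r) × (ℕ → ℝ) → ℝ≥0∞} (hF : Measurable F) :
    ∫⁻ p, F p ∂mixtureCoupling w ρ = ∑ s, w (count s) * ∫⁻ b, F (s, b) ∂ρ (count s) s := by
  unfold mixtureCoupling
  rw [lintegral_sum_measure, tsum_fintype]
  refine Finset.sum_congr rfl fun s _ => ?_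
  rw [lintegral_map hF (by fun_prop), lintegral_smul_measure, smul_eq_mul]

lemma map_snd_mixtureCoupling [IsProbabilityMeasure γ]
    (hρ : ∀ m, ∑ i, m i = n → IsArrangementCoupling m γ (ρ m))
    (hw : ∀ s, q s = w (count s) * ENNReal.ofReal (arrangementProb (count s) s))
    (hq : ∑ s, q s = 1) : (mixtureCoupling w ρ).map Prod.snd = γ := by
  ext E hE
  have h1 := lintegral_mixtureCoupling (w := w) (ρ := ρ)
    (F := fun p => E.indicator (fun _ => 1) p.2) ((measurable_one.indicator hE).comp measurable_snd)
  rw [← lintegral_map (f := E.indicator fun _ => 1) (measurable_const.indicator hE) measurable_snd]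
    at h1
  simp_rw [lintegral_indicator_const hE, one_mul] at h1
  rw [h1, sum_mixture hρ hw (fun κ _ => κ E) fun _ => rfl]
  have h2 : ∀ s' : Fin n → Fin r, ∑ s, ρ (count s') s E = γ E := fun s' => by
    rw [← (hρ _ (sum_count s')).sum_eq, Measure.sum_apply _ hE, tsum_fintype]
  simp_rw [h2]
  rw [← Finset.sum_mul, hq, one_mul]

lemma map_fst_mixtureCoupling
    (hρ : ∀ m, ∑ i, m i = n → IsArrangementCoupling m γ (ρ m))
    (hw : ∀ s, q s = w (count s) * ENNReal.ofReal (arrangementProb (count s) s)) :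
    (mixtureCoupling w ρ).map Prod.fst = Measure.sum fun s => q s • Measure.dirac s := by
  unfold mixtureCoupling
  rw [Measure.map_sum measurable_fst.aemeasurable]
  congr 1
  funext s
  rw [Measure.map_map measurable_fst (by fun_prop)]
  have : (Prod.fst ∘ fun b : ℕ → ℝ => (s, b)) = fun _ => s := rfl
  rw [this, Measure.map_const, Measure.smul_apply, smul_eq_mul, (hρ _ (sum_count s)).mass_eq, hw]

lemma lintegral_comp_eq_sum {Ω : Type*} [MeasurableSpace Ω] {ε : Fin n → Ω → ℝ} {P : Measure Ω}
    (hε : AEMeasurable (fun ω i => ε i ω) P) {a : Fin r → ℝ} (ha : Function.Injective a)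
    (hmem : ∀ i, ∀ᵐ ω ∂P, ε i ω ∈ range a) {g : (Fin n → ℝ) → ℝ≥0∞} (hg : Measurable g) :
    ∫⁻ ω, g (fun i => ε i ω) ∂P = ∑ s : Fin n → Fin r,
      P.map (fun ω i => ε i ω) {fun i => a (s i)} * g fun i => a (s i) := by
  rw [← lintegral_map' (f := g) hg.aemeasurable hε]
  conv_lhs => rw [map_eq_sum_dirac hε ha hmem]
  rw [lintegral_sum_measure, tsum_fintype]
  refine Finset.sum_congr rfl fun s _ => ?_
  rw [lintegral_smul_measure, lintegral_dirac, smul_eq_mul]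

/-- Couplings of the uniform arrangements with a common lattice bridge yield a coupling of an
exchangeable sequence with a Brownian bridge, with the corresponding bounds for expectations. -/
theorem Exchangeable.exists_isCoupling {Ω : Type*} [MeasurableSpace Ω] {P : Measure Ω}
    [IsProbabilityMeasure P] {ε : Fin n → Ω → ℝ} (h : Exchangeable ε P) (hn : 1 ≤ n)
    {a : Fin r → ℝ} (ha : Function.Injective a) (hmem : ∀ i, ∀ᵐ ω ∂P, ε i ω ∈ range a)
    {γ : Measure (ℕ → ℝ)} (hγ : IsLatticeBridge n γ)
    {ρ : (Fin r → ℕ) → (Fin n → Fin r) → Measure (ℕ → ℝ)}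
    (hρ : ∀ m, ∑ i, m i = n → IsArrangementCoupling m γ (ρ m)) :
    ∃ (P' : Measure (((Fin n → Fin r) × (ℕ → ℝ)) × (ℕ × ℕ → ℝ)))
      (B : unitInterval → ((Fin n → Fin r) × (ℕ → ℝ)) × (ℕ × ℕ → ℝ) → ℝ),
      IsCoupling ε P (fun i ω => a (ω.1.1 i)) B P' ∧
      (∀ (x : Fin n → ℝ) η ω, maxDeviation x η (fun t => B t ω) = latticeDev x η ω.1.2) ∧
      ∀ (F : (Fin n → Fin r) × (ℕ → ℝ) → ℝ≥0∞) (g : (Fin n → ℝ) → ℝ≥0∞), Measurable F →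
        Measurable g →
        (∀ s', ∑' s, ∫⁻ b, F (s, b) ∂ρ (count s') s ≤ g fun i => a (s' i)) →
        ∫⁻ ω, F ω.1 ∂P' ≤ ∫⁻ ω, g (fun i => ε i ω) ∂P := by
  have hε : AEMeasurable (fun ω i => ε i ω) P := (h 1).aemeasurable_snd
  have ham : Measurable fun (s : Fin n → Fin r) i => a (s i) := measurable_of_countable _
  have := hγ.isProbabilityMeasure
  set q : (Fin n → Fin r) → ℝ≥0∞ := fun s => P.map (fun ω i => ε i ω) {fun i => a (s i)} with hq
  obtain ⟨w, hw⟩ := exists_mixture_weight (q := q) fun s s' hs => by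
    obtain ⟨σ, hσ⟩ := exists_perm_of_count_eq hs
    simp only [hq]
    rw [← h.map_apply_eq (fun i => a (s' i)) σ]
    simp_rw [hσ]
  have hq1 : ∑ s, q s = 1 := by
    have h1 := lintegral_comp_eq_sum hε ha hmem (g := fun _ => 1) measurable_const
    rw [lintegral_one, measure_univ] at h1
    rw [h1]
    simp [hq]
  have hfst := map_fst_mixtureCoupling hρ hw
  have hsnd := map_snd_mixtureCoupling hρ hw hq1
  set μ := mixtureCoupling w ρ with hμ
  have hμ1 : IsProbabilityMeasure μ := by
    constructor
    rw [← preimage_univ (f := Prod.snd), ← Measure.map_apply measurable_snd MeasurableSet.univ,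
      hsnd, measure_univ]
  obtain ⟨B, hBm, hB, hBc⟩ := exists_brownianBridge
  have hφ : Measurable fun ω : ((Fin n → Fin r) × (ℕ → ℝ)) × (ℕ × ℕ → ℝ) => (ω.1.2, ω.2) := by
    fun_prop
  have hmap : (μ.prod gaussianNoise).map (fun ω => (ω.1.2, ω.2)) = γ.prod gaussianNoise := by
    have h1 := Measure.map_prod_map μ gaussianNoise measurable_snd measurable_id
    rw [hsnd, Measure.map_id] at h1
    exact h1.symm
  refine ⟨μ.prod gaussianNoise, fun t ω => bridgeInterp n B t (ω.1.2, ω.2),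
    ⟨inferInstance, ⟨(ham.comp (measurable_fst.comp measurable_fst)).aemeasurable, hε, ?_⟩,
      HasGaussianKernel.isBrownianBridge ?_ ?_⟩,
    fun x η ω => maxDeviation_bridgeInterp hn B x η _, fun F g hF hg hFg => ?_⟩
  · have h1 : (μ.prod gaussianNoise).map (fun ω i => a (ω.1.1 i)) =
        (μ.map Prod.fst).map fun s i => a (s i) := by
      rw [Measure.map_map ham measurable_fst]
      conv_rhs => rw [← (measurePreserving_fst (μ := μ) (ν := gaussianNoise)).map_eq]
      rw [Measure.map_map (by fun_prop) measurable_fst]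
      rfl
    rw [h1, hfst, map_eq_sum_dirac hε ha hmem, Measure.map_sum ham.aemeasurable]
    congr 1
    funext s
    rw [Measure.map_smul, Measure.map_dirac' ham]
  · refine HasGaussianKernel.of_map (X := bridgeInterp n B) hφ.aemeasurable ?_
      fun t => measurable_bridgeInterp n hBm t
    rw [hmap]
    exact hγ.hasGaussianKernel_bridgeInterp hn hB
  · have h1 := (measurePreserving_snd (μ := μ) (ν := gaussianNoise)).quasiMeasurePreserving.ae hBc
    filter_upwards [h1] with ω hω
    exact continuous_bridgeInterp n hω
  · rw [← lintegral_map (f := F) hF measurable_fst, measurePreserving_fst.map_eq,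
      lintegral_mixtureCoupling hF, sum_mixture hρ hw (fun κ s => ∫⁻ b, F (s, b) ∂κ)
      fun s => lintegral_zero_measure _, lintegral_comp_eq_sum hε ha hmem hg]
    refine Finset.sum_le_sum fun s' _ => mul_le_mul_right ?_ _
    have h1 := hFg s'
    rwa [tsum_fintype] at h1

end Mixture

/-! ### The exponential bound for exchangeable sequences -/

/-- Jensen's inequality for the power function with exponent `θ ≤ 1`. -/
lemma lintegral_exp_mul_le_rpow {Ω : Type*} [MeasurableSpace Ω] {P : Measure Ω}
    [IsProbabilityMeasure P] {X : Ω → ℝ} (hX : AEMeasurable X P) {θ : ℝ} (h0 : 0 < θ)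
    (h1 : θ ≤ 1) : ∫⁻ ω, ENNReal.ofReal (Real.exp (θ * X ω)) ∂P ≤
      (∫⁻ ω, ENNReal.ofReal (Real.exp (X ω)) ∂P) ^ θ := by
  have h := eLpNorm'_le_eLpNorm'_of_exponent_le h0 h1 P (f := fun ω => Real.exp (X ω))
    (by fun_prop)
  have h2 : ∀ ω, ‖Real.exp (X ω)‖ₑ = ENNReal.ofReal (Real.exp (X ω)) := fun ω => by
    rw [Real.enorm_eq_ofReal (Real.exp_pos _).le]
  simp_rw [eLpNorm', h2, ENNReal.rpow_one, div_one, ENNReal.rpow_one] at h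
  have h3 := ENNReal.rpow_le_rpow h h0.le
  rw [← ENNReal.rpow_mul, one_div_mul_cancel h0.ne', ENNReal.rpow_one] at h3
  refine le_trans (le_of_eq (lintegral_congr fun ω => ?_)) h3
  rw [ENNReal.ofReal_rpow_of_pos (Real.exp_pos _), ← Real.exp_mul, mul_comm]

/-- The quantity in the exponent of the error bound, as a function of the sequence. -/
noncomputable def sampleEnergy {n : ℕ} (η : ℝ) (x : Fin n → ℝ) : ℝ :=
  partialSum x n ^ 2 / n + n * (gammaSq x - η ^ 2) ^ 2

lemma sampleEnergy_nonneg {n : ℕ} (η : ℝ) (x : Fin n → ℝ) : 0 ≤ sampleEnergy η x := by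
  unfold sampleEnergy
  positivity

lemma partialSum_self {n : ℕ} (x : Fin n → ℝ) : partialSum x n = ∑ i, x i := by
  unfold partialSum
  rw [Finset.filter_true_of_mem fun i _ => i.isLt]

@[fun_prop]
lemma measurable_partialSum {n : ℕ} (k : ℕ) : Measurable fun x : Fin n → ℝ => partialSum x k := by
  unfold partialSum
  fun_prop

@[fun_prop]
lemma measurable_gammaSq {n : ℕ} : Measurable fun x : Fin n → ℝ => gammaSq x := by
  unfold gammaSq
  fun_prop

lemma energy_count {r n : ℕ} (hn : 1 ≤ n) (a : Fin r → ℝ) (η : ℝ) (s : Fin n → Fin r) :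
    energy a (count s) η = sampleEnergy η fun i => a (s i) := by
  have hn0 : (n : ℝ) ≠ 0 := Nat.cast_ne_zero.2 (by omega)
  have h1 := sum_comp_eq_sum_count s a
  have h2 := sum_comp_eq_sum_count s fun i => a i ^ 2 - η ^ 2
  rw [energy, sampleEnergy, ← h1, ← h2, sum_count, partialSum_self, gammaSq,
    Finset.sum_sub_distrib, Finset.sum_const, Finset.card_univ, Fintype.card_fin, nsmul_eq_mul]
  field_simp

lemma measurable_latticeDev_prod {r n : ℕ} (x : (Fin n → Fin r) → Fin n → ℝ)
    (η : (Fin n → Fin r) → ℝ) :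
    Measurable fun p : (Fin n → Fin r) × (ℕ → ℝ) => latticeDev (x p.1) (η p.1) p.2 := by
  have h : ∀ s, Measurable fun b => latticeDev (x s) (η s) b := fun s => measurable_latticeDev _ _
  exact measurable_from_prod_countable_right
    (f := fun p : (Fin n → Fin r) × (ℕ → ℝ) => latticeDev (x p.1) (η p.1) p.2) h

/-- The exponential bound for the coupling of an exchangeable sequence with a Brownian bridge, for
a scale `η` that is a function of the composition of the sequence. The power of `n` can be made
arbitrarily small, by Jensen's inequality, at the expense of the range of the exponent. -/
theorem exists_isCoupling_integral_exp_le {r : ℕ} {a : Fin r → ℝ} (ha : Function.Injective a)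
    {ν C : ℝ} (hν : 0 < ν) (hC : 0 < C) : ∃ K lam₀ : ℝ, 0 < K ∧ 0 < lam₀ ∧
      ∀ n : ℕ, 1 ≤ n → ∀ η : (Fin n → ℝ) → ℝ, Measurable η →
      (∀ s : Fin n → Fin r, ν ≤ η fun i => a (s i)) →
      (∀ s s' : Fin n → Fin r, count s = count s' → (η fun i => a (s i)) = η fun i => a (s' i)) →
      ∀ (Ω : Type*) [MeasurableSpace Ω] (P : Measure Ω) [IsProbabilityMeasure P]
        (ε : Fin n → Ω → ℝ), Exchangeable ε P → (∀ i, ∀ᵐ ω ∂P, ε i ω ∈ range a) →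
      ∃ (Ω' : Type) (_ : MeasurableSpace Ω') (P' : Measure Ω')
        (ε' : Fin n → Ω' → ℝ) (B : unitInterval → Ω' → ℝ), IsCoupling ε P ε' B P' ∧
        ∀ lam : ℝ, lam ≤ lam₀ →
          Integrable (fun ω => Real.exp (lam *
            maxDeviation (fun i => ε' i ω) (η fun i => ε' i ω) (fun t => B t ω))) P' ∧
          ∫ ω, Real.exp (lam *
            maxDeviation (fun i => ε' i ω) (η fun i => ε' i ω) (fun t => B t ω)) ∂P' ≤
            Real.exp (C * Real.log n) * ∫ ω, Real.exp (K * lam ^ 2 *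
              sampleEnergy (η fun i => ε i ω) fun i => ε i ω) ∂P := by
  obtain ⟨K, lam₀, C', hK, hlam, hC', hcoup⟩ := exists_lattice_coupling a hν
  -- raising to the power `κ⁻¹` turns `n ^ C'` at the exponent `κ * lam` into at most `n ^ C` at `lam`
  set κ := max 1 (C' / C) with hκ
  have hκ1 : 1 ≤ κ := le_max_left _ _
  have hκ0 : 0 < κ := zero_lt_one.trans_le hκ1
  refine ⟨K * κ ^ 2, lam₀ / κ, by positivity, by positivity, ?_⟩
  intro n hn η hηm hην hηc Ω _ P _ ε hexch hmem
  classical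
  obtain ⟨γ, hγ, hcoup⟩ := hcoup n hn
  -- `η` as a function of the composition; compositions that do not occur get the value `ν`
  set H : (Fin r → ℕ) → ℝ := fun m =>
    if h : ∃ s : Fin n → Fin r, count s = m then η fun i => a (h.choose i) else ν with hH
  have hHc : ∀ s : Fin n → Fin r, H (count s) = η fun i => a (s i) := fun s => by
    have h : ∃ s' : Fin n → Fin r, count s' = count s := ⟨s, rfl⟩
    simp only [hH]
    rw [dif_pos h]
    exact hηc _ _ h.choose_spec
  have hHν : ∀ m, ν ≤ H m := fun m => by
    simp only [hH]
    split_ifs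
    · exact hην _
    · exact le_rfl
  choose! ρ hρ hexp using fun m => hcoup (H m) (hHν m) m
  obtain ⟨P', B, hPB, hdev, hint⟩ := hexch.exists_isCoupling hn ha hmem hγ hρ
  have hP' := hPB.isProbabilityMeasure
  have hε : AEMeasurable (fun ω i => ε i ω) P := (hexch 1).aemeasurable_snd
  set D : (Fin n → Fin r) × (ℕ → ℝ) → ℝ := fun p =>
    latticeDev (fun i => a (p.1 i)) (η fun i => a (p.1 i)) p.2 with hD
  have hDm : Measurable D :=
    measurable_latticeDev_prod (fun s i => a (s i)) fun s => η fun i => a (s i)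
  have hD0 : ∀ p, 0 ≤ D p := fun p =>
    (abs_nonneg _).trans (le_latticeDev _ _ _ (Nat.zero_le n))
  have hEm : Measurable fun x : Fin n → ℝ => sampleEnergy (η x) x := by
    unfold sampleEnergy
    fun_prop
  set J : ℝ → ℝ≥0∞ := fun t => ∫⁻ ω, ENNReal.ofReal (Real.exp (K * t ^ 2 *
    sampleEnergy (η fun i => ε i ω) fun i => ε i ω)) ∂P with hJ
  have hJ1 : ∀ t, 1 ≤ J t := fun t => by
    rw [← measure_univ (μ := P), ← lintegral_one]
    refine lintegral_mono fun ω => ?_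
    rw [← ENNReal.ofReal_one]
    exact ENNReal.ofReal_le_ofReal (Real.one_le_exp
      (mul_nonneg (by positivity) (sampleEnergy_nonneg _ _)))
  have hJtop : ∀ t, J t ≠ ⊤ := fun t => by
    have h1 := lintegral_comp_eq_sum hε ha hmem
      (g := fun x => ENNReal.ofReal (Real.exp (K * t ^ 2 * sampleEnergy (η x) x))) (by fun_prop)
    have := Measure.isProbabilityMeasure_map hε
    rw [hJ]
    simp only
    rw [h1]
    exact ENNReal.sum_ne_top.2 fun s _ =>
      ENNReal.mul_ne_top (measure_ne_top _ _) ENNReal.ofReal_ne_top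
  have hn1 : (1 : ℝ) ≤ n := by exact_mod_cast hn
  -- the bound with the exponent of the lattice coupling
  have hlat : ∀ t, 0 ≤ t → t ≤ lam₀ → ∫⁻ ω, ENNReal.ofReal (Real.exp (t * D ω.1)) ∂P' ≤
      ENNReal.ofReal ((n : ℝ) ^ C') * J t := fun t ht ht' => by
    have h1 := hint (fun p => ENNReal.ofReal (Real.exp (t * D p)))
      (fun x => ENNReal.ofReal ((n : ℝ) ^ C') *
        ENNReal.ofReal (Real.exp (K * t ^ 2 * sampleEnergy (η x) x))) (by fun_prop) (by fun_prop)
      fun s' => ?_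
    · rwa [lintegral_const_mul' _ _ ENNReal.ofReal_ne_top] at h1
    · have h2 := hexp (count s') (sum_count s') t ht ht'
      rw [hHc, energy_count hn, ENNReal.ofReal_mul (by positivity)] at h2
      refine le_trans (le_of_eq (tsum_congr fun s => ?_)) h2
      by_cases h3 : ρ (count s') s = 0
      · rw [h3, lintegral_zero_measure, lintegral_zero_measure]
      · have h4 := (hρ _ (sum_count s')).count_eq h3
        simp only [hD]
        rw [hηc _ _ h4]
  have hscaled : ∀ lam, 0 ≤ lam → lam ≤ lam₀ / κ →
      ∫⁻ ω, ENNReal.ofReal (Real.exp (lam * D ω.1)) ∂P' ≤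
        ENNReal.ofReal ((n : ℝ) ^ C) * J (κ * lam) := fun lam h0 h1 => by
    have h2 := lintegral_exp_mul_le_rpow (P := P') (X := fun ω => κ * lam * D ω.1) (by fun_prop)
      (inv_pos.2 hκ0) (inv_le_one_of_one_le₀ hκ1)
    have h3 : ∀ y : ℝ, κ⁻¹ * (κ * lam * y) = lam * y := fun y => by field_simp
    simp_rw [h3] at h2
    refine h2.trans ((ENNReal.rpow_le_rpow (hlat (κ * lam) (by positivity) ?_)
      (by positivity)).trans ?_)
    · rwa [le_div_iff₀' hκ0] at h1
    · rw [ENNReal.mul_rpow_of_nonneg _ _ (by positivity : 0 ≤ κ⁻¹),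
        ENNReal.ofReal_rpow_of_nonneg (by positivity) (by positivity), ← Real.rpow_mul (by positivity)]
      refine mul_le_mul' (ENNReal.ofReal_le_ofReal (Real.rpow_le_rpow_of_exponent_le hn1 ?_)) ?_
      · rw [← div_eq_mul_inv, div_le_iff₀ hκ0, mul_comm, ← div_le_iff₀ hC]
        exact le_max_right _ _
      · conv_rhs => rw [← ENNReal.rpow_one (J (κ * lam))]
        exact ENNReal.rpow_le_rpow_of_exponent_le (hJ1 _) (inv_le_one_of_one_le₀ hκ1)
  -- for negative `lam` the left-hand side is at most `1`
  have hall : ∀ lam, lam ≤ lam₀ / κ → ∫⁻ ω, ENNReal.ofReal (Real.exp (lam * D ω.1)) ∂P' ≤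
      ENNReal.ofReal ((n : ℝ) ^ C) * J (κ * lam) := fun lam h1 => by
    rcases le_or_gt 0 lam with h0 | h0
    · exact hscaled lam h0 h1
    · calc _ ≤ ∫⁻ _, 1 ∂P' := by
            refine lintegral_mono fun ω => ?_
            rw [← ENNReal.ofReal_one]
            exact ENNReal.ofReal_le_ofReal (Real.exp_le_one_iff.2
              (mul_nonpos_of_nonpos_of_nonneg h0.le (hD0 _)))
        _ = 1 * 1 := by rw [lintegral_one, measure_univ, mul_one]
        _ ≤ _ := by
            refine mul_le_mul' ?_ (hJ1 _)
            rw [← ENNReal.ofReal_one]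
            exact ENNReal.ofReal_le_ofReal (Real.one_le_rpow hn1 hC.le)
  refine ⟨_, _, P', _, B, hPB, fun lam h1 => ?_⟩
  have h2 := hall lam h1
  simp only [hdev]
  have h3 : Integrable (fun ω => Real.exp (lam * D ω.1)) P' := by
    have hm : Measurable fun ω : ((Fin n → Fin r) × (ℕ → ℝ)) × (ℕ × ℕ → ℝ) =>
        Real.exp (lam * D ω.1) := by fun_prop
    refine (lintegral_ofReal_ne_top_iff_integrable hm.aestronglyMeasurable
      (ae_of_all _ fun ω => (Real.exp_pos _).le)).1 (ne_top_of_le_ne_top ?_ h2)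
    exact ENNReal.mul_ne_top ENNReal.ofReal_ne_top (hJtop _)
  have h4 : Integrable (fun ω => Real.exp (K * (κ * lam) ^ 2 *
      sampleEnergy (η fun i => ε i ω) fun i => ε i ω)) P :=
    (lintegral_ofReal_ne_top_iff_integrable
      (((by fun_prop : Measurable fun x : Fin n → ℝ => Real.exp (K * (κ * lam) ^ 2 *
        sampleEnergy (η x) x)).comp_aemeasurable hε).aestronglyMeasurable)
      (ae_of_all _ fun ω => (Real.exp_pos _).le)).1 (hJtop _)
  refine ⟨h3, ?_⟩
  rw [← ofReal_integral_eq_lintegral_ofReal h3 (ae_of_all _ fun ω => (Real.exp_pos _).le)] at h2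
  simp only [hJ] at h2
  rw [← ofReal_integral_eq_lintegral_ofReal h4 (ae_of_all _ fun ω => (Real.exp_pos _).le),
    ← ENNReal.ofReal_mul (by positivity), ENNReal.ofReal_le_ofReal_iff
      (mul_nonneg (by positivity) (integral_nonneg fun ω => (Real.exp_pos _).le))] at h2
  rw [mul_comm C, ← Real.rpow_def_of_pos (by linarith)]
  simp_rw [mul_pow, ← mul_assoc] at h2
  exact h2

/-! ### Independent variables with mean zero -/

/-- The square of the sum of independent, bounded and centred variables, divided by their number,
has an exponential moment that does not depend on their number. -/
lemma IsIID.lintegral_exp_sq_le {Ω : Type*} [MeasurableSpace Ω] {P : Measure Ω}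
    [IsProbabilityMeasure P] {n : ℕ} (hn : 1 ≤ n) {ε : Fin n → Ω → ℝ} (h : IsIID ε P)
    (hmean : ∀ i, P[ε i] = 0) {c κ : ℝ} (hc : 0 < c) (hκ : 0 ≤ κ) (hκ1 : 16 * κ * c ≤ 1)
    (hκ2 : 4 * κ * c ^ 2 ≤ 1) (hbound : ∀ i, ∀ᵐ ω ∂P, |ε i ω| ≤ c) :
    ∫⁻ ω, ENNReal.ofReal (Real.exp (κ * partialSum (fun i => ε i ω) n ^ 2 / n)) ∂P ≤ 68 := by
  have hn0 : (0 : ℝ) < n := Nat.cast_pos.2 hn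
  have hm : ∀ i, AEMeasurable (ε i) P := fun i => (h.identDistrib i i).aemeasurable_fst
  have hS := HasSubgaussianMGF.sum_of_iIndepFun h.indep (s := Finset.univ)
    fun i _ => hasSubgaussianMGF_of_mem_Icc_of_integral_eq_zero (a := -c) (b := c) (hm i)
      ((hbound i).mono fun ω hω => abs_le.1 hω) (hmean i)
  set S : Ω → ℝ := fun ω => ∑ i, ε i ω with hSdef
  have hSm : AEMeasurable S P := hS.aemeasurable
  have hsum : ((∑ _i : Fin n, (‖c - -c‖₊ / 2) ^ 2 : NNReal) : ℝ) = n * c ^ 2 := by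
    push_cast
    rw [Finset.sum_const, Finset.card_univ, Fintype.card_fin, nsmul_eq_mul, Real.norm_eq_abs,
      abs_of_pos (by linarith)]
    ring
  have hSb : ∀ᵐ ω ∂P, |S ω| ≤ n * c := by
    filter_upwards [ae_all_iff.2 hbound] with ω hω
    refine (Finset.abs_sum_le_sum_abs _ _).trans ((Finset.sum_le_sum fun i _ => hω i).trans ?_)
    rw [Finset.sum_const, Finset.card_univ, Fintype.card_fin, nsmul_eq_mul]
  have := Measure.isProbabilityMeasure_map hSm
  have h68 := lintegral_exp_le_of_subgamma (P.map S) (fun y => y)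
    (fun y => min |y| (16 * (κ * y ^ 2 / n))) measurable_id (n * c ^ 2 / 4) (by positivity)
    (fun t _ => by
      have h1 : ENNReal.ofReal (mgf S P t) ≤
          ENNReal.ofReal (Real.exp (2 * (n * c ^ 2 / 4) * t ^ 2)) := by
        refine ENNReal.ofReal_le_ofReal ((hS.mgf_le t).trans (le_of_eq ?_))
        rw [hsum]
        ring_nf
      rwa [lintegral_map' (by fun_prop) hSm, ← ofReal_integral_eq_lintegral_ofReal
        (hS.integrable_exp_mul t) (ae_of_all _ fun ω => (Real.exp_pos _).le)])
    (fun y => min_le_left _ _) fun y => by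
      refine (mul_le_mul_of_nonneg_left (min_le_right _ _) (by positivity)).trans ?_
      have h1 : n * c ^ 2 / 4 * (16 * (κ * y ^ 2 / n)) = 4 * κ * c ^ 2 * y ^ 2 := by
        field_simp
        ring
      rw [h1]
      exact mul_le_of_le_one_left (sq_nonneg y) hκ2
  rw [lintegral_map' (by fun_prop) hSm] at h68
  refine le_trans (le_of_eq (lintegral_congr_ae ?_)) h68
  filter_upwards [hSb] with ω hω
  rw [partialSum_self, min_eq_right]
  · congr 2
    ring
  · have h1 : 16 * (κ * S ω ^ 2 / n) = 16 * κ * (|S ω| / n) * |S ω| := by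
      rw [← sq_abs]
      ring
    rw [h1]
    refine mul_le_of_le_one_left (abs_nonneg _) ?_
    have h2 : |S ω| / n ≤ c := by
      rw [div_le_iff₀ hn0]
      linarith
    exact (mul_le_mul_of_nonneg_left h2 (by positivity)).trans hκ1

/-- An exponential tail bound from an exponential moment, with a constant at most `2`. -/
lemma measureReal_le_two_mul_exp {Ω : Type*} [MeasurableSpace Ω] {P : Measure Ω}
    [IsProbabilityMeasure P] {M : Ω → ℝ} {lam C L : ℝ} (hlam : 0 < lam) (hC : 0 ≤ C) (hL : 0 ≤ L)
    (hint : Integrable (fun ω => Real.exp (lam * M ω)) P)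
    (h : ∫ ω, Real.exp (lam * M ω) ∂P ≤ Real.exp (C * L) * 68) {x : ℝ} :
    P.real {ω | (lam / 7)⁻¹ * C * L + x ≤ M ω} ≤ 2 * Real.exp (-(lam / 7 * x)) := by
  have hM : AEMeasurable (fun ω => lam * M ω) P := by
    have h1 := Real.measurable_log.comp_aemeasurable hint.1.aemeasurable
    refine h1.congr (ae_of_all _ fun ω => ?_)
    simp
  have h1 := lintegral_exp_mul_le_rpow hM (by norm_num : (0 : ℝ) < 1 / 7) (by norm_num)
  rw [← ofReal_integral_eq_lintegral_ofReal hint (ae_of_all _ fun ω => (Real.exp_pos _).le),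
    ENNReal.ofReal_rpow_of_nonneg (integral_nonneg fun ω => (Real.exp_pos _).le) (by norm_num)] at h1
  -- the seventh root of `68` is at most `2`
  have h2 : (∫ ω, Real.exp (lam * M ω) ∂P) ^ (1 / 7 : ℝ) ≤ 2 * Real.exp (C * L) := by
    have h3 : (68 : ℝ) ≤ 2 ^ (7 : ℝ) := by norm_num
    have h4 : Real.exp (C * L) ≤ Real.exp (C * L) ^ (7 : ℝ) := by
      conv_lhs => rw [← Real.rpow_one (Real.exp (C * L))]
      exact Real.rpow_le_rpow_of_exponent_le (Real.one_le_exp (by positivity)) (by norm_num)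
    have h5 : Real.exp (C * L) * 68 ≤ (2 * Real.exp (C * L)) ^ (7 : ℝ) := by
      rw [Real.mul_rpow (by norm_num) (Real.exp_pos _).le, mul_comm]
      exact mul_le_mul h3 h4 (Real.exp_pos _).le (by positivity)
    calc _ ≤ ((2 * Real.exp (C * L)) ^ (7 : ℝ)) ^ (1 / 7 : ℝ) :=
          Real.rpow_le_rpow (integral_nonneg fun ω => (Real.exp_pos _).le) (h.trans h5)
            (by norm_num)
      _ = _ := by
          rw [← Real.rpow_mul (by positivity)]
          norm_num
  have h3 := h1.trans (ENNReal.ofReal_le_ofReal h2)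
  have h4 := mul_meas_ge_le_lintegral₀ (μ := P)
    (f := fun ω => ENNReal.ofReal (Real.exp (1 / 7 * (lam * M ω)))) (by fun_prop)
    (ENNReal.ofReal (Real.exp (C * L + lam / 7 * x)))
  have h5 := h4.trans h3
  have hset : {ω | (lam / 7)⁻¹ * C * L + x ≤ M ω} ⊆ {ω | ENNReal.ofReal
      (Real.exp (C * L + lam / 7 * x)) ≤ ENNReal.ofReal (Real.exp (1 / 7 * (lam * M ω)))} := by
    intro ω hω
    refine ENNReal.ofReal_le_ofReal (Real.exp_le_exp.2 ?_)
    have h6 := mul_le_mul_of_nonneg_left (show (lam / 7)⁻¹ * C * L + x ≤ M ω from hω)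
      (by positivity : 0 ≤ lam / 7)
    have h7 : lam / 7 * ((lam / 7)⁻¹ * C * L + x) = C * L + lam / 7 * x := by
      field_simp
    linarith
  have h6 := (mul_le_mul_right (measure_mono hset) _).trans h5
  have h7 : Real.exp (C * L + lam / 7 * x) * P.real {ω | (lam / 7)⁻¹ * C * L + x ≤ M ω} ≤
      2 * Real.exp (C * L) := by
    rw [← ENNReal.ofReal_le_ofReal_iff (by positivity), ENNReal.ofReal_mul (Real.exp_pos _).le,
      ofReal_measureReal]
    exact h6
  have h8 : 2 * Real.exp (C * L) =
      Real.exp (C * L + lam / 7 * x) * (2 * Real.exp (-(lam / 7 * x))) := by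
    rw [mul_left_comm, ← Real.exp_add]
    ring_nf
  rw [h8] at h7
  exact le_of_mul_le_mul_left h7 (Real.exp_pos _)

/-! ### The scale of a sequence -/

lemma gamma_sq {n : ℕ} (x : Fin n → ℝ) : gamma x ^ 2 = gammaSq x :=
  Real.sq_sqrt (by unfold gammaSq; positivity)

lemma sampleEnergy_gamma {n : ℕ} (x : Fin n → ℝ) :
    sampleEnergy (gamma x) x = partialSum x n ^ 2 / n := by
  rw [sampleEnergy, gamma_sq, sub_self]
  ring

lemma le_gamma {n : ℕ} (hn : 1 ≤ n) {x : Fin n → ℝ} {ν : ℝ} (hν : 0 ≤ ν) (h : ∀ i, ν ≤ |x i|) :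
    ν ≤ gamma x := by
  have hn0 : (0 : ℝ) < n := Nat.cast_pos.2 hn
  refine Real.le_sqrt_of_sq_le ?_
  rw [gammaSq, one_div, inv_mul_eq_div, le_div_iff₀ hn0, mul_comm]
  calc (n : ℝ) * ν ^ 2 = ∑ _i : Fin n, ν ^ 2 := by simp
    _ ≤ _ := Finset.sum_le_sum fun i _ => by
      rw [← sq_abs (x i)]
      exact pow_le_pow_left₀ hν (h i) 2

lemma gamma_eq_of_count_eq {r n : ℕ} (a : Fin r → ℝ) {s s' : Fin n → Fin r}
    (h : count s = count s') : (gamma fun i => a (s i)) = gamma fun i => a (s' i) := by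
  rw [gamma, gamma, gammaSq, gammaSq, sum_comp_eq_sum_count s fun i => a i ^ 2,
    sum_comp_eq_sum_count s' fun i => a i ^ 2, h]

lemma exists_pos_le_abs {A : Finset ℝ} (hA : (0 : ℝ) ∉ A) : ∃ ν : ℝ, 0 < ν ∧ ∀ x ∈ A, ν ≤ |x| := by
  rcases A.eq_empty_or_nonempty with rfl | hne
  · exact ⟨1, one_pos, by simp⟩
  · obtain ⟨y, hy, hmin⟩ := A.exists_min_image (fun x => |x|) hne
    exact ⟨|y|, abs_pos.2 fun h => hA (h ▸ hy), hmin⟩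

end ExchangeableEmbedding

theorem theorem1p4 :
    ∃ C : ℝ, 0 < C ∧ C = (2 + Real.log 4) / Real.log (3 / 2) ∧
    ∀ A : Finset ℝ,
      -- first inequality: a deterministic scale `η ≥ ν`
      (∀ ν : ℝ, 0 < ν → ∃ K₁ K₂ lam₀ : ℝ, 0 < K₁ ∧ 0 < K₂ ∧ 0 < lam₀ ∧
        ∀ (n : ℕ), 1 ≤ n → ∀ (η : ℝ), ν ≤ η →
        ∀ (Ω : Type*) [MeasurableSpace Ω] (P : Measure Ω) [IsProbabilityMeasure P]
          (ε : Fin n → Ω → ℝ), Exchangeable ε P → (∀ i, ∀ᵐ ω ∂P, ε i ω ∈ A) →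
        ∃ (Ω' : Type) (_ : MeasurableSpace Ω') (P' : Measure Ω')
          (ε' : Fin n → Ω' → ℝ) (B : unitInterval → Ω' → ℝ), IsCoupling ε P ε' B P' ∧
          ∀ lam : ℝ, lam ≤ lam₀ →
            Integrable (fun ω => Real.exp
              (lam * maxDeviation (fun i => ε' i ω) η (fun t => B t ω))) P' ∧
            ∫ ω, Real.exp (lam * maxDeviation (fun i => ε' i ω) η (fun t => B t ω)) ∂P' ≤
              Real.exp (C * Real.log n) *
                ∫ ω, Real.exp
                  (K₁ * lam ^ 2 * partialSum (fun i => ε i ω) n ^ 2 / n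
                    + K₂ * lam ^ 2 * n * (gammaSq (fun i => ε i ω) - η ^ 2) ^ 2) ∂P) ∧
      -- second inequality and the tail bound: the random scale `γ`, for `0 ∉ A`
      ((0 : ℝ) ∉ A → ∃ K₁ lam₀ lam₁ : ℝ, 0 < K₁ ∧ 0 < lam₀ ∧ 0 < lam₁ ∧
        ∀ (n : ℕ), 1 ≤ n →
        ∀ (Ω : Type*) [MeasurableSpace Ω] (P : Measure Ω) [IsProbabilityMeasure P]
          (ε : Fin n → Ω → ℝ), Exchangeable ε P → (∀ i, ∀ᵐ ω ∂P, ε i ω ∈ A) →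
        ∃ (Ω' : Type) (_ : MeasurableSpace Ω') (P' : Measure Ω')
          (ε' : Fin n → Ω' → ℝ) (B : unitInterval → Ω' → ℝ), IsCoupling ε P ε' B P' ∧
          (∀ lam : ℝ, lam ≤ lam₀ →
            Integrable (fun ω => Real.exp
              (lam * maxDeviation (fun i => ε' i ω) (gamma (fun i => ε' i ω))
                (fun t => B t ω))) P' ∧
            ∫ ω, Real.exp
              (lam * maxDeviation (fun i => ε' i ω) (gamma (fun i => ε' i ω))
                (fun t => B t ω)) ∂P' ≤
              Real.exp (C * Real.log n) *
                ∫ ω, Real.exp (K₁ * lam ^ 2 * partialSum (fun i => ε i ω) n ^ 2 / n) ∂P) ∧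
          (IsIID ε P → (∀ i, P[ε i] = 0) → ∀ x : ℝ, 0 ≤ x →
            P'.real {ω | lam₁⁻¹ * C * Real.log n + x ≤
                maxDeviation (fun i => ε' i ω) (gamma (fun i => ε' i ω)) (fun t => B t ω)}
              ≤ 2 * Real.exp (-(lam₁ * x)))) := by
  have hlog : (0 : ℝ) < Real.log (3 / 2) := Real.log_pos (by norm_num)
  have hlog4 : (0 : ℝ) < Real.log 4 := Real.log_pos (by norm_num)
  have hC : 0 < (2 + Real.log 4) / Real.log (3 / 2) := by positivity
  refine ⟨_, hC, rfl, fun A => ?_⟩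
  set C := (2 + Real.log 4) / Real.log (3 / 2)
  set a : Fin A.card → ℝ := fun i => A.equivFin.symm i with ha_def
  have ha : Function.Injective a := fun i j h => A.equivFin.symm.injective (Subtype.ext h)
  have haA : ∀ i, a i ∈ A := fun i => (A.equivFin.symm i).2
  have hrange : ∀ x ∈ A, x ∈ Set.range a := fun x hx => ⟨A.equivFin ⟨x, hx⟩, by simp [ha_def]⟩
  refine ⟨fun ν hν => ?_, fun h0 => ?_⟩
  · obtain ⟨K, lam₀, hK, hlam, h⟩ := exists_isCoupling_integral_exp_le ha hν hC
    refine ⟨K, K, lam₀, hK, hK, hlam, fun n hn η hη Ω _ P _ ε hexch hmem => ?_⟩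
    obtain ⟨Ω', _, P', ε', B, hPB, hexp⟩ := h n hn (fun _ => η) measurable_const (fun _ => hη)
      (fun _ _ _ => rfl) Ω P ε hexch fun i => (hmem i).mono fun ω hω => hrange _ hω
    refine ⟨Ω', _, P', ε', B, hPB, fun lam h1 => ⟨(hexp lam h1).1, (hexp lam h1).2.trans_eq ?_⟩⟩
    congr 2
    funext ω
    rw [sampleEnergy]
    congr 1
    ring
  · obtain ⟨ν, hν, hνA⟩ := exists_pos_le_abs h0
    obtain ⟨c₀, hc₀⟩ := (A.image fun x => |x|).exists_le
    obtain ⟨c, hc, hcA⟩ : ∃ c : ℝ, 0 < c ∧ ∀ x ∈ A, |x| ≤ c := ⟨max c₀ 1, by positivity,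
      fun x hx => (hc₀ _ (Finset.mem_image_of_mem _ hx)).trans (le_max_left _ _)⟩
    obtain ⟨K, lam₀, hK, hlam, h⟩ := exists_isCoupling_integral_exp_le ha hν hC
    -- an exponent at which the exponential moment of `S_n ^ 2 / n` is bounded in the i.i.d. case
    set lam₂ := min lam₀ (min 1 (1 / (K * (16 * c + 4 * c ^ 2)))) with hlam₂
    have hlam₂0 : 0 < lam₂ := by positivity
    have hlam₂K : K * lam₂ ^ 2 * (16 * c + 4 * c ^ 2) ≤ 1 := by
      have h1 : lam₂ ≤ 1 := (min_le_right _ _).trans (min_le_left _ _)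
      have h2 : lam₂ ≤ 1 / (K * (16 * c + 4 * c ^ 2)) :=
        (min_le_right _ _).trans (min_le_right _ _)
      rw [le_div_iff₀ (by positivity)] at h2
      have h3 : lam₂ ^ 2 ≤ lam₂ := by nlinarith
      calc K * lam₂ ^ 2 * (16 * c + 4 * c ^ 2) = lam₂ ^ 2 * (K * (16 * c + 4 * c ^ 2)) := by ring
        _ ≤ lam₂ * (K * (16 * c + 4 * c ^ 2)) :=
            mul_le_mul_of_nonneg_right h3 (by positivity)
        _ ≤ 1 := h2
    refine ⟨K, lam₀, lam₂ / 7, hK, hlam, by positivity, fun n hn Ω _ P _ ε hexch hmem => ?_⟩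
    obtain ⟨Ω', _, P', ε', B, hPB, hexp⟩ := h n hn gamma measurable_gammaSq.sqrt
      (fun s => le_gamma hn hν.le fun i => hνA _ (haA _)) (fun _ _ => gamma_eq_of_count_eq a)
      Ω P ε hexch fun i => (hmem i).mono fun ω hω => hrange _ hω
    simp_rw [sampleEnergy_gamma, ← mul_div_assoc] at hexp
    refine ⟨Ω', _, P', ε', B, hPB, hexp, fun hiid hmean x _ => ?_⟩
    have hP' := hPB.isProbabilityMeasure
    obtain ⟨hint, hle⟩ := hexp lam₂ (min_le_left _ _)
    refine measureReal_le_two_mul_exp hlam₂0 hC.le (Real.log_natCast_nonneg n) hint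
      (hle.trans (mul_le_mul_of_nonneg_left ?_ (Real.exp_pos _).le))
    have hKc : 0 ≤ K * lam₂ ^ 2 * c := by positivity
    have hKc' : 0 ≤ K * lam₂ ^ 2 * c ^ 2 := by positivity
    have h68 := hiid.lintegral_exp_sq_le hn hmean hc (by positivity : 0 ≤ K * lam₂ ^ 2)
      (by linarith) (by linarith) fun i => (hmem i).mono fun ω hω => hcA _ hω
    rw [integral_eq_lintegral_of_nonneg_ae (Filter.Eventually.of_forall fun ω => (Real.exp_pos _).le)]
    · exact ENNReal.toReal_le_of_le_ofReal (by norm_num) (h68.trans_eq (by norm_num))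
    · exact ((by fun_prop : Measurable fun x : Fin n → ℝ => Real.exp (K * lam₂ ^ 2 *
        partialSum x n ^ 2 / n)).comp_aemeasurable (hexch 1).aemeasurable_snd).aestronglyMeasurable
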